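/- Let $G$ be a Carnot group of step $r$, that is, a simply connected (finite-dimensional, smooth) Lie group whose Lie algebra has a given decomposition $\mathfrak g=\mathfrak g_1\oplus\cdots\oplus\mathfrak g_r$ with $[\mathfrak g_1,\mathfrak g_k]=\mathfrak g_{k+1}$ for $1\le k\le r-1$ and $[\mathfrak g_1,\mathfrak g_r]=0$ (so that $\mathfrak g$ is nilpotent). Put $$\mathfrak p_1=\bigoplus_{k\text{ odd}}\mathfrak g_k,\qquad \mathfrak p_2=\bigoplus_{k\text{ even},\,k\le\lfloor r/2\rfloor}\mathfrak g_k,\qquad \mathfrak k=\bigoplus_{k\text{ even},\,k>\lfloor r/2\rfloor}\mathfrak g_k,$$ and let $D$ and $V$ be the subbundles of $TG$ obtained by left translation of $\mathfrak p_1\oplus\mathfrak p_2$ and $\mathfrak k$, respectively. (a) There exists a smooth Riemannian metric on $G$ for which $D$ and $V$ are orthogonal and the foliation tangent to $V$ is totally geodesic (that is, for the Levi-Civita connection $\nabla$ and all smooth sections $Y,Z$ of $V$, the vector field $\nabla_ZY$ is again a section of $V$) if and only if $[\mathfrak p_2,\mathfrak k]=0$. (b) Let $K$ be the connected subgroup of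 $G$ corresponding to $\mathfrak k$, that is, the subgroup generated by $\exp(\mathfrak k)$. Then $G/K$, with the quotient topology, is a Hausdorff smooth manifold for a structure making $\pi\colon G\to G/K$ a smooth submersion, $D$ is an Ehresmann connection on $\pi$ (i.e. $TG=D\oplus\ker\pi_*$), and $D$ can be made principal if and only if $[\mathfrak p_2,\mathfrak k]=0$. Here "$D$ can be made principal" means that there are a connected Lie group $L$ and a smooth right action of $L$ on $G$ that makes $\pi$ a smooth principal $L$-bundle (the action preserves the fibers of $\pi$, is free and transitive on each of them, and $\pi$ has smooth $L$-equivariant local trivializations) and leaves $D$ invariant, i.e. the differential of $p\mapsto p\cdot a$ maps $D_p$ onto $D_{p\cdot a}$ for all $p\in G$, $a\in L$. -/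

import Mathlib

open scoped Manifold ContDiff Topology

noncomputable section

namespace CarnotFoliation

section LieGroups

variable {E : Type*} [NormedAddCommGroup E] [NormedSpace ℝ E]
  {H : Type*} [TopologicalSpace H] (I : ModelWithCorners ℝ E H)
  (G : Type*) [TopologicalSpace G] [ChartedSpace H G] [Group G]

/-- The span `[𝔞, 𝔟]` of all brackets of elements of two subspaces of the Lie algebra of `G`. -/
def bracketSpan (𝔞 𝔟 : Submodule ℝ (GroupLieAlgebra I G)) :
    Submodule ℝ (GroupLieAlgebra I G) :=
  Submodule.span ℝ {z | ∃ x ∈ 𝔞, ∃ y ∈ 𝔟, ⁅x, y⁆ = z}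

/-- A Carnot grading `𝔤 = 𝔤₁ ⊕ ⋯ ⊕ 𝔤ᵣ` of the Lie algebra of `G`. The layers are indexed by `ℕ`;
those whose index is not in `{1, …, r}` are zero. -/
structure IsCarnotGrading (r : ℕ) (layer : ℕ → Submodule ℝ (GroupLieAlgebra I G)) : Prop where
  isInternal : DirectSum.IsInternal layer
  layer_zero : layer 0 = ⊥
  layer_of_lt : ∀ k, r < k → layer k = ⊥
  bracket_layer : ∀ k, 1 ≤ k → k < r → bracketSpan I G (layer 1) (layer k) = layer (k + 1)
  bracket_last : bracketSpan I G (layer 1) (layer r) = ⊥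

variable {I G}

/-- `𝔭₁`: the sum of the layers of odd index. -/
def oddPart (layer : ℕ → Submodule ℝ (GroupLieAlgebra I G)) :
    Submodule ℝ (GroupLieAlgebra I G) :=
  ⨆ k : ℕ, ⨆ _ : Odd k, layer k

/-- `𝔭₂`: the sum of the layers of even index at most `⌊r / 2⌋`. -/
def lowEvenPart (r : ℕ) (layer : ℕ → Submodule ℝ (GroupLieAlgebra I G)) :
    Submodule ℝ (GroupLieAlgebra I G) :=
  ⨆ k : ℕ, ⨆ _ : Even k ∧ k ≤ r / 2, layer k

/-- `𝔨`: the sum of the layers of even index greater than `⌊r / 2⌋`. -/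
def highEvenPart (r : ℕ) (layer : ℕ → Submodule ℝ (GroupLieAlgebra I G)) :
    Submodule ℝ (GroupLieAlgebra I G) :=
  ⨆ k : ℕ, ⨆ _ : Even k ∧ r / 2 < k, layer k

/-- The subbundle of `TG` obtained by left translation of a subspace of the Lie algebra. Its fibre
at `g` is the image of `𝔞` under the differential at `1` of `x ↦ g * x`. -/
def leftTranslate (𝔞 : Submodule ℝ (GroupLieAlgebra I G)) (g : G) :
    Submodule ℝ (TangentSpace I g) where
  carrier := {w | ∃ v ∈ 𝔞, mulInvariantVectorField v g = w}
  zero_mem' := ⟨0, 𝔞.zero_mem, by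
    have h := congrFun (mulInvariantVectorField_smul (I := I) (G := G) (0 : ℝ) 0) g
    simpa using! h⟩
  add_mem' := by
    rintro _ _ ⟨v, hv, rfl⟩ ⟨w, hw, rfl⟩
    exact ⟨v + w, 𝔞.add_mem hv hw, congrFun (mulInvariantVectorField_add v w) g⟩
  smul_mem' := by
    rintro c _ ⟨v, hv, rfl⟩
    exact ⟨c • v, 𝔞.smul_mem c hv, congrFun (mulInvariantVectorField_smul c v) g⟩

/-- The connected subgroup of `G` corresponding to a Lie subalgebra `𝔥`: the subgroup generated by
the elements `exp v = γ 1`, where `v ∈ 𝔥` and `γ` is the integral curve through `1` of the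
left-invariant vector field defined by `v`. -/
def connectedSubgroup (𝔥 : Submodule ℝ (GroupLieAlgebra I G)) : Subgroup G :=
  Subgroup.closure {x | ∃ v ∈ 𝔥, ∃ γ : ℝ → G,
    γ 0 = 1 ∧ IsMIntegralCurve γ (mulInvariantVectorField (I := I) v) ∧ γ 1 = x}

end LieGroups

section Riemannian

variable {E : Type*} [NormedAddCommGroup E] [NormedSpace ℝ E]
  {H : Type*} [TopologicalSpace H] {I : ModelWithCorners ℝ E H}
  {M : Type*} [TopologicalSpace M] [ChartedSpace H M] [IsManifold I ∞ M]

/-- `cov` is the Levi-Civita connection of the Riemannian metric `g`: it is torsion free and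
`g` is parallel. (`cov Y x v` is the covariant derivative of `Y` at `x` in the direction `v`.) -/
structure IsLeviCivita
    (g : Bundle.ContMDiffRiemannianMetric I ∞ E (fun x : M ↦ TangentSpace I x))
    (cov : CovariantDerivative I E (fun x : M ↦ TangentSpace I x)) : Prop where
  torsion_free : ∀ (X Y : Π x : M, TangentSpace I x) (x : M),
    MDiffAt (T% X) x → MDiffAt (T% Y) x →
      cov Y x (X x) - cov X x (Y x) = VectorField.mlieBracket I X Y x
  metric : ∀ (Y Z : Π x : M, TangentSpace I x) (x : M) (v : TangentSpace I x),
    MDiffAt (T% Y) x → MDiffAt (T% Z) x →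
      d% (fun y ↦ g.inner y (Y y) (Z y)) x v =
        g.inner x (cov Y x v) (Z x) + g.inner x (Y x) (cov Z x v)

/-- The foliation tangent to the subbundle `V` is totally geodesic for the metric `g`: the second
fundamental form of the leaves vanishes, that is, the Levi-Civita derivative `∇_Z Y` of smooth
sections `Y`, `Z` of `V` is again tangent to `V`. -/
def IsTotallyGeodesic
    (g : Bundle.ContMDiffRiemannianMetric I ∞ E (fun x : M ↦ TangentSpace I x))
    (V : Π x : M, Submodule ℝ (TangentSpace I x)) : Prop :=
  ∃ cov : CovariantDerivative I E (fun x : M ↦ TangentSpace I x), IsLeviCivita g cov ∧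
    ∀ Y Z : Π x : M, TangentSpace I x, CMDiff ∞ (T% Y) → CMDiff ∞ (T% Z) →
      (∀ x, Y x ∈ V x) → (∀ x, Z x ∈ V x) → ∀ x, cov Y x (Z x) ∈ V x

/-- The subbundles `D` and `V` are orthogonal for the metric `g`. -/
def AreOrthogonal
    (g : Bundle.ContMDiffRiemannianMetric I ∞ E (fun x : M ↦ TangentSpace I x))
    (D V : Π x : M, Submodule ℝ (TangentSpace I x)) : Prop :=
  ∀ x, ∀ u ∈ D x, ∀ v ∈ V x, g.inner x u v = 0

end Riemannian

section Bundles

variable {E : Type*} [NormedAddCommGroup E] [NormedSpace ℝ E]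
  {H : Type*} [TopologicalSpace H] (I : ModelWithCorners ℝ E H)
  {P : Type*} [TopologicalSpace P] [ChartedSpace H P]
  {E' : Type*} [NormedAddCommGroup E'] [NormedSpace ℝ E']
  {H' : Type*} [TopologicalSpace H'] (J : ModelWithCorners ℝ E' H')
  {B : Type*} [TopologicalSpace B] [ChartedSpace H' B]
  {E'' : Type*} [NormedAddCommGroup E''] [NormedSpace ℝ E'']
  {H'' : Type*} [TopologicalSpace H''] (IL : ModelWithCorners ℝ E'' H'')
  {L : Type*} [TopologicalSpace L] [ChartedSpace H'' L] [Group L]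

/-- `π : P → B` is a smooth surjective submersion. -/
structure IsSurjectiveSubmersion (π : P → B) : Prop where
  contMDiff : ContMDiff I J ∞ π
  surjective : Function.Surjective π
  mfderiv_surjective : ∀ p, Function.Surjective (mfderiv I J π p)

/-- `D` is an Ehresmann connection on `π`: it is complementary to the vertical bundle `ker dπ`. -/
def IsEhresmannConnection (π : P → B) (D : Π p : P, Submodule ℝ (TangentSpace I p)) : Prop :=
  ∀ p, IsCompl (D p) (LinearMap.ker (mfderiv I J π p).toLinearMap)

/-- The map `act : P → L → P` is a smooth right action of the Lie group `L` making `π : P → B` a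
smooth principal `L`-bundle: it preserves the fibres of `π`, is free and transitive on each of
them, and `π` has smooth equivariant local trivializations. -/
structure IsPrincipalBundle (π : P → B) (act : P → L → P) : Prop where
  act_one : ∀ p, act p 1 = p
  act_mul : ∀ p a b, act p (a * b) = act (act p a) b
  contMDiff_act : ContMDiff (I.prod IL) I ∞ (fun q : P × L ↦ act q.1 q.2)
  proj_act : ∀ p a, π (act p a) = π p
  free : ∀ p a, act p a = p → a = 1
  transitive : ∀ p q, π p = π q → ∃ a, act p a = q
  locally_trivial : ∀ b : B, ∃ e : Bundle.Trivialization L π, b ∈ e.baseSet ∧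
    ContMDiffOn I (J.prod IL) ∞ e e.source ∧
    ContMDiffOn (J.prod IL) I ∞ e.toOpenPartialHomeomorph.symm e.target ∧
    ∀ p ∈ e.source, ∀ a, (e (act p a)).2 = (e p).2 * a

/-- The subbundle `D` of `TP` is invariant under the right action `act`, that is, the image of
`D p` under the differential of `act · a` is the fibre of `D` at `act p a`. -/
def IsInvariant (act : P → L → P) (D : Π p : P, Submodule ℝ (TangentSpace I p)) : Prop :=
  ∀ p a, (D p).map (mfderiv I I (fun q ↦ act q a) p).toLinearMap = D (act p a)

/-- The Ehresmann connection `D` on `π` can be made principal: there are a connected Lie group `L`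
and a right action of `L` on `P` such that `π` is a smooth principal `L`-bundle and `D` is
invariant under `L`. -/
def CanBeMadePrincipal (π : P → B) (D : Π p : P, Submodule ℝ (TangentSpace I p)) : Prop :=
  ∃ (d : ℕ) (L : Type) (_ : TopologicalSpace L) (_ : ChartedSpace (EuclideanSpace ℝ (Fin d)) L)
    (_ : Group L) (_ : LieGroup 𝓘(ℝ, EuclideanSpace ℝ (Fin d)) ∞ L) (_ : ConnectedSpace L)
    (act : P → L → P),
    IsPrincipalBundle I J 𝓘(ℝ, EuclideanSpace ℝ (Fin d)) π act ∧ IsInvariant I act D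

end Bundles

end CarnotFoliation

end

/-!
Let `w` be the derivation of the Lie algebra acting on the `k`-th layer as multiplication by `k`.
In the left-invariant frame the one-form `X ↦ Ad g (w X)` is closed by the Jacobi identity, hence
exact since `G` is simply connected. Its primitive is a diffeomorphism from `G` onto the Lie
algebra, which replaces the exponential map and makes the Baker–Campbell–Hausdorff formula
unnecessary. The layers of index greater than `r / 2` form an abelian ideal, on which `exp` is
additive; in coordinates adapted to it, right multiplication by `exp Y` is translation by `Y`.
Hence `K = exp 𝔨` and `G ⧸ K` is a vector space.

If `[𝔭₂, 𝔨] = 0`, then right multiplication by `exp 𝔨` preserves `D`, as `Ad` of `exp 𝔨` maps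
`𝔭₁ ⊕ 𝔭₂` into itself, and by the Koszul formula every left-invariant metric with
`𝔭₁ ⊕ 𝔭₂ ⟂ 𝔨` is totally geodesic. Conversely, parity gives `[𝔭₁, 𝔨] ⊆ 𝔭₁`, so derivatives along
the generating layer `𝔤₁` vanish for the quantities that obstruct the converse. For a totally
geodesic metric these are the inner products of left-invariant sections of `V`: they are constant,
so `ad X` is skew on `𝔨` for `X ∈ 𝔭₂`, and being nilpotent it is zero. For a principal action they
are the displacements `p ↦ p⁻¹ (p · a) ∈ K`: they are constant, so the action is right
multiplication by elements of `K`, and its differential can preserve `D` only if `[𝔭₂, 𝔨] = 0`.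
-/

noncomputable section

namespace CarnotFoliation

section Gluing

variable {X F : Type*} [TopologicalSpace X] [AddCommGroup F]

/-- The fibre bundle of germs of local functions with prescribed differences: over `U i` it is
trivialized by `f i`, and the transition functions are the differences `f i - f j`, which are
locally constant, so that the fibre `F` may carry the discrete topology. -/
def gluingBundle [TopologicalSpace F] [DiscreteTopology F] (U : X → Set X)
    (hU : ∀ i, IsOpen (U i)) (hmem : ∀ x, x ∈ U x) (f : X → X → F)
    (hf : ∀ i j, ∀ x ∈ U i ∩ U j, ∀ᶠ y in 𝓝 x, f i y - f j y = f i x - f j x) :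
    FiberBundleCore X X F where
  baseSet := U
  isOpen_baseSet := hU
  indexAt := id
  mem_baseSet_at := hmem
  coordChange i j x v := v + (f i x - f j x)
  coordChange_self := by simp
  continuousOn_coordChange := by
    rintro i j ⟨x, v⟩ ⟨hx, -⟩
    have heq : (fun p : X × F ↦ p.2 + (f i x - f j x)) =ᶠ[𝓝 (x, v)]
        fun p ↦ p.2 + (f i p.1 - f j p.1) := by
      filter_upwards [(hf i j x hx).prod_inl_nhds v] with p hp
      rw [hp]
    have hcont : Continuous fun p : X × F ↦ p.2 + (f i x - f j x) :=
      (continuous_of_discreteTopology (f := fun w : F ↦ w + (f i x - f j x))).comp continuous_snd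
    exact (hcont.continuousAt.congr heq).continuousWithinAt
  coordChange_comp := by
    intros
    abel

/-- Local functions with locally constant differences glue, up to locally constant functions: the
bundle they define has discrete fibres, so it is a covering and has a global section. -/
theorem exists_forall_eventually_sub_eq [SimplyConnectedSpace X] [LocallyPathConnectedSpace X]
    (U : X → Set X) (hU : ∀ i, IsOpen (U i)) (hmem : ∀ x, x ∈ U x) (f : X → X → F)
    (hf : ∀ i j, ∀ x ∈ U i ∩ U j, ∀ᶠ y in 𝓝 x, f i y - f j y = f i x - f j x) :
    ∃ g : X → F, ∀ i, ∀ x ∈ U i, ∀ᶠ y in 𝓝 x, g y - f i y = g x - f i x := by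
  let : TopologicalSpace F := ⊥
  have : DiscreteTopology F := ⟨rfl⟩
  let Z := gluingBundle U hU hmem f hf
  have hcover : IsCoveringMap Z.proj := IsFiberBundle.isCoveringMap (F := F)
    fun x ↦ ⟨Z.localTriv x, hmem x⟩
  obtain ⟨x₀⟩ : Nonempty X := inferInstance
  obtain ⟨s, ⟨-, hs⟩, -⟩ := hcover.existsUnique_continuousMap_lifts (ContinuousMap.id X) x₀
    (⟨x₀, (0 : F)⟩ : Z.TotalSpace) rfl
  have hproj (x : X) : (s x).proj = x := congrFun hs x
  let value (x : X) : F := (s x).2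
  have htriv (i y : X) : (Z.localTriv i (s y)).2 = value y + f y y - f i y := by
    rw [FiberBundleCore.localTriv_apply]
    change value y + (f (s y).proj (s y).proj - f i (s y).proj) = _
    rw [hproj, add_sub_assoc]
  refine ⟨fun x ↦ value x + f x x, fun i x hx ↦ ?_⟩
  have hcont : ContinuousAt (fun y ↦ (Z.localTriv i (s y)).2) x := by
    refine continuous_snd.continuousAt.comp (ContinuousAt.comp ?_ s.continuous.continuousAt)
    apply (Z.localTriv i).continuousAt
    rw [FiberBundleCore.mem_localTriv_source, hproj]
    exact hx
  rw [ContinuousAt, nhds_discrete F, Filter.tendsto_pure] at hcont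
  filter_upwards [hcont] with y hy
  rwa [htriv, htriv] at hy

end Gluing

section LeftChart

variable {E : Type*} [NormedAddCommGroup E]
  {G : Type*} [TopologicalSpace G] [ChartedSpace E G] [Group G]

variable (E) in
/-- The left translate to `g` of the preferred chart at `1`. -/
def leftChart (g : G) : PartialEquiv G E :=
  (Equiv.mulLeft g⁻¹).transPartialEquiv (chartAt E (1 : G)).toPartialEquiv

variable (E G) in
/-- The point of the model space which corresponds to `g` in the left chart at `g`, for every
`g`. -/
def basePt : E := chartAt E (1 : G) 1

theorem leftChart_symm_apply (g : G) (u : E) :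
    (leftChart E g).symm u = g * (chartAt E (1 : G)).symm u := by
  simp [leftChart]

theorem leftChart_mul_symm_apply (g h : G) (u : E) :
    (leftChart E (g * h)).symm u = g * (leftChart E h).symm u := by
  rw [leftChart_symm_apply, mul_assoc, leftChart_symm_apply]

theorem basePt_mem_target (g : G) : basePt E G ∈ (leftChart E g).target := mem_chart_target E 1

theorem isOpen_leftChart_target (g : G) : IsOpen (leftChart E g).target :=
  (chartAt E (1 : G)).open_target

theorem leftChart_target_mem_nhds (g : G) : (leftChart E g).target ∈ 𝓝 (basePt E G) :=
  (isOpen_leftChart_target g).mem_nhds (basePt_mem_target g)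

theorem mem_leftChart_source (g : G) : g ∈ (leftChart E g).source := by
  change g⁻¹ * g ∈ (chartAt E (1 : G)).source
  simp

@[simp]
theorem leftChart_self (g : G) : leftChart E g g = basePt E G := by
  simp [leftChart, basePt]

@[simp]
theorem leftChart_symm_basePt (g : G) : (leftChart E g).symm (basePt E G) = g := by
  simp [leftChart_symm_apply, basePt]

variable [NormedSpace ℝ E] [LieGroup 𝓘(ℝ, E) ∞ G]

theorem isOpen_leftChart_source (g : G) : IsOpen (leftChart E g).source :=
  (chartAt E (1 : G)).open_source.preimage
    (contMDiff_mul_left (I := 𝓘(ℝ, E)) (n := ∞) (a := g⁻¹)).continuous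

theorem contMDiffAt_leftChart {g x : G} (hx : x ∈ (leftChart E g).source) :
    ContMDiffAt 𝓘(ℝ, E) 𝓘(ℝ, E) ∞ (leftChart E g) x := by
  have hchart : ContMDiffAt 𝓘(ℝ, E) 𝓘(ℝ, E) ∞ (chartAt E (1 : G)) (g⁻¹ * x) :=
    contMDiffOn_chart.contMDiffAt ((chartAt E (1 : G)).open_source.mem_nhds hx)
  exact hchart.comp x contMDiffAt_mul_left

theorem contMDiffAt_leftChart_symm {g : G} {u : E} (hu : u ∈ (leftChart E g).target) :
    ContMDiffAt 𝓘(ℝ, E) 𝓘(ℝ, E) ∞ (leftChart E g).symm u := by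
  have hchart : ContMDiffAt 𝓘(ℝ, E) 𝓘(ℝ, E) ∞ (chartAt E (1 : G)).symm u :=
    contMDiffOn_chart_symm.contMDiffAt ((chartAt E (1 : G)).open_target.mem_nhds hu)
  have hmul := (contMDiff_mul_left (I := 𝓘(ℝ, E)) (n := ∞) (a := g)).contMDiffAt.comp u hchart
  exact hmul.congr_of_eventuallyEq (.of_forall fun v ↦ by simp [leftChart_symm_apply])

theorem tendsto_leftChart_symm (g : G) :
    Filter.Tendsto (leftChart E g).symm (𝓝 (basePt E G)) (𝓝 g) := by
  simpa only [leftChart_symm_basePt] using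
    (contMDiffAt_leftChart_symm (basePt_mem_target (E := E) g)).continuousAt.tendsto

variable {F : Type*} [NormedAddCommGroup F] [NormedSpace ℝ F]

theorem contMDiffAt_iff_comp_leftChart_symm {n : ℕ∞} {f : G → F} {g : G} {u : E}
    (hu : u ∈ (leftChart E g).target) :
    ContMDiffAt 𝓘(ℝ, E) 𝓘(ℝ, F) n f ((leftChart E g).symm u) ↔
      ContDiffAt ℝ n (f ∘ (leftChart E g).symm) u := by
  have hn : (n : ℕ∞ω) ≤ ∞ := by exact_mod_cast le_top
  refine ⟨fun hf ↦ (hf.comp u ((contMDiffAt_leftChart_symm hu).of_le hn)).contDiffAt,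
    fun hf ↦ ?_⟩
  have hx := (leftChart E g).map_target hu
  have hf' : ContMDiffAt 𝓘(ℝ, E) 𝓘(ℝ, F) n (f ∘ (leftChart E g).symm)
      (leftChart E g ((leftChart E g).symm u)) := by
    rw [(leftChart E g).right_inv hu]
    exact hf.contMDiffAt
  refine (hf'.comp _ ((contMDiffAt_leftChart hx).of_le hn)).congr_of_eventuallyEq ?_
  filter_upwards [(isOpen_leftChart_source g).mem_nhds hx] with y hy
  simp [(leftChart E g).left_inv hy]

theorem contMDiffAt_iff_comp_leftChart_symm_basePt {n : ℕ∞} {f : G → F} {g : G} :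
    ContMDiffAt 𝓘(ℝ, E) 𝓘(ℝ, F) n f g ↔
      ContDiffAt ℝ n (f ∘ (leftChart E g).symm) (basePt E G) := by
  rw [← contMDiffAt_iff_comp_leftChart_symm (basePt_mem_target g), leftChart_symm_basePt]

theorem differentiableAt_comp_leftChart_symm {f : G → F} {g : G}
    (hf : MDifferentiableAt 𝓘(ℝ, E) 𝓘(ℝ, F) f g) :
    DifferentiableAt ℝ (f ∘ (leftChart E g).symm) (basePt E G) := by
  rw [← leftChart_symm_basePt (E := E) g] at hf
  exact (hf.comp (basePt E G) ((contMDiffAt_leftChart_symm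
    (basePt_mem_target g)).mdifferentiableAt (by simp))).differentiableAt

end LeftChart

section LeftFrame

variable {E : Type*} [NormedAddCommGroup E] [NormedSpace ℝ E]
  {G : Type*} [TopologicalSpace G] [ChartedSpace E G] [Group G]

variable (E) in
/-- The differential at `x` of the left translation by `a`, as an endomorphism of the model space.
Forgetting the base points makes the chain rule for `a * (b * x) = (a * b) * x` typecheck. -/
def mulLeftDeriv (a x : G) : E →L[ℝ] E :=
  mfderiv 𝓘(ℝ, E) 𝓘(ℝ, E) (fun y : G ↦ a * y) x

@[simp]
theorem mulLeftDeriv_one (x : G) : mulLeftDeriv E 1 x = ContinuousLinearMap.id ℝ E := by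
  have hone : (fun y : G ↦ 1 * y) = id := funext one_mul
  rw [mulLeftDeriv, hone]
  exact mfderiv_id

variable [LieGroup 𝓘(ℝ, E) ∞ G]

theorem mdifferentiableAt_mul_left (a x : G) :
    MDifferentiableAt 𝓘(ℝ, E) 𝓘(ℝ, E) (fun y ↦ a * y) x :=
  (contMDiff_mul_left (I := 𝓘(ℝ, E)) (n := ∞)).mdifferentiable (by simp) x

theorem mulLeftDeriv_mul (a b x : G) :
    mulLeftDeriv E (a * b) x = mulLeftDeriv E a (b * x) ∘L mulLeftDeriv E b x := by
  have hcomp : (fun y ↦ a * b * y) = (fun y ↦ a * y) ∘ fun y ↦ b * y :=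
    funext fun y ↦ mul_assoc a b y
  rw [mulLeftDeriv, hcomp]
  exact mfderiv_comp x (mdifferentiableAt_mul_left a (b * x)) (mdifferentiableAt_mul_left b x)

variable (E) in
/-- The left trivialization of the tangent bundle: `leftFrame E g` is the differential at `1` of
the left translation by `g`. -/
def leftFrame (g : G) : E ≃L[ℝ] E :=
  .equivOfInverse (mulLeftDeriv E g 1) (mulLeftDeriv E g⁻¹ g)
    (fun X ↦ by simpa using congr($(mulLeftDeriv_mul g⁻¹ g 1) X).symm)
    (fun X ↦ by simpa using congr($(mulLeftDeriv_mul g g⁻¹ g) X).symm)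

theorem mfderiv_mul_left_leftFrame (g h : G) (X : E) :
    mfderiv 𝓘(ℝ, E) 𝓘(ℝ, E) (fun x : G ↦ g * x) h (leftFrame E h X) =
      leftFrame E (g * h) X := by
  have hmul := congr($(mulLeftDeriv_mul (E := E) g h 1) X)
  rw [mul_one] at hmul
  exact hmul.symm

end LeftFrame

section LeftDerivative

variable {E : Type*} [NormedAddCommGroup E] [NormedSpace ℝ E]
  {G : Type*} [TopologicalSpace G] [ChartedSpace E G] [Group G]
  {F : Type*} [NormedAddCommGroup F] [NormedSpace ℝ F]

/-- The derivative of a vector-valued function on a Lie group in the left trivialization of the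
tangent bundle: the derivative at the base point of its expression in the left chart. -/
def leftDeriv (f : G → F) (g : G) : E →L[ℝ] F :=
  fderiv ℝ (f ∘ (leftChart E g).symm) (basePt E G)

theorem leftDeriv_comp_mul_left (f : G → F) (h g : G) :
    leftDeriv (E := E) (fun x ↦ f (h * x)) g = leftDeriv f (h * g) := by
  simp only [leftDeriv, Function.comp_def, leftChart_mul_symm_apply]

@[simp]
theorem leftDeriv_const (c : F) (g : G) : leftDeriv (E := E) (fun _ ↦ c) g = 0 := by
  simp [leftDeriv, Function.comp_def]

theorem leftDeriv_leftChart_self (g : G) :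
    leftDeriv (leftChart E g) g = ContinuousLinearMap.id ℝ E := by
  have hid : leftChart E g ∘ (leftChart E g).symm =ᶠ[𝓝 (basePt E G)] id := by
    filter_upwards [leftChart_target_mem_nhds g] with u hu
    exact (leftChart E g).right_inv hu
  rw [leftDeriv, hid.fderiv_eq, fderiv_id]

variable [LieGroup 𝓘(ℝ, E) ∞ G]

theorem hasFDerivAt_leftDeriv {f : G → F} {g : G}
    (hf : MDifferentiableAt 𝓘(ℝ, E) 𝓘(ℝ, F) f g) :
    HasFDerivAt (f ∘ (leftChart E g).symm) (leftDeriv f g) (basePt E G) :=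
  (differentiableAt_comp_leftChart_symm hf).hasFDerivAt

theorem leftDeriv_congr {f f' : G → F} {g : G} (h : f =ᶠ[𝓝 g] f') :
    leftDeriv (E := E) f g = leftDeriv f' g :=
  Filter.EventuallyEq.fderiv_eq (h.comp_tendsto (tendsto_leftChart_symm g))

theorem mfderiv_leftFrame {f : G → F} {g : G}
    (hf : MDifferentiableAt 𝓘(ℝ, E) 𝓘(ℝ, F) f g) (X : E) :
    mfderiv 𝓘(ℝ, E) 𝓘(ℝ, F) f g (leftFrame E g X) = leftDeriv f g X := by
  have hf' : MDifferentiableAt 𝓘(ℝ, E) 𝓘(ℝ, F) f (g * 1) := by rwa [mul_one]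
  have hmul := mdifferentiableAt_mul_left (E := E) g 1
  have hone : mfderiv 𝓘(ℝ, E) 𝓘(ℝ, F) (f ∘ fun x ↦ g * x) 1 = leftDeriv (E := E) f g := by
    rw [(hf'.comp 1 hmul).mfderiv]
    simp only [writtenInExtChartAt, extChartAt, mfld_simps]
    simp [leftDeriv, Function.comp_def, leftChart_symm_apply, basePt]
    rfl
  have hchain := congr($(mfderiv_comp (1 : G) hf' hmul) X)
  rw [hone, mul_one] at hchain
  exact hchain.symm

theorem leftDeriv_sub {f f' : G → F} {g : G} (hf : MDifferentiableAt 𝓘(ℝ, E) 𝓘(ℝ, F) f g)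
    (hf' : MDifferentiableAt 𝓘(ℝ, E) 𝓘(ℝ, F) f' g) :
    leftDeriv (E := E) (fun x ↦ f x - f' x) g = leftDeriv f g - leftDeriv f' g :=
  ((hasFDerivAt_leftDeriv hf).sub (hasFDerivAt_leftDeriv hf')).fderiv

theorem leftDeriv_add_const {f : G → F} {g : G} (hf : MDifferentiableAt 𝓘(ℝ, E) 𝓘(ℝ, F) f g)
    (c : F) : leftDeriv (E := E) (fun x ↦ f x + c) g = leftDeriv f g :=
  ((hasFDerivAt_leftDeriv hf).add_const c).fderiv

theorem leftDeriv_clm_apply {A : G → E →L[ℝ] F} {g : G}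
    (hA : MDifferentiableAt 𝓘(ℝ, E) 𝓘(ℝ, E →L[ℝ] F) A g) (X Y : E) :
    leftDeriv (fun h ↦ A h Y) g X = leftDeriv A g X Y := by
  have hasDeriv := (hasFDerivAt_leftDeriv hA).clm_apply (hasFDerivAt_const Y (basePt E G))
  exact congr($hasDeriv.fderiv X).trans (by simp)

theorem leftDeriv_clm_comp {F' : Type*} [NormedAddCommGroup F'] [NormedSpace ℝ F']
    {A : G → F →L[ℝ] F'} {B : G → E →L[ℝ] F} {g : G}
    (hA : MDifferentiableAt 𝓘(ℝ, E) 𝓘(ℝ, F →L[ℝ] F') A g)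
    (hB : MDifferentiableAt 𝓘(ℝ, E) 𝓘(ℝ, E →L[ℝ] F) B g) (X Y : E) :
    leftDeriv (fun x ↦ A x ∘L B x) g X Y =
      A g (leftDeriv B g X Y) + leftDeriv A g X (B g Y) := by
  have hasDeriv := (hasFDerivAt_leftDeriv hA).clm_comp (hasFDerivAt_leftDeriv hB)
  exact congr($hasDeriv.fderiv X Y).trans (by simp)

theorem leftDeriv_comp {F' : Type*} [NormedAddCommGroup F'] [NormedSpace ℝ F'] {φ : F → F'}
    {φ' : F →L[ℝ] F'} {f : G → F} {g : G} (hφ : HasFDerivAt φ φ' (f g))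
    (hf : MDifferentiableAt 𝓘(ℝ, E) 𝓘(ℝ, F) f g) :
    leftDeriv (E := E) (φ ∘ f) g = φ' ∘L leftDeriv f g := by
  have hφ_base : HasFDerivAt φ φ' ((f ∘ (leftChart E g).symm) (basePt E G)) := by simpa using hφ
  exact (hφ_base.comp (basePt E G) (hasFDerivAt_leftDeriv hf)).fderiv

theorem contDiffAt_comp_prodMap_leftChart_symm {f : G × G → F} {g h : G}
    (hf : ContMDiffAt (𝓘(ℝ, E).prod 𝓘(ℝ, E)) 𝓘(ℝ, F) ∞ f (g, h)) :
    ContDiffAt ℝ ∞ (f ∘ Prod.map (leftChart E g).symm (leftChart E h).symm)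
      (basePt E G, basePt E G) := by
  have hcharts : ContMDiffAt (𝓘(ℝ, E).prod 𝓘(ℝ, E)) (𝓘(ℝ, E).prod 𝓘(ℝ, E)) ∞
      (Prod.map (leftChart E g).symm (leftChart E h).symm) (basePt E G, basePt E G) :=
    (contMDiffAt_leftChart_symm (basePt_mem_target g)).prodMap
      (contMDiffAt_leftChart_symm (basePt_mem_target h))
  have hcomp := ContMDiffAt.comp (basePt E G, basePt E G) (by simpa using hf) hcharts
  rw [← modelWithCornersSelf_prod, chartedSpaceSelf_prod] at hcomp
  exact hcomp.contDiffAt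

theorem contMDiffAt_leftDeriv_right {f : G → G → F} {g h : G}
    (hf : ContMDiffAt (𝓘(ℝ, E).prod 𝓘(ℝ, E)) 𝓘(ℝ, F) ∞ (Function.uncurry f) (g, h)) :
    ContMDiffAt 𝓘(ℝ, E) 𝓘(ℝ, E →L[ℝ] F) ∞ (fun x ↦ leftDeriv (E := E) (f x) h) g :=
  contMDiffAt_iff_comp_leftChart_symm_basePt (n := ⊤) |>.2 <|
    ContDiffAt.fderiv (g := fun _ ↦ basePt E G) (m := ∞) (n := ∞)
      (contDiffAt_comp_prodMap_leftChart_symm hf) contDiffAt_const le_rfl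

theorem contMDiffAt_leftDeriv {f : G → F} {g : G} (hf : ContMDiffAt 𝓘(ℝ, E) 𝓘(ℝ, F) ∞ f g) :
    ContMDiffAt 𝓘(ℝ, E) 𝓘(ℝ, E →L[ℝ] F) ∞ (leftDeriv (E := E) f) g := by
  have hmul : ContMDiffAt (𝓘(ℝ, E).prod 𝓘(ℝ, E)) 𝓘(ℝ, F) ∞
      (Function.uncurry fun x y ↦ f (x * y)) (g, 1) :=
    ContMDiffAt.comp (g, 1) (by simpa using hf) (contMDiffAt_fst.mul contMDiffAt_snd)
  simpa only [leftDeriv_comp_mul_left, mul_one] using contMDiffAt_leftDeriv_right hmul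

theorem contMDiff_leftDeriv {f : G → F} (hf : ContMDiff 𝓘(ℝ, E) 𝓘(ℝ, F) ∞ f) :
    ContMDiff 𝓘(ℝ, E) 𝓘(ℝ, E →L[ℝ] F) ∞ (leftDeriv (E := E) f) :=
  fun g ↦ contMDiffAt_leftDeriv (hf g)

end LeftDerivative

section Commutator

open VectorField

variable {E : Type*} [NormedAddCommGroup E] [NormedSpace ℝ E]
  {F : Type*} [NormedAddCommGroup F] [NormedSpace ℝ F]

theorem fderiv_lieBracket {f : E → F} {V W : E → E} {p : E} (hf : ContDiffAt ℝ 2 f p)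
    (hV : DifferentiableAt ℝ V p) (hW : DifferentiableAt ℝ W p) :
    fderiv ℝ f p (lieBracket ℝ V W p) =
      fderiv ℝ (fun u ↦ fderiv ℝ f u (W u)) p (V p) -
        fderiv ℝ (fun u ↦ fderiv ℝ f u (V u)) p (W p) := by
  have hf' : DifferentiableAt ℝ (fderiv ℝ f) p :=
    (hf.fderiv_right (m := 1) (by norm_num)).differentiableAt (by simp)
  have hsymm : IsSymmSndFDerivAt ℝ f p := hf.isSymmSndFDerivAt (by simp)
  rw [lieBracket_eq, fderiv_clm_apply hf' hV, fderiv_clm_apply hf' hW]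
  simp only [map_sub, add_apply, ContinuousLinearMap.comp_apply,
    ContinuousLinearMap.flip_apply]
  rw [hsymm.eq (V p) (W p)]
  abel

variable {M : Type*} [TopologicalSpace M] [ChartedSpace E M]

/-- The derivative of a vector-valued function along a vector field. -/
def derivAlong (f : M → F) (V : Π x : M, TangentSpace 𝓘(ℝ, E) x) (x : M) : F :=
  mfderiv 𝓘(ℝ, E) 𝓘(ℝ, F) f x (V x)

/-- The local representative of a vector field in the preferred chart at `x`. -/
def chartField (x : M) (V : Π x : M, TangentSpace 𝓘(ℝ, E) x) : E → E :=
  mpullback 𝓘(ℝ, E) 𝓘(ℝ, E) (extChartAt 𝓘(ℝ, E) x).symm V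

theorem mdifferentiableAt_of_comp_extChartAt_symm {f : M → F} {x : M}
    (hf : DifferentiableAt ℝ (f ∘ (extChartAt 𝓘(ℝ, E) x).symm) (extChartAt 𝓘(ℝ, E) x x)) :
    MDifferentiableAt 𝓘(ℝ, E) 𝓘(ℝ, F) f x := by
  have hcomp := hf.mdifferentiableAt.comp x
    ((contMDiffAt_extChartAt (I := 𝓘(ℝ, E)) (n := ∞) (x := x)).mdifferentiableAt (by simp))
  refine hcomp.congr_of_eventuallyEq ?_
  filter_upwards [extChartAt_source_mem_nhds (I := 𝓘(ℝ, E)) x] with y hy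
  simp only [Function.comp_apply, (extChartAt 𝓘(ℝ, E) x).left_inv hy]

variable [IsManifold 𝓘(ℝ, E) ∞ M]

theorem contMDiffAt_extChartAt_symm_self (x : M) :
    ContMDiffAt 𝓘(ℝ, E) 𝓘(ℝ, E) ∞ (extChartAt 𝓘(ℝ, E) x).symm (extChartAt 𝓘(ℝ, E) x x) :=
  (contMDiffOn_extChartAt_symm x).contMDiffAt (extChartAt_target_mem_nhds x)

theorem contDiffAt_comp_extChartAt_symm {n : ℕ∞} {f : M → F} {x : M}
    (hf : ContMDiffAt 𝓘(ℝ, E) 𝓘(ℝ, F) n f x) :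
    ContDiffAt ℝ n (f ∘ (extChartAt 𝓘(ℝ, E) x).symm) (extChartAt 𝓘(ℝ, E) x x) := by
  rw [← extChartAt_to_inv (I := 𝓘(ℝ, E)) x] at hf
  exact (hf.comp _ ((contMDiffAt_extChartAt_symm_self x).of_le
    (by exact_mod_cast le_top))).contDiffAt

theorem eventually_mdifferentiableAt {f : M → F} {x : M}
    (hf : ContMDiffAt 𝓘(ℝ, E) 𝓘(ℝ, F) 1 f x) :
    ∀ᶠ y in 𝓝 x, MDifferentiableAt 𝓘(ℝ, E) 𝓘(ℝ, F) f y := by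
  have : IsManifold 𝓘(ℝ, E) 1 M := .of_le (n := ∞) (by simp)
  filter_upwards [contMDiffAt_iff_contMDiffAt_nhds (by simp) |>.1 hf] with y hy
  exact hy.mdifferentiableAt (by simp)

theorem fderiv_comp_extChartAt_symm_chartField {f : M → F} {x : M} {u : E}
    (hu : u ∈ (extChartAt 𝓘(ℝ, E) x).target)
    (hf : MDifferentiableAt 𝓘(ℝ, E) 𝓘(ℝ, F) f ((extChartAt 𝓘(ℝ, E) x).symm u))
    (V : Π x : M, TangentSpace 𝓘(ℝ, E) x) :
    fderiv ℝ (f ∘ (extChartAt 𝓘(ℝ, E) x).symm) u (chartField x V u) =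
      derivAlong f V ((extChartAt 𝓘(ℝ, E) x).symm u) := by
  have : IsManifold 𝓘(ℝ, E) 1 M := .of_le (n := ∞) (by simp)
  have hinv : (mfderiv 𝓘(ℝ, E) 𝓘(ℝ, E) (extChartAt 𝓘(ℝ, E) x).symm u).IsInvertible := by
    simpa [mfderivWithin_univ] using isInvertible_mfderivWithin_extChartAt_symm hu
  have hdiff : MDifferentiableAt 𝓘(ℝ, E) 𝓘(ℝ, E) (extChartAt 𝓘(ℝ, E) x).symm u := by
    simpa [mdifferentiableWithinAt_univ] using mdifferentiableWithinAt_extChartAt_symm hu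
  rw [← mfderiv_eq_fderiv, mfderiv_comp u hf hdiff]
  exact congrArg (mfderiv 𝓘(ℝ, E) 𝓘(ℝ, F) f _) (hinv.self_apply_inverse _)

theorem fderiv_chartField_eq_derivAlong {f : M → F} {x : M}
    (hf : MDifferentiableAt 𝓘(ℝ, E) 𝓘(ℝ, F) f x) (V : Π x : M, TangentSpace 𝓘(ℝ, E) x) :
    fderiv ℝ (f ∘ (extChartAt 𝓘(ℝ, E) x).symm) (extChartAt 𝓘(ℝ, E) x x)
      (chartField x V (extChartAt 𝓘(ℝ, E) x x)) = derivAlong f V x := by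
  have h := fderiv_comp_extChartAt_symm_chartField (mem_extChartAt_target x)
    (by rwa [extChartAt_to_inv]) V
  rwa [extChartAt_to_inv] at h

theorem eventuallyEq_derivAlong_comp_extChartAt_symm {f : M → F} {x : M}
    (hf : ContMDiffAt 𝓘(ℝ, E) 𝓘(ℝ, F) 1 f x) (V : Π x : M, TangentSpace 𝓘(ℝ, E) x) :
    derivAlong f V ∘ (extChartAt 𝓘(ℝ, E) x).symm =ᶠ[𝓝 (extChartAt 𝓘(ℝ, E) x x)]
      fun u ↦ fderiv ℝ (f ∘ (extChartAt 𝓘(ℝ, E) x).symm) u (chartField x V u) := by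
  have hf' := eventually_mdifferentiableAt hf
  rw [← extChartAt_to_inv (I := 𝓘(ℝ, E)) x] at hf'
  filter_upwards [extChartAt_target_mem_nhds (I := 𝓘(ℝ, E)) x,
    (contMDiffAt_extChartAt_symm_self x).continuousAt.tendsto.eventually hf'] with u hu hfu
  exact (fderiv_comp_extChartAt_symm_chartField hu hfu V).symm

variable [CompleteSpace E]

theorem differentiableAt_chartField {x : M} {V : Π x : M, TangentSpace 𝓘(ℝ, E) x}
    (hV : MDiffAt (T% V) x) :
    DifferentiableAt ℝ (chartField x V) (extChartAt 𝓘(ℝ, E) x x) := by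
  have : IsManifold 𝓘(ℝ, E) 2 M := .of_le (n := ∞) (ENat.LEInfty.out : (2 : ℕ∞ω) ≤ ∞)
  have h := MDifferentiableWithinAt.differentiableWithinAt_mpullbackWithin_vectorField
    (mdifferentiableWithinAt_univ.2 hV)
  rw [ModelWithCorners.range_eq_univ, mpullbackWithin_univ, Set.preimage_univ, Set.univ_inter] at h
  exact differentiableWithinAt_univ.1 h

theorem chartField_mlieBracket {x : M} {V W : Π x : M, TangentSpace 𝓘(ℝ, E) x}
    (hV : MDiffAt (T% V) x) (hW : MDiffAt (T% W) x) :
    chartField x (mlieBracket 𝓘(ℝ, E) V W) (extChartAt 𝓘(ℝ, E) x x) =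
      lieBracket ℝ (chartField x V) (chartField x W) (extChartAt 𝓘(ℝ, E) x x) := by
  have : IsManifold 𝓘(ℝ, E) (minSmoothness ℝ 3) M :=
    .of_le (n := ∞) (by simpa using (ENat.LEInfty.out : (3 : ℕ∞ω) ≤ ∞))
  rw [← extChartAt_to_inv (I := 𝓘(ℝ, E)) x] at hV hW
  rw [chartField, mpullback_mlieBracket hV hW (contMDiffAt_extChartAt_symm_self x)
    (by simpa using (ENat.LEInfty.out : (2 : ℕ∞ω) ≤ ∞)), ← mlieBracketWithin_univ,
    mlieBracketWithin_eq_lieBracketWithin]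
  exact congrFun (lieBracketWithin_univ (𝕜 := ℝ)) _

theorem derivAlong_mlieBracket {f : M → F} {x : M} {V W : Π x : M, TangentSpace 𝓘(ℝ, E) x}
    (hf : ContMDiffAt 𝓘(ℝ, E) 𝓘(ℝ, F) 2 f x) (hV : MDiffAt (T% V) x) (hW : MDiffAt (T% W) x) :
    derivAlong f (mlieBracket 𝓘(ℝ, E) V W) x =
      derivAlong (derivAlong f W) V x - derivAlong (derivAlong f V) W x := by
  have hf1 : ContMDiffAt 𝓘(ℝ, E) 𝓘(ℝ, F) 1 f x := hf.of_le (by norm_num)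
  have hf2 := contDiffAt_comp_extChartAt_symm (n := 2) hf
  have hf2' := (hf2.fderiv_right (m := 1) (by norm_num)).differentiableAt (by simp)
  have hdiff {U : Π x : M, TangentSpace 𝓘(ℝ, E) x} (hU : MDiffAt (T% U) x) :
      MDifferentiableAt 𝓘(ℝ, E) 𝓘(ℝ, F) (derivAlong f U) x :=
    mdifferentiableAt_of_comp_extChartAt_symm <|
      (hf2'.clm_apply (differentiableAt_chartField hU)).congr_of_eventuallyEq
        (eventuallyEq_derivAlong_comp_extChartAt_symm hf1 U)
  rw [← fderiv_chartField_eq_derivAlong (hf.mdifferentiableAt (by simp)),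
    ← fderiv_chartField_eq_derivAlong (hdiff hW), ← fderiv_chartField_eq_derivAlong (hdiff hV),
    (eventuallyEq_derivAlong_comp_extChartAt_symm hf1 W).fderiv_eq,
    (eventuallyEq_derivAlong_comp_extChartAt_symm hf1 V).fderiv_eq, chartField_mlieBracket hV hW]
  exact fderiv_lieBracket hf2 (differentiableAt_chartField hV) (differentiableAt_chartField hW)

end Commutator

section MaurerCartan

variable {E : Type*} [NormedAddCommGroup E] [NormedSpace ℝ E]
  {G : Type*} [TopologicalSpace G] [ChartedSpace E G] [Group G] [LieGroup 𝓘(ℝ, E) ∞ G]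
  {F : Type*} [NormedAddCommGroup F] [NormedSpace ℝ F]

variable (E) in
/-- The expression of the Maurer–Cartan form in the left chart at `g`. -/
def maurerCartan (g : G) (u : E) : E →L[ℝ] E :=
  ((leftFrame E ((leftChart E g).symm u)).symm : E →L[ℝ] E) ∘L
    (mfderiv 𝓘(ℝ, E) 𝓘(ℝ, E) (leftChart E g).symm u : E →L[ℝ] E)

theorem fderiv_comp_leftChart_symm {f : G → F} {g : G} {u : E}
    (hu : u ∈ (leftChart E g).target)
    (hf : MDifferentiableAt 𝓘(ℝ, E) 𝓘(ℝ, F) f ((leftChart E g).symm u)) :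
    fderiv ℝ (f ∘ (leftChart E g).symm) u =
      leftDeriv f ((leftChart E g).symm u) ∘L maurerCartan E g u := by
  have hchain := mfderiv_comp u hf ((contMDiffAt_leftChart_symm hu).mdifferentiableAt (by simp))
  rw [mfderiv_eq_fderiv] at hchain
  ext v
  refine congr($hchain v).trans (Eq.trans ?_ (mfderiv_leftFrame hf (maurerCartan E g u v)))
  exact congrArg (mfderiv 𝓘(ℝ, E) 𝓘(ℝ, F) f ((leftChart E g).symm u))
    ((leftFrame E ((leftChart E g).symm u)).apply_symm_apply
      (mfderiv 𝓘(ℝ, E) 𝓘(ℝ, E) (leftChart E g).symm u v)).symm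

theorem leftDeriv_leftChart_comp_maurerCartan {g : G} {u : E} (hu : u ∈ (leftChart E g).target) :
    leftDeriv (leftChart E g) ((leftChart E g).symm u) ∘L maurerCartan E g u =
      ContinuousLinearMap.id ℝ E := by
  rw [← fderiv_comp_leftChart_symm hu
    ((contMDiffAt_leftChart ((leftChart E g).map_target hu)).mdifferentiableAt (by simp))]
  have hid : leftChart E g ∘ (leftChart E g).symm =ᶠ[𝓝 u] id := by
    filter_upwards [(isOpen_leftChart_target g).mem_nhds hu] with v hv
    exact (leftChart E g).right_inv hv
  rw [hid.fderiv_eq, fderiv_id]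

theorem contDiffOn_leftDeriv_leftChart (g : G) :
    ContDiffOn ℝ ∞ (fun u : E ↦ leftDeriv (E := E) (leftChart E g) ((leftChart E g).symm u))
      (leftChart E g).target :=
  fun _ hu ↦ ((contMDiffAt_iff_comp_leftChart_symm (n := ⊤) hu).1 (contMDiffAt_leftDeriv
    (contMDiffAt_leftChart ((leftChart E g).map_target hu)))).contDiffWithinAt

variable [FiniteDimensional ℝ E]

theorem maurerCartan_comp_leftDeriv_leftChart {g : G} {u : E} (hu : u ∈ (leftChart E g).target) :
    maurerCartan E g u ∘L leftDeriv (leftChart E g) ((leftChart E g).symm u) =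
      ContinuousLinearMap.id ℝ E := by
  have hleft : (leftDeriv (leftChart E g) ((leftChart E g).symm u)).toLinearMap *
      (maurerCartan E g u).toLinearMap = 1 :=
    congrArg ContinuousLinearMap.toLinearMap (leftDeriv_leftChart_comp_maurerCartan hu)
  ext v
  exact congr($(mul_eq_one_comm.1 hleft) v)

theorem maurerCartan_leftDeriv_leftChart {g : G} {u : E} (hu : u ∈ (leftChart E g).target)
    (X : E) : maurerCartan E g u (leftDeriv (leftChart E g) ((leftChart E g).symm u) X) = X :=
  congr($(maurerCartan_comp_leftDeriv_leftChart hu) X)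

theorem contDiffOn_maurerCartan (g : G) :
    ContDiffOn ℝ ∞ (maurerCartan E g) (leftChart E g).target := by
  intro u hu
  have hinv : ∀ v ∈ (leftChart E g).target, maurerCartan E g v =
      (leftDeriv (leftChart E g) ((leftChart E g).symm v)).inverse := fun v hv ↦
    (ContinuousLinearMap.inverse_eq (leftDeriv_leftChart_comp_maurerCartan hv)
      (maurerCartan_comp_leftDeriv_leftChart hv)).symm
  refine ContDiffWithinAt.congr ?_ hinv (hinv u hu)
  let e : E ≃L[ℝ] E := .equivOfInverse
    (leftDeriv (leftChart E g) ((leftChart E g).symm u)) (maurerCartan E g u)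
    (fun v ↦ congr($(maurerCartan_comp_leftDeriv_leftChart hu) v))
    (fun v ↦ congr($(leftDeriv_leftChart_comp_maurerCartan hu) v))
  exact (contDiffAt_map_inverse e : ContDiffAt ℝ ∞ ContinuousLinearMap.inverse (e : E →L[ℝ] E))
    |>.comp_contDiffWithinAt u (contDiffOn_leftDeriv_leftChart g u hu)

end MaurerCartan

section LocallyConstant

variable {E : Type*} [NormedAddCommGroup E] [NormedSpace ℝ E]
  {G : Type*} [TopologicalSpace G] [ChartedSpace E G] [Group G] [LieGroup 𝓘(ℝ, E) ∞ G]
  {F : Type*} [NormedAddCommGroup F] [NormedSpace ℝ F]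

theorem eventually_eq_of_leftDeriv_eq_zero {f : G → F} {g : G}
    (hf : ∀ᶠ x in 𝓝 g, MDifferentiableAt 𝓘(ℝ, E) 𝓘(ℝ, F) f x)
    (h : ∀ᶠ x in 𝓝 g, leftDeriv (E := E) f x = 0) : ∀ᶠ x in 𝓝 g, f x = f g := by
  have hchart := (Filter.eventually_mem_set.2 (leftChart_target_mem_nhds (E := E) g)).and
    ((tendsto_leftChart_symm g).eventually (hf.and h))
  obtain ⟨ε, hε, hball⟩ := Metric.eventually_nhds_iff_ball.1 hchart
  have hconst {u : E} (hu : u ∈ Metric.ball (basePt E G) ε) :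
      f ((leftChart E g).symm u) = f g := by
    have heq := IsOpen.is_const_of_fderiv_eq_zero (𝕜 := ℝ) (f := f ∘ (leftChart E g).symm)
      Metric.isOpen_ball (convex_ball (basePt E G) ε).isPreconnected
      (fun v hv ↦ ((hball v hv).2.1.comp v ((contMDiffAt_leftChart_symm
        (hball v hv).1).mdifferentiableAt (by simp))).differentiableAt.differentiableWithinAt)
      (fun v hv ↦ by
        rw [fderiv_comp_leftChart_symm (hball v hv).1 (hball v hv).2.1, (hball v hv).2.2]
        exact ContinuousLinearMap.zero_comp _) hu (Metric.mem_ball_self hε)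
    simpa using heq
  have hcont := (contMDiffAt_leftChart (mem_leftChart_source (E := E) g)).continuousAt
  rw [ContinuousAt, leftChart_self] at hcont
  filter_upwards [(isOpen_leftChart_source g).mem_nhds (mem_leftChart_source (E := E) g),
    hcont.eventually (Metric.ball_mem_nhds _ hε)] with x hx hxε
  rw [← hconst hxε, (leftChart E g).left_inv hx]

theorem eq_of_leftDeriv_eq_zero [PreconnectedSpace G] {f : G → F}
    (hf : ∀ x, MDifferentiableAt 𝓘(ℝ, E) 𝓘(ℝ, F) f x) (h : ∀ x, leftDeriv (E := E) f x = 0)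
    (x y : G) : f x = f y := by
  have hconst : IsLocallyConstant f := (IsLocallyConstant.iff_eventually_eq f).2 fun _ ↦
    eventually_eq_of_leftDeriv_eq_zero (.of_forall hf) (.of_forall h)
  exact hconst.apply_eq_of_isPreconnected isPreconnected_univ (Set.mem_univ x) (Set.mem_univ y)

theorem eq_of_leftDeriv_eq [PreconnectedSpace G] {f f' : G → F}
    (hf : ∀ x, MDifferentiableAt 𝓘(ℝ, E) 𝓘(ℝ, F) f x)
    (hf' : ∀ x, MDifferentiableAt 𝓘(ℝ, E) 𝓘(ℝ, F) f' x)
    (h : ∀ x, leftDeriv (E := E) f x = leftDeriv f' x) {x₀ : G} (h₀ : f x₀ = f' x₀) (x : G) :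
    f x = f' x := by
  have hconst := eq_of_leftDeriv_eq_zero (E := E) (f := fun y ↦ f y - f' y)
    (fun y ↦ (hf y).sub (hf' y))
    (fun y ↦ by rw [leftDeriv_sub (hf y) (hf' y), h, sub_self]) x x₀
  rwa [h₀, sub_self, sub_eq_zero] at hconst

end LocallyConstant

section Bracket

open VectorField

variable {E : Type*} [NormedAddCommGroup E] [NormedSpace ℝ E]
  {G : Type*} [TopologicalSpace G] [ChartedSpace E G] [Group G] [LieGroup 𝓘(ℝ, E) ∞ G]

variable (E G) in
theorem lieGroup_minSmoothness : LieGroup 𝓘(ℝ, E) (minSmoothness ℝ 3) G :=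
  LieGroup.of_le (n := ∞) (by simpa using (ENat.LEInfty.out : (3 : ℕ∞ω) ≤ ∞))

variable [FiniteDimensional ℝ E]

variable (E G) in
/-- The Lie bracket of the Lie algebra of `G`, as a continuous bilinear map on the model space. On
the model space, unlike on `GroupLieAlgebra 𝓘(ℝ, E) G`, instance search finds the norm, the
manifold structure and the spaces of continuous linear maps. -/
def bracket : E →L[ℝ] E →L[ℝ] E :=
  have := lieGroup_minSmoothness E G
  let L := GroupLieAlgebra 𝓘(ℝ, E) G
  LinearMap.toContinuousBilinearMap (𝕜 := ℝ) (E := E) (F := E) (G := E) <| LinearMap.mk₂ ℝ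
    (fun X Y : E ↦ (⁅(show L from X), (show L from Y)⁆ : L))
    (add_lie (L := L) (M := L)) (smul_lie (R := ℝ) (L := L) (M := L))
    (lie_add (L := L) (M := L)) (lie_smul (R := ℝ) (L := L) (M := L))

theorem bracket_swap (X Y : E) : bracket E G X Y = -bracket E G Y X := by
  have := lieGroup_minSmoothness E G
  exact (lie_skew (L := GroupLieAlgebra 𝓘(ℝ, E) G) X Y).symm

theorem bracket_jacobi (X Y Z : E) : bracket E G X (bracket E G Y Z) =
    bracket E G (bracket E G X Y) Z + bracket E G Y (bracket E G X Z) := by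
  have := lieGroup_minSmoothness E G
  let L := GroupLieAlgebra 𝓘(ℝ, E) G
  exact leibniz_lie (L₁ := L) (L₂ := L) (M := L) X Y Z

variable {F : Type*} [NormedAddCommGroup F] [NormedSpace ℝ F]

theorem leftDeriv_leftDeriv_sub {f : G → F} {g : G} (hf : ContMDiffAt 𝓘(ℝ, E) 𝓘(ℝ, F) ∞ f g)
    (X Y : E) :
    leftDeriv (leftDeriv (E := E) f) g X Y - leftDeriv (leftDeriv f) g Y X =
      leftDeriv f g (bracket E G X Y) := by
  have := lieGroup_minSmoothness E G
  let field (Z : E) (x : G) : TangentSpace 𝓘(ℝ, E) x := leftFrame E x Z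
  have hfield (Z : E) : MDiffAt (T% (field Z)) g := mdifferentiableAt_mulInvariantVectorField _
  have hbracket : mlieBracket 𝓘(ℝ, E) (field X) (field Y) = field (bracket E G X Y) :=
    (mulInvariantVector_mlieBracket (I := 𝓘(ℝ, E)) (G := G) X Y).symm
  have hf' : MDifferentiableAt 𝓘(ℝ, E) 𝓘(ℝ, E →L[ℝ] F) (leftDeriv (E := E) f) g :=
    (contMDiffAt_leftDeriv hf).mdifferentiableAt (by simp)
  have hfirst (Z : E) : derivAlong f (field Z) =ᶠ[𝓝 g] fun x ↦ leftDeriv f x Z := by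
    filter_upwards [eventually_mdifferentiableAt (hf.of_le (by simp))] with y hy
    exact mfderiv_leftFrame hy Z
  have hsecond (Z W : E) :
      derivAlong (derivAlong f (field Z)) (field W) g = leftDeriv (leftDeriv f) g W Z := by
    rw [← leftDeriv_clm_apply hf', ← mfderiv_leftFrame (hf'.clm_apply mdifferentiableAt_const)]
    exact congr($((hfirst Z).mfderiv_eq) (leftFrame E g W))
  have hcomm := derivAlong_mlieBracket
    (hf.of_le (ENat.LEInfty.out : (2 : ℕ∞ω) ≤ ∞)) (hfield X) (hfield Y)
  rw [hsecond, hsecond, hbracket] at hcomm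
  rw [← hcomm, ← mfderiv_leftFrame (hf.mdifferentiableAt (by simp))]
  rfl

end Bracket

section ClosedForms

variable {E : Type*} [NormedAddCommGroup E] [NormedSpace ℝ E]
  {G : Type*} [TopologicalSpace G] [ChartedSpace E G] [Group G] [LieGroup 𝓘(ℝ, E) ∞ G]
  {F : Type*} [NormedAddCommGroup F] [NormedSpace ℝ F]

/-- The expression in the left chart at `g` of the `F`-valued `1`-form `A` on `G`, where `A` is
given in the left trivialization of the tangent bundle. -/
def chartForm (A : G → E →L[ℝ] F) (g : G) (u : E) : E →L[ℝ] F :=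
  A ((leftChart E g).symm u) ∘L maurerCartan E g u

variable [FiniteDimensional ℝ E]

/-- The `F`-valued `1`-form on `G` given by `A` in the left trivialization is closed: its exterior
derivative, evaluated on left-invariant vector fields, vanishes. -/
def IsClosedForm (A : G → E →L[ℝ] F) : Prop :=
  ∀ g X Y, leftDeriv A g X Y - leftDeriv A g Y X = A g (bracket E G X Y)

theorem chartForm_leftDeriv_leftChart (A : G → E →L[ℝ] F) {g : G} {u : E}
    (hu : u ∈ (leftChart E g).target) (X : E) :
    chartForm A g u (leftDeriv (leftChart E g) ((leftChart E g).symm u) X) =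
      A ((leftChart E g).symm u) X :=
  congrArg (A ((leftChart E g).symm u)) (maurerCartan_leftDeriv_leftChart hu X)

theorem contDiffOn_chartForm {A : G → E →L[ℝ] F} (hA : ContMDiff 𝓘(ℝ, E) 𝓘(ℝ, E →L[ℝ] F) ∞ A)
    (g : G) : ContDiffOn ℝ ∞ (chartForm A g) (leftChart E g).target :=
  ContDiffOn.clm_comp (fun _ hu ↦ ((contMDiffAt_iff_comp_leftChart_symm (n := ⊤) hu).1
    (hA _)).contDiffWithinAt) (contDiffOn_maurerCartan g)

theorem fderiv_chartForm_apply {A : G → E →L[ℝ] F}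
    (hA : ContMDiff 𝓘(ℝ, E) 𝓘(ℝ, E →L[ℝ] F) ∞ A) {g x : G} {u : E}
    (hu : u ∈ (leftChart E g).target) (hx : (leftChart E g).symm u = x) (X Y : E) :
    fderiv ℝ (chartForm A g) u (leftDeriv (leftChart E g) x X) (leftDeriv (leftChart E g) x Y) =
      leftDeriv A x X Y - chartForm A g u (leftDeriv (leftDeriv (leftChart E g)) x X Y) := by
  subst hx
  set P : E → E →L[ℝ] E := fun v ↦ leftDeriv (leftChart E g) ((leftChart E g).symm v)
  have htarget := (isOpen_leftChart_target g).mem_nhds hu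
  have hform : DifferentiableAt ℝ (chartForm A g) u :=
    ((contDiffOn_chartForm hA g).contDiffAt htarget).differentiableAt (by simp)
  have hP : DifferentiableAt ℝ P u :=
    ((contDiffOn_leftDeriv_leftChart g).contDiffAt htarget).differentiableAt (by simp)
  have hP' : fderiv ℝ P u = leftDeriv (leftDeriv (leftChart E g)) ((leftChart E g).symm u) ∘L
      maurerCartan E g u := fderiv_comp_leftChart_symm hu ((contMDiffAt_leftDeriv
    (contMDiffAt_leftChart ((leftChart E g).map_target hu))).mdifferentiableAt (by simp))
  have hprod : (fun v ↦ chartForm A g v ∘L P v) =ᶠ[𝓝 u] A ∘ (leftChart E g).symm := by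
    filter_upwards [htarget] with v hv
    ext Z
    exact chartForm_leftDeriv_leftChart A hv Z
  have hfderiv := hprod.fderiv_eq (𝕜 := ℝ)
  rw [(hform.hasFDerivAt.clm_comp hP.hasFDerivAt).fderiv,
    fderiv_comp_leftChart_symm hu (hA.mdifferentiable (by simp) _)] at hfderiv
  have happly := congr($hfderiv (P u X) Y)
  simp only [hP', add_apply, ContinuousLinearMap.comp_apply, ContinuousLinearMap.compL_apply,
    ContinuousLinearMap.flip_apply, P, maurerCartan_leftDeriv_leftChart hu] at happly
  exact eq_sub_of_add_eq' happly

theorem IsClosedForm.fderiv_chartForm_comm {A : G → E →L[ℝ] F} (hclosed : IsClosedForm A)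
    (hA : ContMDiff 𝓘(ℝ, E) 𝓘(ℝ, E →L[ℝ] F) ∞ A) {g : G} {u : E}
    (hu : u ∈ (leftChart E g).target) (v w : E) :
    fderiv ℝ (chartForm A g) u v w = fderiv ℝ (chartForm A g) u w v := by
  have hP (v : E) : leftDeriv (leftChart E g) ((leftChart E g).symm u) (maurerCartan E g u v) = v :=
    congr($(leftDeriv_leftChart_comp_maurerCartan hu) v)
  rw [← hP v, ← hP w, fderiv_chartForm_apply hA hu rfl, fderiv_chartForm_apply hA hu rfl,
    sub_eq_sub_iff_sub_eq_sub, hclosed, ← map_sub, leftDeriv_leftDeriv_sub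
      (contMDiffAt_leftChart ((leftChart E g).map_target hu)), chartForm_leftDeriv_leftChart A hu]

theorem leftDeriv_comp_leftChart {A : G → E →L[ℝ] F} {g x : G} (hx : x ∈ (leftChart E g).source)
    {f : E → F} (hf : HasFDerivAt f (chartForm A g (leftChart E g x)) (leftChart E g x)) :
    leftDeriv (f ∘ leftChart E g) x = A x := by
  rw [leftDeriv_comp hf ((contMDiffAt_leftChart hx).mdifferentiableAt (by simp))]
  ext X
  simpa [(leftChart E g).left_inv hx] using
    chartForm_leftDeriv_leftChart A ((leftChart E g).map_source hx) X

theorem IsClosedForm.exists_local_primitive [CompleteSpace F] {A : G → E →L[ℝ] F}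
    (hclosed : IsClosedForm A) (hA : ContMDiff 𝓘(ℝ, E) 𝓘(ℝ, E →L[ℝ] F) ∞ A) (g : G) :
    ∃ (U : Set G) (f : G → F), IsOpen U ∧ g ∈ U ∧ ∀ x ∈ U,
      ContMDiffAt 𝓘(ℝ, E) 𝓘(ℝ, F) ∞ f x ∧ leftDeriv f x = A x := by
  obtain ⟨ε, hε, hball⟩ := Metric.mem_nhds_iff.1 (leftChart_target_mem_nhds (E := E) g)
  set B := Metric.ball (basePt E G) ε
  have hBopen : IsOpen B := Metric.isOpen_ball
  have hform := (contDiffOn_chartForm hA g).mono hball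
  obtain ⟨f, hf⟩ := (convex_ball (basePt E G) ε).exists_forall_hasFDerivAt_of_fderiv_symmetric
    hBopen (hform.differentiableOn (by simp))
    fun u hu ↦ hclosed.fderiv_chartForm_comm hA (hball hu)
  have hsmooth : ContDiffOn ℝ ∞ f B := (contDiffOn_infty_iff_fderiv_of_isOpen hBopen).2
    ⟨fun u hu ↦ (hf u hu).differentiableAt.differentiableWithinAt,
      hform.congr fun u hu ↦ (hf u hu).fderiv⟩
  refine ⟨(leftChart E g).source ∩ leftChart E g ⁻¹' B, f ∘ leftChart E g, ?_,
    ⟨mem_leftChart_source g, by simpa [B] using hε⟩, ?_⟩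
  · exact ContinuousOn.isOpen_inter_preimage
      (fun x hx ↦ (contMDiffAt_leftChart hx).continuousAt.continuousWithinAt)
      (isOpen_leftChart_source g) hBopen
  · rintro x ⟨hx, hxB⟩
    exact ⟨(hsmooth.contDiffAt (hBopen.mem_nhds hxB)).contMDiffAt.comp x (contMDiffAt_leftChart hx),
      leftDeriv_comp_leftChart hx (hf _ hxB)⟩

theorem IsClosedForm.exists_leftDeriv_eq [SimplyConnectedSpace G] [CompleteSpace F]
    {A : G → E →L[ℝ] F} (hclosed : IsClosedForm A)
    (hA : ContMDiff 𝓘(ℝ, E) 𝓘(ℝ, E →L[ℝ] F) ∞ A) :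
    ∃ f : G → F, ContMDiff 𝓘(ℝ, E) 𝓘(ℝ, F) ∞ f ∧ ∀ g, leftDeriv f g = A g := by
  have := ChartedSpace.locallyPathConnectedSpace E G
  choose U f hU hmem hf using hclosed.exists_local_primitive hA
  have hdiff {i x : G} (hx : x ∈ U i) : MDifferentiableAt 𝓘(ℝ, E) 𝓘(ℝ, F) (f i) x :=
    (hf i x hx).1.mdifferentiableAt (by simp)
  obtain ⟨s, hs⟩ := exists_forall_eventually_sub_eq U hU hmem f fun i j x hx ↦ by
    have hinter : ∀ᶠ y in 𝓝 x, y ∈ U i ∩ U j := ((hU i).inter (hU j)).mem_nhds hx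
    refine eventually_eq_of_leftDeriv_eq_zero (E := E) (f := fun y ↦ f i y - f j y) ?_ ?_
    · filter_upwards [hinter] with y hy
      exact (hdiff hy.1).sub (hdiff hy.2)
    · filter_upwards [hinter] with y hy
      rw [leftDeriv_sub (hdiff hy.1) (hdiff hy.2), (hf i y hy.1).2, (hf j y hy.2).2, sub_self]
  have hlocal (x : G) : s =ᶠ[𝓝 x] fun y ↦ f x y + (s x - f x x) := by
    filter_upwards [hs x x (hmem x)] with y hy
    rw [← hy, add_sub_cancel]
  refine ⟨s, fun x ↦ ?_, fun x ↦ ?_⟩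
  · exact ((hf x x (hmem x)).1.add contMDiffAt_const).congr_of_eventuallyEq (hlocal x)
  · rw [leftDeriv_congr (hlocal x), leftDeriv_add_const (hdiff (hmem x)), (hf x x (hmem x)).2]

end ClosedForms

section MixedDerivatives

variable {E₁ E₂ E F : Type*} [NormedAddCommGroup E₁] [NormedSpace ℝ E₁]
  [NormedAddCommGroup E₂] [NormedSpace ℝ E₂] [NormedAddCommGroup E] [NormedSpace ℝ E]
  [NormedAddCommGroup F] [NormedSpace ℝ F]

theorem fderiv_fderiv_comp_eq {f : E → F} {s : E₁ → E₂ → E} {a : E₁} {b : E₂} {A : E₁ →L[ℝ] E}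
    {B : E₂ →L[ℝ] E} (hf : ContDiffAt ℝ 2 f (s a b)) (hA : ∀ v, HasFDerivAt (fun u ↦ s u v) A a)
    (hB : HasFDerivAt (s a) B b) (X : E₁) (Y : E₂) :
    fderiv ℝ (fun v ↦ fderiv ℝ (fun u ↦ f (s u v)) a) b Y X =
      fderiv ℝ (fderiv ℝ f) (s a b) (B Y) (A X) := by
  have hdiff : ∀ᶠ v in 𝓝 b, DifferentiableAt ℝ f (s a v) := by
    refine hB.continuousAt.eventually ?_
    filter_upwards [hf.eventually (by simp)] with p hp
    exact hp.differentiableAt (by simp)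
  have hinner : (fun v ↦ fderiv ℝ (fun u ↦ f (s u v)) a) =ᶠ[𝓝 b]
      fun v ↦ fderiv ℝ f (s a v) ∘L A := by
    filter_upwards [hdiff] with v hv
    exact (hv.hasFDerivAt.comp a (hA v)).fderiv
  have hsecond : HasFDerivAt (fderiv ℝ f) (fderiv ℝ (fderiv ℝ f) (s a b)) (s a b) :=
    ((hf.fderiv_right (m := 1) (by norm_num)).differentiableAt (by simp)).hasFDerivAt
  have houter := (hsecond.comp b hB).clm_comp (hasFDerivAt_const A b)
  rw [hinner.fderiv_eq]
  exact congr($(houter.fderiv) Y X).trans (by simp)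

theorem fderiv_fderiv_comm {f : E₁ × E₂ → F} {a : E₁} {b : E₂} (hf : ContDiffAt ℝ 2 f (a, b))
    (X : E₁) (Y : E₂) :
    fderiv ℝ (fun v ↦ fderiv ℝ (fun u ↦ f (u, v)) a) b Y X =
      fderiv ℝ (fun u ↦ fderiv ℝ (fun v ↦ f (u, v)) b) a X Y := by
  rw [fderiv_fderiv_comp_eq (s := fun u v ↦ (u, v)) hf (hasFDerivAt_prodMk_left a)
      (hasFDerivAt_prodMk_right a b),
    fderiv_fderiv_comp_eq (s := fun v u ↦ (u, v)) hf (fun u ↦ hasFDerivAt_prodMk_right u b)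
      (hasFDerivAt_prodMk_left a b)]
  exact hf.isSymmSndFDerivAt (by simp) _ _

end MixedDerivatives

section Adjoint

variable {E : Type*} [NormedAddCommGroup E] [NormedSpace ℝ E]
  {G : Type*} [TopologicalSpace G] [ChartedSpace E G] [Group G]
  {F : Type*} [NormedAddCommGroup F] [NormedSpace ℝ F]

variable (E) in
/-- The adjoint representation of `G`, as a family of endomorphisms of the model space: `Ad E g` is
the differential at `1` of the conjugation `x ↦ g * x * g⁻¹`. -/
def Ad (g : G) : E →L[ℝ] E := leftDeriv (fun x ↦ leftChart E 1 (g * x * g⁻¹)) 1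

@[simp]
theorem Ad_one : Ad E (1 : G) = ContinuousLinearMap.id ℝ E := by
  simp [Ad, leftDeriv_leftChart_self]

variable [LieGroup 𝓘(ℝ, E) ∞ G]

theorem leftDeriv_leftDeriv_comm {f : G → G → F} {g h : G}
    (hf : ContMDiffAt (𝓘(ℝ, E).prod 𝓘(ℝ, E)) 𝓘(ℝ, F) ∞ (Function.uncurry f) (g, h)) (X Y : E) :
    leftDeriv (fun y ↦ leftDeriv (fun x ↦ f x y) g) h Y X =
      leftDeriv (fun x ↦ leftDeriv (f x) h) g X Y :=
  fderiv_fderiv_comm ((contDiffAt_comp_prodMap_leftChart_symm hf).of_le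
    (ENat.LEInfty.out : (2 : ℕ∞ω) ≤ ∞)) X Y

theorem contMDiffAt_leftChart_self (g : G) :
    ContMDiffAt 𝓘(ℝ, E) 𝓘(ℝ, E) ∞ (leftChart E g) g :=
  contMDiffAt_leftChart (mem_leftChart_source g)

variable (E) in
theorem contMDiff_conj :
    ContMDiff (𝓘(ℝ, E).prod 𝓘(ℝ, E)) 𝓘(ℝ, E) ∞ fun p : G × G ↦ p.1 * p.2 * p.1⁻¹ :=
  (contMDiff_fst.mul contMDiff_snd).mul contMDiff_fst.inv

theorem mdifferentiableAt_conj (g x : G) :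
    MDifferentiableAt 𝓘(ℝ, E) 𝓘(ℝ, E) (fun x ↦ g * x * g⁻¹) x :=
  ((contMDiff_conj E).comp (contMDiff_const.prodMk contMDiff_id)).mdifferentiable (by simp) x

theorem mdifferentiableAt_leftChart_conj (g : G) :
    MDifferentiableAt 𝓘(ℝ, E) 𝓘(ℝ, E) (fun x ↦ leftChart E 1 (g * x * g⁻¹)) 1 :=
  MDifferentiableAt.comp 1 (by simpa using
    (contMDiffAt_leftChart_self (E := E) (1 : G)).mdifferentiableAt (by simp))
    (mdifferentiableAt_conj g 1)

theorem leftDeriv_conj {f : G → F} (g : G) (hf : MDifferentiableAt 𝓘(ℝ, E) 𝓘(ℝ, F) f 1) :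
    leftDeriv (fun x ↦ f (g * x * g⁻¹)) 1 = leftDeriv f 1 ∘L Ad E g := by
  have hchart : HasFDerivAt (f ∘ (leftChart E 1).symm) (leftDeriv f 1)
      (leftChart E 1 (g * 1 * g⁻¹)) := by
    simpa [leftChart_self] using hasFDerivAt_leftDeriv hf
  have hconj : Filter.Tendsto (fun x ↦ g * x * g⁻¹) (𝓝 1) (𝓝 1) := by
    simpa using (mdifferentiableAt_conj (E := E) g 1).continuousAt.tendsto
  have hcongr : (fun x ↦ f (g * x * g⁻¹)) =ᶠ[𝓝 1]
      (f ∘ (leftChart E 1).symm) ∘ fun x ↦ leftChart E 1 (g * x * g⁻¹) := by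
    filter_upwards [hconj ((isOpen_leftChart_source (E := E) 1).mem_nhds
      (mem_leftChart_source (1 : G)))] with x hx
    exact congrArg f ((leftChart E 1).left_inv hx).symm
  rw [leftDeriv_congr hcongr, leftDeriv_comp (f := fun x ↦ leftChart E 1 (g * x * g⁻¹)) hchart
    (mdifferentiableAt_leftChart_conj g)]
  rfl

theorem leftDeriv_mul_right {f : G → F} {g h : G}
    (hf : MDifferentiableAt 𝓘(ℝ, E) 𝓘(ℝ, F) f (g * h)) :
    leftDeriv (fun x ↦ f (x * h)) g = leftDeriv f (g * h) ∘L Ad E h⁻¹ := by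
  have htranslate : MDifferentiableAt 𝓘(ℝ, E) 𝓘(ℝ, F) (fun x ↦ f (g * h * x)) 1 :=
    MDifferentiableAt.comp 1 (by simpa using hf) (mdifferentiableAt_mul_left (g * h) 1)
  have hconj := leftDeriv_conj h⁻¹ htranslate
  have hleft := leftDeriv_comp_mul_left (E := E) (fun x ↦ f (x * h)) g 1
  rw [leftDeriv_comp_mul_left, mul_one] at hconj
  rw [mul_one] at hleft
  rw [← hconj, ← hleft]
  simp [mul_assoc]

theorem Ad_mul (g h : G) : Ad E (g * h) = Ad E g ∘L Ad E h := by
  rw [show Ad E g = leftDeriv (fun x ↦ leftChart E 1 (g * x * g⁻¹)) 1 from rfl,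
    ← leftDeriv_conj h (mdifferentiableAt_leftChart_conj g)]
  simp [Ad, mul_assoc]

@[simp]
theorem Ad_inv_Ad (g : G) (X : E) : Ad E g⁻¹ (Ad E g X) = X := by
  simpa using congr($((Ad_mul (E := E) g⁻¹ g).symm) X)

@[simp]
theorem Ad_Ad_inv (g : G) (X : E) : Ad E g (Ad E g⁻¹ X) = X := by
  simpa using Ad_inv_Ad g⁻¹ X

theorem contMDiff_Ad : ContMDiff 𝓘(ℝ, E) 𝓘(ℝ, E →L[ℝ] E) ∞ (Ad E : G → E →L[ℝ] E) := fun g ↦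
  contMDiffAt_leftDeriv_right (f := fun g x ↦ leftChart E 1 (g * x * g⁻¹)) <|
    ContMDiffAt.comp (g, 1) (by simpa using contMDiffAt_leftChart_self (E := E) (1 : G))
      (contMDiff_conj E).contMDiffAt

theorem mdifferentiableAt_Ad (g : G) :
    MDifferentiableAt 𝓘(ℝ, E) 𝓘(ℝ, E →L[ℝ] E) (Ad E : G → E →L[ℝ] E) g :=
  contMDiff_Ad.mdifferentiable (by simp) g

variable [FiniteDimensional ℝ E]

theorem leftDeriv_Ad_one (X Y : E) : leftDeriv (Ad E) (1 : G) X Y = bracket E G X Y := by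
  set κ : G → E := fun x ↦ leftChart E 1 x
  have hκ : ContMDiffAt 𝓘(ℝ, E) 𝓘(ℝ, E) ∞ κ 1 := contMDiffAt_leftChart_self 1
  have hκ_id : leftDeriv κ 1 = ContinuousLinearMap.id ℝ E := leftDeriv_leftChart_self 1
  -- `rightDeriv` differentiates `κ` along right-invariant fields; these commute with the
  -- left-invariant ones, and `Ad` compares the two frames.
  let rightDeriv (x : G) : E →L[ℝ] E := leftDeriv (fun z ↦ κ (z * x)) 1
  have hmul : ContMDiffAt (𝓘(ℝ, E).prod 𝓘(ℝ, E)) 𝓘(ℝ, E) ∞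
      (Function.uncurry fun x z ↦ κ (z * x)) (1, 1) :=
    ContMDiffAt.comp (1, 1) (by simpa using hκ) (contMDiffAt_snd.mul contMDiffAt_fst)
  have hright : MDifferentiableAt 𝓘(ℝ, E) 𝓘(ℝ, E →L[ℝ] E) rightDeriv 1 :=
    (contMDiffAt_leftDeriv_right hmul).mdifferentiableAt (by simp)
  have hcomm : leftDeriv rightDeriv 1 X Y = leftDeriv (leftDeriv κ) 1 Y X := by
    refine (leftDeriv_leftDeriv_comm hmul X Y).symm.trans ?_
    simp only [leftDeriv_comp_mul_left, mul_one]
  have hprod : leftDeriv κ =ᶠ[𝓝 1] fun x ↦ rightDeriv x ∘L Ad E x := by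
    filter_upwards [eventually_mdifferentiableAt (hκ.of_le (by simp))] with x hx
    have hmulRight := leftDeriv_mul_right (f := κ) (g := 1) (h := x) (by rwa [one_mul])
    ext v
    simp [rightDeriv, hmulRight]
  have hone : rightDeriv 1 = ContinuousLinearMap.id ℝ E := by simp [rightDeriv, hκ_id]
  have hleibniz : leftDeriv (leftDeriv κ) 1 X Y =
      leftDeriv (Ad E) (1 : G) X Y + leftDeriv rightDeriv 1 X Y := by
    rw [leftDeriv_congr hprod, leftDeriv_clm_comp hright (mdifferentiableAt_Ad 1)]
    simp [hone]
  have hbracket := leftDeriv_leftDeriv_sub hκ X Y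
  rw [hleibniz, hcomm, hκ_id] at hbracket
  simpa using hbracket

theorem leftDeriv_Ad (g : G) (X Y : E) : leftDeriv (Ad E) g X Y = Ad E g (bracket E G X Y) := by
  have htranslate := leftDeriv_comp_mul_left (E := E) (Ad E) g 1
  rw [mul_one] at htranslate
  simp only [Ad_mul] at htranslate
  rw [← htranslate, leftDeriv_clm_comp mdifferentiableAt_const (mdifferentiableAt_Ad 1)]
  simp [leftDeriv_Ad_one]

end Adjoint

section FrameComponents

open VectorField

variable {E : Type*} [NormedAddCommGroup E] [NormedSpace ℝ E]
  {G : Type*} [TopologicalSpace G] [ChartedSpace E G] [Group G]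

variable (G) in
/-- The left-invariant vector field on `G` defined by a vector of the model space. -/
def leftInvField (X : E) : Π g : G, TangentSpace 𝓘(ℝ, E) g :=
  mulInvariantVectorField (I := 𝓘(ℝ, E)) (G := G) X

/-- The components of a vector field in the frame of the left-invariant vector fields. -/
def frameComponents [LieGroup 𝓘(ℝ, E) ∞ G] (Y : Π x : G, TangentSpace 𝓘(ℝ, E) x) (x : G) : E :=
  (leftFrame E x).symm (Y x)

variable [LieGroup 𝓘(ℝ, E) ∞ G]

theorem leftFrame_frameComponents (Y : Π x : G, TangentSpace 𝓘(ℝ, E) x) (x : G) :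
    leftFrame E x (frameComponents Y x) = Y x :=
  (leftFrame E x).apply_symm_apply (Y x)

theorem frameComponents_leftInvField (X : E) : frameComponents (leftInvField G X) = fun _ ↦ X :=
  funext fun x ↦ (leftFrame E x).symm_apply_apply X

theorem derivAlong_eq_leftDeriv {F : Type*} [NormedAddCommGroup F] [NormedSpace ℝ F] {f : G → F}
    {x : G} (hf : MDifferentiableAt 𝓘(ℝ, E) 𝓘(ℝ, F) f x)
    (Y : Π x : G, TangentSpace 𝓘(ℝ, E) x) :
    derivAlong f Y x = leftDeriv f x (frameComponents Y x) :=
  (congrArg (mfderiv 𝓘(ℝ, E) 𝓘(ℝ, F) f x : E → F) (leftFrame_frameComponents Y x)).symm.trans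
    (mfderiv_leftFrame hf _)

theorem trivializationAt_apply_snd {x₀ x : G} (hx : x ∈ (chartAt E x₀).source)
    (Y : Π x : G, TangentSpace 𝓘(ℝ, E) x) :
    (trivializationAt E (TangentSpace 𝓘(ℝ, E)) x₀ ⟨x, Y x⟩).2 =
      leftDeriv (extChartAt 𝓘(ℝ, E) x₀) x (frameComponents Y x) := by
  rw [← derivAlong_eq_leftDeriv (mdifferentiableAt_extChartAt hx) Y]
  have hbase : x ∈ (trivializationAt E (TangentSpace 𝓘(ℝ, E)) x₀).baseSet := hx
  have happly := Bundle.Trivialization.continuousLinearMapAt_apply_of_mem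
    (R := ℝ) (trivializationAt E (TangentSpace 𝓘(ℝ, E)) x₀) hbase (Y x)
  rw [TangentBundle.continuousLinearMapAt_trivializationAt hx] at happly
  exact happly.symm

theorem isInvertible_leftDeriv_extChartAt {x₀ x : G} (hx : x ∈ (chartAt E x₀).source) :
    (leftDeriv (E := E) (extChartAt 𝓘(ℝ, E) x₀) x).IsInvertible := by
  have hmfderiv : (mfderiv 𝓘(ℝ, E) 𝓘(ℝ, E) (extChartAt 𝓘(ℝ, E) x₀) x : E →L[ℝ] E).IsInvertible :=
    isInvertible_mfderiv_extChartAt ((extChartAt_source 𝓘(ℝ, E) x₀).symm ▸ hx)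
  have heq : leftDeriv (E := E) (extChartAt 𝓘(ℝ, E) x₀) x =
      (mfderiv 𝓘(ℝ, E) 𝓘(ℝ, E) (extChartAt 𝓘(ℝ, E) x₀) x : E →L[ℝ] E) ∘L
        (leftFrame E x : E →L[ℝ] E) :=
    ContinuousLinearMap.ext fun X ↦
      (mfderiv_leftFrame (mdifferentiableAt_extChartAt hx) X).symm
  rw [heq]
  exact hmfderiv.comp ⟨leftFrame E x, rfl⟩

theorem contMDiffAt_leftDeriv_extChartAt (x₀ : G) :
    ContMDiffAt 𝓘(ℝ, E) 𝓘(ℝ, E →L[ℝ] E) ∞ (leftDeriv (E := E) (extChartAt 𝓘(ℝ, E) x₀)) x₀ :=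
  contMDiffAt_leftDeriv (contMDiffAt_extChartAt (I := 𝓘(ℝ, E)) (n := ∞))

theorem contMDiff_of_frameComponents {Y : Π x : G, TangentSpace 𝓘(ℝ, E) x}
    (hY : ContMDiff 𝓘(ℝ, E) 𝓘(ℝ, E) ∞ (frameComponents Y)) : CMDiff ∞ (T% Y) := fun x₀ ↦ by
  rw [Bundle.contMDiffAt_section]
  refine ((contMDiffAt_leftDeriv_extChartAt x₀).clm_apply (hY x₀)).congr_of_eventuallyEq ?_
  filter_upwards [chart_source_mem_nhds E x₀] with x hx
  exact trivializationAt_apply_snd hx Y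

theorem contMDiff_leftInvField (X : E) : CMDiff ∞ (T% (leftInvField G X)) :=
  contMDiff_of_frameComponents <| by
    rw [frameComponents_leftInvField]
    exact contMDiff_const

theorem mdifferentiableAt_leftInvField (X : E) (x : G) : MDiffAt (T% (leftInvField G X)) x :=
  (contMDiff_leftInvField X).mdifferentiable (by simp) x

theorem contMDiffAt_inverse_leftDeriv_extChartAt [CompleteSpace E] (x₀ : G) :
    ContMDiffAt 𝓘(ℝ, E) 𝓘(ℝ, E →L[ℝ] E) ∞
      (fun x ↦ (leftDeriv (E := E) (extChartAt 𝓘(ℝ, E) x₀) x).inverse) x₀ :=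
  (isInvertible_leftDeriv_extChartAt (mem_chart_source E x₀)).contDiffAt_map_inverse.contMDiffAt
    |>.comp x₀ (contMDiffAt_leftDeriv_extChartAt x₀)

theorem mdifferentiableAt_frameComponents [CompleteSpace E]
    {Y : Π x : G, TangentSpace 𝓘(ℝ, E) x} {x₀ : G} (hY : MDiffAt (T% Y) x₀) :
    MDifferentiableAt 𝓘(ℝ, E) 𝓘(ℝ, E) (frameComponents Y) x₀ := by
  rw [mdifferentiableAt_section] at hY
  have hinverse :=
    (contMDiffAt_inverse_leftDeriv_extChartAt (E := E) x₀).mdifferentiableAt (by simp)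
  refine (hinverse.clm_apply hY).congr_of_eventuallyEq ?_
  filter_upwards [chart_source_mem_nhds E x₀] with x hx
  rw [trivializationAt_apply_snd hx]
  exact ((isInvertible_leftDeriv_extChartAt hx).inverse_apply_self _).symm

theorem derivAlong_derivAlong [CompleteSpace E] {F : Type*} [NormedAddCommGroup F]
    [NormedSpace ℝ F] {f : G → F} {x : G} (hf : ContMDiffAt 𝓘(ℝ, E) 𝓘(ℝ, F) ∞ f x)
    {Y : Π x : G, TangentSpace 𝓘(ℝ, E) x} (hY : MDiffAt (T% Y) x)
    (X : Π x : G, TangentSpace 𝓘(ℝ, E) x) :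
    derivAlong (derivAlong f Y) X x =
      leftDeriv f x (leftDeriv (frameComponents Y) x (frameComponents X x)) +
        leftDeriv (leftDeriv f) x (frameComponents X x) (frameComponents Y x) := by
  have hf' : MDifferentiableAt 𝓘(ℝ, E) 𝓘(ℝ, E →L[ℝ] F) (leftDeriv (E := E) f) x :=
    (contMDiffAt_leftDeriv hf).mdifferentiableAt (by simp)
  have hY' := mdifferentiableAt_frameComponents hY
  have heq : derivAlong f Y =ᶠ[𝓝 x] fun y ↦ leftDeriv f y (frameComponents Y y) :=
    (eventually_mdifferentiableAt (hf.of_le ENat.LEInfty.out)).mono fun y hy ↦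
      derivAlong_eq_leftDeriv hy Y
  have hdiff : MDifferentiableAt 𝓘(ℝ, E) 𝓘(ℝ, F) (derivAlong f Y) x :=
    (hf'.clm_apply hY').congr_of_eventuallyEq heq
  have hfderiv := ((hasFDerivAt_leftDeriv hf').clm_apply (hasFDerivAt_leftDeriv hY')).fderiv
  rw [derivAlong_eq_leftDeriv hdiff, leftDeriv_congr heq]
  exact congr($hfderiv (frameComponents X x)).trans (by simp)

theorem frameComponents_mlieBracket [FiniteDimensional ℝ E]
    {X Y : Π x : G, TangentSpace 𝓘(ℝ, E) x} {x : G}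
    (hX : MDiffAt (T% X) x) (hY : MDiffAt (T% Y) x) :
    frameComponents (mlieBracket 𝓘(ℝ, E) X Y) x =
      leftDeriv (frameComponents Y) x (frameComponents X x) -
          leftDeriv (frameComponents X) x (frameComponents Y x) +
        bracket E G (frameComponents X x) (frameComponents Y x) := by
  have := FiniteDimensional.complete ℝ E
  have hchart := contMDiffAt_leftChart (mem_leftChart_source (E := E) x)
  have hderiv := derivAlong_mlieBracket (hchart.of_le ENat.LEInfty.out) hX hY
  have hsecond := leftDeriv_leftDeriv_sub hchart (frameComponents X x) (frameComponents Y x)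
  rw [derivAlong_derivAlong hchart hX, derivAlong_derivAlong hchart hY,
    derivAlong_eq_leftDeriv (hchart.mdifferentiableAt (by simp))] at hderiv
  simp only [leftDeriv_leftChart_self, ContinuousLinearMap.id_apply] at hderiv hsecond
  linear_combination (norm := module) hderiv + hsecond

theorem mlieBracket_leftInvField [FiniteDimensional ℝ E] (X Y : E) (x : G) :
    mlieBracket 𝓘(ℝ, E) (leftInvField G X) (leftInvField G Y) x =
      leftInvField G (bracket E G X Y) x := by
  have := lieGroup_minSmoothness E G
  exact congrFun (mulInvariantVector_mlieBracket (I := 𝓘(ℝ, E)) (G := G) X Y).symm x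

end FrameComponents

section IntegralCurves

variable {E : Type*} [NormedAddCommGroup E] [NormedSpace ℝ E]
  {G : Type*} [TopologicalSpace G] [ChartedSpace E G] [Group G]

variable [LieGroup 𝓘(ℝ, E) ∞ G]

theorem isMIntegralCurveOn_mul_left {X : E} {γ : ℝ → G} {s : Set ℝ} (g : G)
    (hγ : IsMIntegralCurveOn γ (leftInvField G X) s) :
    IsMIntegralCurveOn (fun t ↦ g * γ t) (leftInvField G X) s := fun t ht ↦ by
  refine ((mdifferentiableAt_mul_left g (γ t)).hasMFDerivAt.comp_hasMFDerivWithinAt t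
    (hγ t ht)).congr_mfderiv (ContinuousLinearMap.ext fun c ↦ ?_)
  refine (map_smul (mulLeftDeriv E g (γ t)) (show ℝ from c) (leftFrame E (γ t) X)).trans ?_
  exact congrArg (fun w : E ↦ (show ℝ from c) • w) (mfderiv_mul_left_leftFrame g (γ t) X)

theorem hasDerivAt_comp_of_isMIntegralCurve {F : Type*} [NormedAddCommGroup F] [NormedSpace ℝ F]
    {X : E} {γ : ℝ → G} (hγ : IsMIntegralCurve γ (leftInvField G X)) {f : G → F} {t : ℝ}
    (hf : MDifferentiableAt 𝓘(ℝ, E) 𝓘(ℝ, F) f (γ t)) :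
    HasDerivAt (f ∘ γ) (leftDeriv f (γ t) X) t := by
  let A : E →L[ℝ] F := mfderiv 𝓘(ℝ, E) 𝓘(ℝ, F) f (γ t)
  have hcomp : HasFDerivAt (f ∘ γ)
      (A ∘L ContinuousLinearMap.smulRight (1 : ℝ →L[ℝ] ℝ) (leftFrame E (γ t) X)) t :=
    hasMFDerivAt_iff_hasFDerivAt.1 (hf.hasMFDerivAt.comp t (hγ t))
  have hA : A (leftFrame E (γ t) X) = leftDeriv f (γ t) X := mfderiv_leftFrame hf X
  simpa [← hA] using hcomp.hasDerivAt

theorem exists_isMIntegralCurve_leftInvField [CompleteSpace E] [T2Space G] (X : E) (g : G) :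
    ∃ γ : ℝ → G, γ 0 = g ∧ IsMIntegralCurve γ (leftInvField G X) := by
  have hsmooth : CMDiff 1 (T% (leftInvField G X)) := (contMDiff_leftInvField X).of_le (by simp)
  obtain ⟨γ, hγ_zero, hγ⟩ :=
    exists_isMIntegralCurveAt_of_contMDiffAt_boundaryless (t₀ := 0) (hsmooth 1)
  obtain ⟨ε, hε, hγ⟩ := isMIntegralCurveAt_iff'.1 hγ
  rw [Real.ball_eq_Ioo, zero_sub, zero_add] at hγ
  exact exists_isMIntegralCurve_of_isMIntegralCurveOn hsmooth hε
    (fun x ↦ ⟨fun t ↦ x * γ t, by simp [hγ_zero], isMIntegralCurveOn_mul_left x hγ⟩) g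

end IntegralCurves

section Grading

variable {E : Type*} [NormedAddCommGroup E] [NormedSpace ℝ E] [FiniteDimensional ℝ E]
  {G : Type*} [TopologicalSpace G] [ChartedSpace E G] [Group G] [LieGroup 𝓘(ℝ, E) ∞ G]
  {r : ℕ} {layer : ℕ → Submodule ℝ E}

variable (E G) in
/-- A Carnot grading of the Lie algebra of `G`, expressed on the model space: the counterpart of
`IsCarnotGrading` for the bilinear map `bracket E G`. -/
structure IsGrading (r : ℕ) (layer : ℕ → Submodule ℝ E) : Prop where
  isInternal : DirectSum.IsInternal layer
  layer_zero : layer 0 = ⊥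
  layer_of_lt : ∀ k, r < k → layer k = ⊥
  span_bracket : ∀ k, 1 ≤ k → k < r →
    Submodule.span ℝ {z | ∃ x ∈ layer 1, ∃ y ∈ layer k, bracket E G x y = z} = layer (k + 1)
  bracket_last : ∀ x ∈ layer 1, ∀ y ∈ layer r, bracket E G x y = 0

theorem bracketSpan_eq_bot_iff {𝔞 𝔟 : Submodule ℝ E} :
    bracketSpan 𝓘(ℝ, E) G 𝔞 𝔟 = ⊥ ↔ ∀ x ∈ 𝔞, ∀ y ∈ 𝔟, bracket E G x y = 0 := by
  refine Submodule.span_eq_bot.trans ⟨fun h x hx y hy ↦ h _ ⟨x, hx, y, hy, rfl⟩, ?_⟩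
  rintro h _ ⟨x, hx, y, hy, rfl⟩
  exact h x hx y hy

theorem IsCarnotGrading.isGrading (h : IsCarnotGrading 𝓘(ℝ, E) G r layer) :
    IsGrading E G r layer where
  isInternal := h.isInternal
  layer_zero := h.layer_zero
  layer_of_lt := h.layer_of_lt
  span_bracket := h.bracket_layer
  bracket_last := bracketSpan_eq_bot_iff.1 h.bracket_last

section LayerSum

variable {V : Type*} [AddCommGroup V] [Module ℝ V]

/-- The sum of the layers whose index lies in `S`. -/
def layerSum (layer : ℕ → Submodule ℝ V) (S : Set ℕ) : Submodule ℝ V :=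
  ⨆ k : ℕ, ⨆ _ : k ∈ S, layer k

theorem layer_le_layerSum (layer : ℕ → Submodule ℝ V) {S : Set ℕ} {k : ℕ} (hk : k ∈ S) :
    layer k ≤ layerSum layer S :=
  le_iSup₂_of_le k hk le_rfl

theorem layerSum_sup (layer : ℕ → Submodule ℝ V) (S T : Set ℕ) :
    layerSum layer S ⊔ layerSum layer T = layerSum layer (S ∪ T) :=
  iSup_union.symm

end LayerSum

namespace IsGrading

theorem eq_zero_or_index_mem (gr : IsGrading E G r layer) {k : ℕ} {x : E} (hx : x ∈ layer k) :
    x = 0 ∨ 1 ≤ k ∧ k ≤ r := by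
  rcases Nat.eq_zero_or_pos k with rfl | hk
  · exact .inl (by simpa [gr.layer_zero] using hx)
  rcases lt_or_ge r k with hr | hr
  · exact .inl (by simpa [gr.layer_of_lt k hr] using hx)
  · exact .inr ⟨hk, hr⟩

theorem layerSum_le (gr : IsGrading E G r layer) {S : Set ℕ} {q : Submodule ℝ E}
    (h : ∀ k ∈ S, 1 ≤ k → k ≤ r → layer k ≤ q) : layerSum layer S ≤ q :=
  iSup₂_le fun k hk x hx ↦ by
    obtain rfl | ⟨hk_one, hkr⟩ := gr.eq_zero_or_index_mem hx
    · exact zero_mem q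
    · exact h k hk hk_one hkr hx

theorem layerSum_mono (gr : IsGrading E G r layer) {S T : Set ℕ}
    (h : ∀ k ∈ S, 1 ≤ k → k ≤ r → k ∈ T) : layerSum layer S ≤ layerSum layer T :=
  gr.layerSum_le fun k hk hk_one hkr ↦ layer_le_layerSum layer (h k hk hk_one hkr)

theorem layerSum_univ (gr : IsGrading E G r layer) : layerSum layer Set.univ = ⊤ := by
  simpa [layerSum] using gr.isInternal.submodule_iSup_eq_top

section Bracket

theorem bracket_layer_one_mem (gr : IsGrading E G r layer) {j : ℕ} {x y : E} (hx : x ∈ layer 1)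
    (hy : y ∈ layer j) : bracket E G x y ∈ layer (j + 1) := by
  obtain rfl | ⟨hj, hjr⟩ := gr.eq_zero_or_index_mem hy
  · simp
  obtain rfl | hjr := hjr.eq_or_lt
  · simp [gr.bracket_last x hx y hy]
  · rw [← gr.span_bracket j hj hjr]
    exact Submodule.subset_span ⟨x, hx, y, hy, rfl⟩

theorem bracket_mem_layer (gr : IsGrading E G r layer) {i j : ℕ} {x y : E} (hx : x ∈ layer i)
    (hy : y ∈ layer j) : bracket E G x y ∈ layer (i + j) := by
  induction i generalizing j x y with
  | zero => simp_all [gr.layer_zero]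
  | succ i ih =>
    rcases Nat.eq_zero_or_pos i with rfl | hi
    · simpa [add_comm] using gr.bracket_layer_one_mem hx hy
    obtain rfl | ⟨-, hir⟩ := gr.eq_zero_or_index_mem hx
    · simp
    rw [← gr.span_bracket i hi hir] at hx
    induction hx using Submodule.span_induction with
    | mem z hz =>
      obtain ⟨u, hu, v, hv, rfl⟩ := hz
      have hjacobi : bracket E G (bracket E G u v) y =
          bracket E G u (bracket E G v y) - bracket E G v (bracket E G u y) := by
        rw [bracket_jacobi u v y, add_sub_cancel_right]
      rw [hjacobi, Nat.add_right_comm]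
      exact sub_mem (gr.bracket_layer_one_mem hu (ih hv hy))
        (ih hv (gr.bracket_layer_one_mem hu hy))
    | zero => simp
    | add a b _ _ ha hb => simpa using add_mem ha hb
    | smul c a _ ha => simpa using Submodule.smul_mem _ c ha

theorem bracket_mem_layerSum (gr : IsGrading E G r layer) {S T U : Set ℕ}
    (h : ∀ i ∈ S, ∀ j ∈ T, 1 ≤ i → 1 ≤ j → i + j ≤ r → i + j ∈ U) {x y : E}
    (hx : x ∈ layerSum layer S) (hy : y ∈ layerSum layer T) :
    bracket E G x y ∈ layerSum layer U := by
  have hleft : layerSum layer S ≤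
      (layerSum layer U).comap ((bracket E G).flip y).toLinearMap := by
    refine gr.layerSum_le fun i hi hi_one _ a ha ↦ ?_
    have hright : layerSum layer T ≤ (layerSum layer U).comap (bracket E G a).toLinearMap := by
      refine gr.layerSum_le fun j hj hj_one _ b hb ↦ ?_
      have hab := gr.bracket_mem_layer ha hb
      obtain hzero | ⟨-, hijr⟩ := gr.eq_zero_or_index_mem hab
      · simp [hzero]
      · exact layer_le_layerSum layer (h i hi j hj hi_one hj_one hijr) hab
    exact hright hy
  exact hleft hx

theorem bracket_eq_zero_of_mem_layerSum (gr : IsGrading E G r layer) {S T : Set ℕ}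
    (h : ∀ i ∈ S, ∀ j ∈ T, 1 ≤ i → 1 ≤ j → r < i + j) {x y : E}
    (hx : x ∈ layerSum layer S) (hy : y ∈ layerSum layer T) : bracket E G x y = 0 := by
  have hempty := gr.bracket_mem_layerSum (U := ∅) (fun i hi j hj hi_one hj_one hr ↦
    (h i hi j hj hi_one hj_one).not_ge hr) hx hy
  simpa [layerSum] using hempty

theorem eq_top_of_layer_one_le (gr : IsGrading E G r layer) {q : Submodule ℝ E}
    (hq : layer 1 ≤ q) (h : ∀ x ∈ layer 1, ∀ y ∈ q, bracket E G x y ∈ q) : q = ⊤ := by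
  have hlayer (k : ℕ) (hk : 1 ≤ k) : k ≤ r → layer k ≤ q := by
    induction k, hk using Nat.le_induction with
    | base => exact fun _ ↦ hq
    | succ k hk ih =>
      intro hkr
      rw [← gr.span_bracket k hk hkr, Submodule.span_le]
      rintro _ ⟨x, hx, y, hy, rfl⟩
      exact h x hx y (ih (by omega) hy)
  rw [eq_top_iff, ← gr.layerSum_univ]
  exact gr.layerSum_le fun k _ hk hkr ↦ hlayer k hk hkr

end Bracket

section Diagonal

theorem bijective_coeLinearMap (gr : IsGrading E G r layer) :
    Function.Bijective (DirectSum.coeLinearMap layer) :=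
  gr.isInternal

/-- The diagonal operator that multiplies the layer of index `k` by `f k`. -/
def diag (gr : IsGrading E G r layer) (f : ℕ → ℝ) : E →L[ℝ] E :=
  LinearMap.toContinuousLinearMap
    (DirectSum.toModule ℝ ℕ E (fun k ↦ f k • (layer k).subtype) ∘ₗ
      (LinearEquiv.ofBijective (DirectSum.coeLinearMap layer)
        gr.bijective_coeLinearMap).symm.toLinearMap)

theorem diag_of_mem (gr : IsGrading E G r layer) (f : ℕ → ℝ) {k : ℕ} {x : E} (hx : x ∈ layer k) :
    gr.diag f x = f k • x := by
  have hcomponent :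
      (LinearEquiv.ofBijective (DirectSum.coeLinearMap layer) gr.bijective_coeLinearMap).symm x =
        DirectSum.lof ℝ ℕ (fun k ↦ layer k) k ⟨x, hx⟩ := by
    rw [LinearEquiv.symm_apply_eq, LinearEquiv.ofBijective_apply]
    exact (DirectSum.coeLinearMap_of layer k ⟨x, hx⟩).symm
  simp [diag, hcomponent]

theorem eqOn_layerSum {F : Type*} [NormedAddCommGroup F] [NormedSpace ℝ F]
    (gr : IsGrading E G r layer) {A B : E →L[ℝ] F} {S : Set ℕ}
    (h : ∀ k ∈ S, 1 ≤ k → k ≤ r → ∀ x ∈ layer k, A x = B x) :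
    Set.EqOn A B (layerSum layer S) := fun _ hx ↦
  gr.layerSum_le (q := LinearMap.eqLocus A.toLinearMap B.toLinearMap) h hx

theorem continuousLinearMap_ext {F : Type*} [NormedAddCommGroup F] [NormedSpace ℝ F]
    (gr : IsGrading E G r layer) {A B : E →L[ℝ] F}
    (h : ∀ k, 1 ≤ k → k ≤ r → ∀ x ∈ layer k, A x = B x) : A = B := by
  ext x
  exact gr.eqOn_layerSum (S := Set.univ) (fun k _ ↦ h k) (by simp [gr.layerSum_univ])

theorem diag_comp (gr : IsGrading E G r layer) (f g : ℕ → ℝ) :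
    gr.diag f ∘L gr.diag g = gr.diag (f * g) :=
  gr.continuousLinearMap_ext fun k _ _ x hx ↦ by
    simp [gr.diag_of_mem _ hx, mul_smul, smul_comm (f k)]

theorem diag_add (gr : IsGrading E G r layer) (f g : ℕ → ℝ) :
    gr.diag (f + g) = gr.diag f + gr.diag g :=
  gr.continuousLinearMap_ext fun k _ _ x hx ↦ by simp [gr.diag_of_mem _ hx, add_smul]

theorem diag_eq_smul (gr : IsGrading E G r layer) {f : ℕ → ℝ} {c : ℝ} {S : Set ℕ}
    (h : ∀ k ∈ S, 1 ≤ k → k ≤ r → f k = c) {x : E} (hx : x ∈ layerSum layer S) :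
    gr.diag f x = c • x :=
  gr.eqOn_layerSum (B := c • ContinuousLinearMap.id ℝ E) (fun k hk hk_one hkr y hy ↦ by
    simp [gr.diag_of_mem f hy, h k hk hk_one hkr]) hx

theorem diag_eq_id (gr : IsGrading E G r layer) {f : ℕ → ℝ} (h : ∀ k, 1 ≤ k → k ≤ r → f k = 1) :
    gr.diag f = ContinuousLinearMap.id ℝ E :=
  gr.continuousLinearMap_ext fun k hk hkr x hx ↦ by simp [gr.diag_of_mem f hx, h k hk hkr]

theorem diag_mem_layerSum (gr : IsGrading E G r layer) {f : ℕ → ℝ} {S T : Set ℕ}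
    (h : ∀ k ∈ S, 1 ≤ k → k ≤ r → k ∉ T → f k = 0) {x : E} (hx : x ∈ layerSum layer S) :
    gr.diag f x ∈ layerSum layer T := by
  refine gr.layerSum_le (q := (layerSum layer T).comap (gr.diag f).toLinearMap)
    (fun k hk hk_one hkr y hy ↦ ?_) hx
  change gr.diag f y ∈ layerSum layer T
  rw [gr.diag_of_mem f hy]
  by_cases hkT : k ∈ T
  · exact Submodule.smul_mem _ _ (layer_le_layerSum layer hkT hy)
  · simp [h k hk hk_one hkr hkT]

/-- The projection onto the sum of the layers with index in `S`, along the other layers. -/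
def proj (gr : IsGrading E G r layer) (S : Set ℕ) : E →L[ℝ] E := gr.diag (S.indicator 1)

theorem proj_mem (gr : IsGrading E G r layer) (S : Set ℕ) (x : E) :
    gr.proj S x ∈ layerSum layer S :=
  gr.diag_mem_layerSum (S := Set.univ) (fun k _ _ _ hk ↦ by simp [hk]) (by simp [gr.layerSum_univ])

theorem proj_of_mem (gr : IsGrading E G r layer) {S T : Set ℕ}
    (h : ∀ k ∈ S, 1 ≤ k → k ≤ r → k ∈ T) {x : E} (hx : x ∈ layerSum layer S) :
    gr.proj T x = x :=
  (gr.diag_eq_smul (fun k hk hk_one hkr ↦ by simp [h k hk hk_one hkr]) hx).trans (one_smul ℝ x)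

theorem proj_eq_zero (gr : IsGrading E G r layer) {S T : Set ℕ}
    (h : ∀ k ∈ S, 1 ≤ k → k ≤ r → k ∉ T) {x : E} (hx : x ∈ layerSum layer S) :
    gr.proj T x = 0 :=
  (gr.diag_eq_smul (fun k hk hk_one hkr ↦ by simp [h k hk hk_one hkr]) hx).trans (zero_smul ℝ x)

theorem proj_add_proj_compl (gr : IsGrading E G r layer) (S : Set ℕ) (x : E) :
    gr.proj S x + gr.proj Sᶜ x = x := by
  have hsum : gr.diag (S.indicator 1 + Sᶜ.indicator 1) = ContinuousLinearMap.id ℝ E := by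
    rw [Set.indicator_self_add_compl]
    exact gr.diag_eq_id fun _ _ _ ↦ rfl
  rw [gr.diag_add] at hsum
  exact congr($hsum x)

theorem mem_layerSum_compl_of_proj_eq_zero (gr : IsGrading E G r layer) {S : Set ℕ} {x : E}
    (hx : gr.proj S x = 0) : x ∈ layerSum layer Sᶜ := by
  rw [← gr.proj_add_proj_compl S x, hx, zero_add]
  exact gr.proj_mem Sᶜ x

theorem isCompl_layerSum (gr : IsGrading E G r layer) (S : Set ℕ) :
    IsCompl (layerSum layer S) (layerSum layer Sᶜ) := by
  refine .of_eq ((Submodule.eq_bot_iff _).2 fun x hx ↦ ?_) ?_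
  · rw [← gr.proj_of_mem (fun _ hk _ _ ↦ hk) (Submodule.mem_inf.1 hx).1]
    exact gr.proj_eq_zero (fun _ hk _ _ ↦ hk) (Submodule.mem_inf.1 hx).2
  · rw [layerSum_sup, Set.union_compl_self, gr.layerSum_univ]

end Diagonal

section Weight

/-- The derivation of the Lie algebra that multiplies the layer of index `k` by `k`. -/
def weight (gr : IsGrading E G r layer) : E →L[ℝ] E := gr.diag fun k ↦ k

/-- The inverse of the derivation `weight`. The junk value `0⁻¹ = 0` is taken on the layer of index
`0` only, which is trivial. -/
def weightInv (gr : IsGrading E G r layer) : E →L[ℝ] E := gr.diag fun k ↦ (k : ℝ)⁻¹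

theorem weight_comp_weightInv (gr : IsGrading E G r layer) :
    gr.weight ∘L gr.weightInv = ContinuousLinearMap.id ℝ E :=
  (gr.diag_comp _ _).trans <| gr.diag_eq_id fun k hk _ ↦ mul_inv_cancel₀ (by positivity)

theorem weightInv_comp_weight (gr : IsGrading E G r layer) :
    gr.weightInv ∘L gr.weight = ContinuousLinearMap.id ℝ E :=
  (gr.diag_comp _ _).trans <| gr.diag_eq_id fun k hk _ ↦ inv_mul_cancel₀ (by positivity)

theorem weight_weightInv (gr : IsGrading E G r layer) (x : E) : gr.weight (gr.weightInv x) = x :=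
  congr($gr.weight_comp_weightInv x)

theorem weightInv_weight (gr : IsGrading E G r layer) (x : E) : gr.weightInv (gr.weight x) = x :=
  congr($gr.weightInv_comp_weight x)

theorem weight_mem_layerSum (gr : IsGrading E G r layer) {S : Set ℕ} {x : E}
    (hx : x ∈ layerSum layer S) : gr.weight x ∈ layerSum layer S :=
  gr.diag_mem_layerSum (fun _ hk _ _ h ↦ absurd hk h) hx

theorem weightInv_mem_layerSum (gr : IsGrading E G r layer) {S : Set ℕ} {x : E}
    (hx : x ∈ layerSum layer S) : gr.weightInv x ∈ layerSum layer S :=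
  gr.diag_mem_layerSum (fun _ hk _ _ h ↦ absurd hk h) hx

theorem weight_bracket (gr : IsGrading E G r layer) (x y : E) : gr.weight (bracket E G x y) =
    bracket E G (gr.weight x) y + bracket E G x (gr.weight y) := by
  have hbilinear : ContinuousLinearMap.compL ℝ E E E gr.weight ∘L bracket E G =
      bracket E G ∘L gr.weight +
        (ContinuousLinearMap.compL ℝ E E E).flip gr.weight ∘L bracket E G := by
    refine gr.continuousLinearMap_ext fun i _ _ a ha ↦
      gr.continuousLinearMap_ext fun j _ _ b hb ↦ ?_
    simp [weight, gr.diag_of_mem _ (gr.bracket_mem_layer ha hb), gr.diag_of_mem _ ha,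
      gr.diag_of_mem _ hb, add_smul]
  exact congr($hbilinear x y)

end Weight

theorem leftDeriv_eq_zero_of_layer_one {F : Type*} [NormedAddCommGroup F] [NormedSpace ℝ F]
    (gr : IsGrading E G r layer) {f : G → F} (hf : ContMDiff 𝓘(ℝ, E) 𝓘(ℝ, F) ∞ f)
    (h : ∀ g, ∀ X ∈ layer 1, leftDeriv f g X = 0) (g : G) : leftDeriv (E := E) f g = 0 := by
  let constantDirections : Submodule ℝ E :=
    ⨅ g : G, LinearMap.ker (leftDeriv (E := E) f g).toLinearMap
  have hmem {X : E} : X ∈ constantDirections ↔ ∀ g, leftDeriv f g X = 0 := by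
    simp [constantDirections]
  have hsecond {X : E} (hX : X ∈ constantDirections) (Y : E) (g : G) :
      leftDeriv (leftDeriv (E := E) f) g Y X = 0 := by
    rw [← leftDeriv_clm_apply ((contMDiff_leftDeriv hf).mdifferentiable (by simp) g),
      funext (hmem.1 hX)]
    simp
  have htop : constantDirections = ⊤ := by
    refine gr.eq_top_of_layer_one_le (fun X hX ↦ hmem.2 fun g ↦ h g X hX) fun X hX Y hY ↦ ?_
    refine hmem.2 fun g ↦ ?_
    rw [← leftDeriv_leftDeriv_sub (hf g), hsecond (hmem.2 fun g ↦ h g X hX), hsecond hY, sub_zero]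
  ext X
  exact hmem.1 (htop ▸ Submodule.mem_top) g

end IsGrading

end Grading

section LocalInverse

variable {E : Type*} [NormedAddCommGroup E] [NormedSpace ℝ E] [FiniteDimensional ℝ E]
  {G : Type*} [TopologicalSpace G] [ChartedSpace E G] [Group G] [LieGroup 𝓘(ℝ, E) ∞ G]

theorem exists_localInverse {f : G → E} {g : G} (hf : ContMDiffAt 𝓘(ℝ, E) 𝓘(ℝ, E) ∞ f g)
    (hinj : Function.Injective (leftDeriv (E := E) f g)) :
    ∃ φ : E → G, ContMDiffAt 𝓘(ℝ, E) 𝓘(ℝ, E) ∞ φ (f g) ∧ ∀ᶠ x in 𝓝 g, φ (f x) = x := by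
  have := FiniteDimensional.complete ℝ E
  let A : E ≃L[ℝ] E := (LinearEquiv.ofInjectiveEndo _ hinj).toContinuousLinearEquiv
  have hsmooth := contMDiffAt_iff_comp_leftChart_symm_basePt.1 hf
  have hA : HasFDerivAt (f ∘ (leftChart E g).symm) (A : E →L[ℝ] E) (basePt E G) :=
    hasFDerivAt_leftDeriv (hf.mdifferentiableAt (by simp))
  let ψ := hsmooth.localInverse hA (by simp)
  have hψ : ContDiffAt ℝ ∞ ψ (f g) := by
    simpa using hsmooth.to_localInverse hA (by simp)
  have hleft : ∀ᶠ x in 𝓝 g, ψ (f x) = leftChart E g x := by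
    have htendsto := (contMDiffAt_leftChart (mem_leftChart_source (E := E) g)).continuousAt.tendsto
    rw [leftChart_self] at htendsto
    filter_upwards [htendsto.eventually
        (hsmooth.hasStrictFDerivAt' hA (by simp)).eventually_left_inverse,
      (isOpen_leftChart_source (E := E) g).mem_nhds (mem_leftChart_source g)] with x hx hx_source
    rwa [Function.comp_apply, (leftChart E g).left_inv hx_source] at hx
  have hψ_base : ψ (f g) = basePt E G := hleft.self_of_nhds.trans (leftChart_self g)
  refine ⟨(leftChart E g).symm ∘ ψ, ContMDiffAt.comp (I' := 𝓘(ℝ, E)) (f g)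
    (contMDiffAt_leftChart_symm (hψ_base ▸ basePt_mem_target g)) hψ.contMDiffAt, ?_⟩
  filter_upwards [hleft, (isOpen_leftChart_source (E := E) g).mem_nhds (mem_leftChart_source g)]
    with x hx hx_source
  rw [Function.comp_apply, hx, (leftChart E g).left_inv hx_source]

variable {f : G → E} {s : E → G}

theorem contMDiff_of_rightInverse (hf : ContMDiff 𝓘(ℝ, E) 𝓘(ℝ, E) ∞ f)
    (hinj : ∀ g, Function.Injective (leftDeriv (E := E) f g)) (hs : Continuous s)
    (hfs : Function.RightInverse s f) : ContMDiff 𝓘(ℝ, E) 𝓘(ℝ, E) ∞ s := fun w ↦ by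
  obtain ⟨φ, hφ, hleft⟩ := exists_localInverse (hf (s w)) (hinj (s w))
  rw [hfs w] at hφ
  refine hφ.congr_of_eventuallyEq ?_
  filter_upwards [(hs.tendsto w).eventually hleft] with v hv
  rw [← hv, hfs v]

theorem leftInverse_of_rightInverse [T2Space G] [PreconnectedSpace G]
    (hf : ContMDiff 𝓘(ℝ, E) 𝓘(ℝ, E) ∞ f)
    (hinj : ∀ g, Function.Injective (leftDeriv (E := E) f g)) (hs : Continuous s)
    (hfs : Function.RightInverse s f) : Function.LeftInverse s f := by
  have hcont : Continuous (s ∘ f) := hs.comp hf.continuous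
  have hclosed : IsClosed {x | s (f x) = x} := isClosed_eq hcont continuous_id
  have hopen : IsOpen {x | s (f x) = x} := by
    rw [isOpen_iff_mem_nhds]
    intro x hx
    obtain ⟨φ, -, hleft⟩ := exists_localInverse (hf x) (hinj x)
    have htendsto : Filter.Tendsto (s ∘ f) (𝓝 x) (𝓝 x) := by
      simpa only [Function.comp_apply, show s (f x) = x from hx] using hcont.tendsto x
    filter_upwards [hleft, htendsto.eventually hleft] with y hy hy_section
    rwa [Function.comp_apply, hfs (f y), hy, eq_comm] at hy_section
  exact Set.eq_univ_iff_forall.1 (IsClopen.eq_univ ⟨hclosed, hopen⟩ ⟨s 0, congrArg s (hfs 0)⟩)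

end LocalInverse

theorem eq_add_smul_of_hasDerivAt {F : Type*} [NormedAddCommGroup F] [NormedSpace ℝ F]
    {f : ℝ → F} {v : F} (hf : ∀ t, HasDerivAt f v t) (t : ℝ) : f t = f 0 + t • v := by
  have hderiv (t : ℝ) : HasDerivAt (fun t ↦ f t - t • v) 0 t := by
    simpa using (hf t).fun_sub ((hasDerivAt_id t).smul_const v)
  have hconst := is_const_of_deriv_eq_zero (fun t ↦ (hderiv t).differentiableAt)
    (fun t ↦ (hderiv t).deriv) t 0
  rwa [zero_smul, sub_zero, sub_eq_iff_eq_add] at hconst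

namespace IsGrading

section Filtration

variable {E : Type*} [NormedAddCommGroup E] [NormedSpace ℝ E]

/-- The terms of the descending filtration defined by a sequence of layers. -/
abbrev filtration (layer : ℕ → Submodule ℝ E) (j : ℕ) : Submodule ℝ E := layerSum layer {k | j ≤ k}

variable [FiniteDimensional ℝ E] {G : Type*} [TopologicalSpace G] [ChartedSpace E G] [Group G]
  [LieGroup 𝓘(ℝ, E) ∞ G] {r : ℕ} {layer : ℕ → Submodule ℝ E}

theorem filtration_antitone (gr : IsGrading E G r layer) : Antitone (filtration layer) :=
  fun _ _ h ↦ gr.layerSum_mono fun _ hk _ _ ↦ h.trans hk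

theorem filtration_zero (gr : IsGrading E G r layer) : filtration layer 0 = ⊤ := by
  simpa [filtration] using gr.layerSum_univ

theorem filtration_eq_bot (gr : IsGrading E G r layer) {j : ℕ} (hj : r < j) :
    filtration layer j = ⊥ :=
  bot_unique (gr.layerSum_le fun _ hk _ hkr ↦ absurd (hj.trans_le hk) hkr.not_gt)

theorem bracket_mem_filtration (gr : IsGrading E G r layer) {j : ℕ} (X : E) {w : E}
    (hw : w ∈ filtration layer j) : bracket E G X w ∈ filtration layer (j + 1) :=
  gr.bracket_mem_layerSum (S := Set.univ)
    (fun _ _ _ hk hi _ _ ↦ (Nat.add_comm j 1).trans_le (Nat.add_le_add hi hk))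
    (by simp [gr.layerSum_univ]) hw

theorem proj_eq_zero_iff_mem_filtration (gr : IsGrading E G r layer) {j : ℕ} {w : E} :
    gr.proj {k | k ≤ j} w = 0 ↔ w ∈ filtration layer (j + 1) := by
  have hcompl : {k | j + 1 ≤ k} = {k | k ≤ j}ᶜ := by
    ext k
    simp
  rw [filtration, hcompl]
  exact ⟨gr.mem_layerSum_compl_of_proj_eq_zero, gr.proj_eq_zero fun _ hk _ _ ↦ hk⟩

theorem Ad_sub_mem_filtration [PreconnectedSpace G] (gr : IsGrading E G r layer) (g : G) (j : ℕ)
    {w : E} (hw : w ∈ filtration layer j) : Ad E g w - w ∈ filtration layer (j + 1) := by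
  induction hn : r + 1 - j generalizing j w g with
  | zero =>
    rw [gr.filtration_eq_bot (by omega), Submodule.mem_bot] at hw
    simp [hw]
  | succ n ih =>
    have hdiff (x : G) : MDifferentiableAt 𝓘(ℝ, E) 𝓘(ℝ, E) (fun x ↦ Ad E x w) x :=
      (mdifferentiableAt_Ad x).clm_apply mdifferentiableAt_const
    have hderiv (x : G) :
        leftDeriv (E := E) (gr.proj {k | k ≤ j} ∘ fun x ↦ Ad E x w) x = 0 := by
      rw [leftDeriv_comp (gr.proj {k | k ≤ j}).hasFDerivAt (hdiff x)]
      ext X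
      have hbracket := gr.bracket_mem_filtration X hw
      have hAd := add_mem hbracket
        (gr.filtration_antitone (Nat.le_succ _) (ih x (j + 1) hbracket (by omega)))
      rw [add_sub_cancel] at hAd
      rw [ContinuousLinearMap.comp_apply, leftDeriv_clm_apply (mdifferentiableAt_Ad x),
        leftDeriv_Ad]
      exact gr.proj_eq_zero_iff_mem_filtration.2 hAd
    have hconst := eq_of_leftDeriv_eq_zero
      (fun x ↦ MDifferentiableAt.clm_apply mdifferentiableAt_const (hdiff x)) hderiv g 1
    rw [← gr.proj_eq_zero_iff_mem_filtration, map_sub, sub_eq_zero]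
    simpa using hconst

theorem Ad_mem_filtration [PreconnectedSpace G] (gr : IsGrading E G r layer) (g : G) {j : ℕ}
    {w : E} (hw : w ∈ filtration layer j) : Ad E g w ∈ filtration layer j := by
  simpa using add_mem hw (gr.filtration_antitone j.le_succ (gr.Ad_sub_mem_filtration g j hw))

end Filtration

section Coordinates

variable {E : Type*} [NormedAddCommGroup E] [NormedSpace ℝ E] [FiniteDimensional ℝ E]
  {G : Type*} [TopologicalSpace G] [SimplyConnectedSpace G] [ChartedSpace E G] [Group G]
  [LieGroup 𝓘(ℝ, E) ∞ G] {r : ℕ} {layer : ℕ → Submodule ℝ E}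

theorem isClosedForm_Ad_comp_weight {G : Type*} [TopologicalSpace G] [ChartedSpace E G] [Group G]
    [LieGroup 𝓘(ℝ, E) ∞ G] (gr : IsGrading E G r layer) :
    IsClosedForm fun g : G ↦ Ad E g ∘L gr.weight := fun g X Y ↦ by
  simp only [leftDeriv_clm_comp (mdifferentiableAt_Ad g) mdifferentiableAt_const, leftDeriv_const,
    zero_apply, map_zero, zero_add, leftDeriv_Ad, ContinuousLinearMap.comp_apply,
    gr.weight_bracket, map_add, bracket_swap Y, map_neg, sub_neg_eq_add]
  exact add_comm _ _

theorem exists_leftDeriv_eq_Ad_comp_weight (gr : IsGrading E G r layer) :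
    ∃ c : G → E, ContMDiff 𝓘(ℝ, E) 𝓘(ℝ, E) ∞ c ∧ ∀ g, leftDeriv c g = Ad E g ∘L gr.weight :=
  have := FiniteDimensional.complete ℝ E
  gr.isClosedForm_Ad_comp_weight.exists_leftDeriv_eq (contMDiff_Ad.clm_comp contMDiff_const)

/-- The crossed homomorphism `G → 𝔤` for the adjoint action that integrates the derivation
`weight`. It is a diffeomorphism, and plays the part of the logarithm of `G`. -/
def coord (gr : IsGrading E G r layer) (g : G) : E :=
  gr.exists_leftDeriv_eq_Ad_comp_weight.choose g - gr.exists_leftDeriv_eq_Ad_comp_weight.choose 1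

theorem contMDiff_coord (gr : IsGrading E G r layer) :
    ContMDiff 𝓘(ℝ, E) 𝓘(ℝ, E) ∞ (gr.coord : G → E) :=
  gr.exists_leftDeriv_eq_Ad_comp_weight.choose_spec.1.sub contMDiff_const

theorem mdifferentiableAt_coord (gr : IsGrading E G r layer) (g : G) :
    MDifferentiableAt 𝓘(ℝ, E) 𝓘(ℝ, E) (gr.coord : G → E) g :=
  gr.contMDiff_coord.mdifferentiable (by simp) g

theorem leftDeriv_coord (gr : IsGrading E G r layer) (g : G) :
    leftDeriv gr.coord g = Ad E g ∘L gr.weight := by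
  obtain ⟨hsmooth, hderiv⟩ := gr.exists_leftDeriv_eq_Ad_comp_weight.choose_spec
  refine (leftDeriv_sub (hsmooth.mdifferentiable (by simp) g) mdifferentiableAt_const).trans ?_
  rw [leftDeriv_const, sub_zero, hderiv]

@[simp]
theorem coord_one (gr : IsGrading E G r layer) : gr.coord (1 : G) = 0 := sub_self _

theorem leftDeriv_coord_injective (gr : IsGrading E G r layer) (g : G) :
    Function.Injective (leftDeriv (E := E) gr.coord g) := by
  refine Function.LeftInverse.injective (g := fun X ↦ gr.weightInv (Ad E g⁻¹ X)) fun X ↦ ?_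
  simp [leftDeriv_coord, weightInv_weight, Ad_inv_Ad]

theorem coord_mul (gr : IsGrading E G r layer) (g h : G) :
    gr.coord (g * h) = gr.coord g + Ad E g (gr.coord h) := by
  have htranslate (x : G) :
      MDifferentiableAt 𝓘(ℝ, E) 𝓘(ℝ, E) (fun x ↦ gr.coord (g * x)) x :=
    (gr.mdifferentiableAt_coord (g * x)).comp x (mdifferentiableAt_mul_left g x)
  have hAd (x : G) : MDifferentiableAt 𝓘(ℝ, E) 𝓘(ℝ, E) (Ad E g ∘ gr.coord) x :=
    MDifferentiableAt.clm_apply mdifferentiableAt_const (gr.mdifferentiableAt_coord x)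
  refine eq_of_leftDeriv_eq (E := E) (x₀ := 1) (f' := fun x ↦ gr.coord g + Ad E g (gr.coord x))
    htranslate (fun x ↦ mdifferentiableAt_const.add (hAd x)) (fun x ↦ ?_) (by simp) h
  simp only [add_comm (gr.coord g)]
  rw [leftDeriv_comp_mul_left, leftDeriv_coord, Ad_mul]
  refine Eq.symm ((leftDeriv_add_const (hAd x) _).trans ?_)
  rw [leftDeriv_comp (Ad E g).hasFDerivAt (gr.mdifferentiableAt_coord x), leftDeriv_coord]
  rfl

theorem hasDerivAt_coord_comp (gr : IsGrading E G r layer) {Y : E} {γ : ℝ → G}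
    (hγ : IsMIntegralCurve γ (leftInvField G Y)) (t : ℝ) :
    HasDerivAt (gr.coord ∘ γ) (Ad E (γ t) (gr.weight Y)) t := by
  simpa [leftDeriv_coord] using
    hasDerivAt_comp_of_isMIntegralCurve hγ (gr.mdifferentiableAt_coord (γ t))

theorem coord_integralCurve_sub_mem_filtration (gr : IsGrading E G r layer) {j : ℕ} {Y : E}
    {γ : ℝ → G} (hY : Y ∈ filtration layer j) (hγ_zero : γ 0 = 1)
    (hγ : IsMIntegralCurve γ (leftInvField G Y)) (t : ℝ) :
    gr.coord (γ t) - t • gr.weight Y ∈ filtration layer (j + 1) := by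
  let π := gr.proj {k | k ≤ j}
  have hderiv (s : ℝ) : HasDerivAt (π ∘ gr.coord ∘ γ) (π (gr.weight Y)) s := by
    have hAd := gr.proj_eq_zero_iff_mem_filtration.2
      (gr.Ad_sub_mem_filtration (γ s) j (gr.weight_mem_layerSum hY))
    rw [map_sub, sub_eq_zero] at hAd
    have hcomp := π.hasFDerivAt.comp_hasDerivAt s (gr.hasDerivAt_coord_comp hγ s)
    exact hAd ▸ hcomp
  rw [← gr.proj_eq_zero_iff_mem_filtration, map_sub, map_smul, sub_eq_zero]
  simpa [hγ_zero, π] using eq_add_smul_of_hasDerivAt hderiv t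

section Section

variable [T2Space G]

theorem exists_continuous_coord_sub_sum_mem_filtration (gr : IsGrading E G r layer) (j : ℕ)
    {ι : Type*} (s : Finset ι) {a : ι → E → ℝ} (ha : ∀ i, Continuous (a i)) {Y : ι → E}
    (hY : ∀ i, Y i ∈ filtration layer j) :
    ∃ ρ : E → G, Continuous ρ ∧
      ∀ w, gr.coord (ρ w) - ∑ i ∈ s, a i w • gr.weight (Y i) ∈ filtration layer (j + 1) := by
  classical
  have := FiniteDimensional.complete ℝ E
  have := topologicalGroup_of_lieGroup 𝓘(ℝ, E) ∞ (G := G)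
  induction s using Finset.induction_on with
  | empty => exact ⟨fun _ ↦ 1, continuous_const, by simp⟩
  | insert i s hi ih =>
    obtain ⟨ρ, hρ, hsum⟩ := ih
    obtain ⟨γ, hγ_zero, hγ⟩ := exists_isMIntegralCurve_leftInvField (Y i) (1 : G)
    refine ⟨fun w ↦ ρ w * γ (a i w), hρ.mul (hγ.continuous.comp (ha i)), fun w ↦ ?_⟩
    have hcurve := gr.coord_integralCurve_sub_mem_filtration (hY i) hγ_zero hγ (a i w)
    have hcurve_mem : gr.coord (γ (a i w)) ∈ filtration layer j := by
      simpa using add_mem (gr.filtration_antitone j.le_succ hcurve)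
        (Submodule.smul_mem _ (a i w) (gr.weight_mem_layerSum (hY i)))
    have hmem := add_mem (add_mem (hsum w) hcurve) (gr.Ad_sub_mem_filtration (ρ w) j hcurve_mem)
    rw [Finset.sum_insert hi, coord_mul]
    convert hmem using 1
    abel

/-- Downward induction on `j`: a product of one-parameter subgroups solves the equation up to an
error one step deeper in the filtration, which the crossed homomorphism law then absorbs. -/
theorem exists_continuous_coord_eq_of_mem_filtration (gr : IsGrading E G r layer) (j : ℕ) :
    ∃ σ : E → G, Continuous σ ∧ ∀ w ∈ filtration layer j, gr.coord (σ w) = w := by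
  have := topologicalGroup_of_lieGroup 𝓘(ℝ, E) ∞ (G := G)
  induction hn : r + 1 - j generalizing j with
  | zero =>
    refine ⟨fun _ ↦ 1, continuous_const, fun w hw ↦ ?_⟩
    rw [gr.filtration_eq_bot (by omega), Submodule.mem_bot] at hw
    simp [hw]
  | succ n ih =>
    obtain ⟨σ, hσ, hσ_coord⟩ := ih (j + 1) (by omega)
    let b := Module.finBasis ℝ E
    let Y := fun i ↦ gr.weightInv (gr.proj {k | j ≤ k} (b i))
    obtain ⟨ρ, hρ, hρ_sum⟩ := gr.exists_continuous_coord_sub_sum_mem_filtration (G := G) j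
      Finset.univ (a := fun i w ↦ b.repr w i) (Y := Y)
      (fun i ↦ (LinearMap.toContinuousLinearMap (b.coord i)).continuous)
      (fun i ↦ gr.weightInv_mem_layerSum (gr.proj_mem _ _))
    have herror {w : E} (hw : w ∈ filtration layer j) :
        w - gr.coord (ρ w) ∈ filtration layer (j + 1) := by
      have hexpand : ∑ i, b.repr w i • gr.weight (Y i) = w := by
        simp only [Y, weight_weightInv, ← map_smul, ← map_sum]
        rw [b.sum_repr, gr.proj_of_mem (fun _ hk _ _ ↦ hk) hw]
      rw [← neg_mem_iff, neg_sub]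
      simpa only [hexpand] using hρ_sum w
    refine ⟨fun w ↦ ρ w * σ (Ad E (ρ w)⁻¹ (w - gr.coord (ρ w))), hρ.mul (hσ.comp ?_),
      fun w hw ↦ ?_⟩
    · exact (contMDiff_Ad.continuous.comp hρ.inv).clm_apply
        (continuous_id.sub (gr.contMDiff_coord.continuous.comp hρ))
    · rw [coord_mul, hσ_coord _ (gr.Ad_mem_filtration _ (herror hw)), Ad_Ad_inv, add_sub_cancel]

theorem exists_continuous_rightInverse_coord (gr : IsGrading E G r layer) :
    ∃ σ : E → G, Continuous σ ∧ Function.RightInverse σ gr.coord := by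
  obtain ⟨σ, hσ, hcoord⟩ := gr.exists_continuous_coord_eq_of_mem_filtration (G := G) 0
  exact ⟨σ, hσ, fun w ↦ hcoord w (by simp [gr.filtration_zero])⟩

/-- The inverse of the diffeomorphism `coord`. -/
def coordSymm (gr : IsGrading E G r layer) : E → G :=
  gr.exists_continuous_rightInverse_coord.choose

@[simp]
theorem coord_coordSymm (gr : IsGrading E G r layer) (w : E) :
    gr.coord (gr.coordSymm w : G) = w :=
  gr.exists_continuous_rightInverse_coord.choose_spec.2 w

@[simp]
theorem coordSymm_coord (gr : IsGrading E G r layer) (g : G) : gr.coordSymm (gr.coord g) = g :=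
  leftInverse_of_rightInverse gr.contMDiff_coord gr.leftDeriv_coord_injective
    gr.exists_continuous_rightInverse_coord.choose_spec.1 gr.coord_coordSymm g

theorem contMDiff_coordSymm (gr : IsGrading E G r layer) :
    ContMDiff 𝓘(ℝ, E) 𝓘(ℝ, E) ∞ (gr.coordSymm : E → G) :=
  contMDiff_of_rightInverse gr.contMDiff_coord gr.leftDeriv_coord_injective
    gr.exists_continuous_rightInverse_coord.choose_spec.1 gr.coord_coordSymm

theorem coord_injective (gr : IsGrading E G r layer) : Function.Injective (gr.coord : G → E) :=
  Function.LeftInverse.injective gr.coordSymm_coord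

end Section

end Coordinates

end IsGrading

section LeftTranslate

variable {E : Type*} [NormedAddCommGroup E] [NormedSpace ℝ E]
  {G : Type*} [TopologicalSpace G] [ChartedSpace E G] [Group G] [LieGroup 𝓘(ℝ, E) ∞ G]

theorem mem_leftTranslate_iff {𝔞 : Submodule ℝ E} {g : G} {w : E} :
    w ∈ (leftTranslate (I := 𝓘(ℝ, E)) (G := G) 𝔞 g : Submodule ℝ E) ↔
      (leftFrame E g).symm w ∈ 𝔞 := by
  refine ⟨?_, fun h ↦ ⟨_, h, (leftFrame E g).apply_symm_apply w⟩⟩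
  rintro ⟨v, hv, rfl⟩
  exact ((leftFrame E g).symm_apply_apply v).symm ▸ hv

theorem leftFrame_mem_leftTranslate_iff {𝔞 : Submodule ℝ E} {g : G} {X : E} :
    leftFrame E g X ∈ (leftTranslate (I := 𝓘(ℝ, E)) (G := G) 𝔞 g : Submodule ℝ E) ↔ X ∈ 𝔞 := by
  rw [mem_leftTranslate_iff, ContinuousLinearEquiv.symm_apply_apply]

theorem mfderiv_eq_leftDeriv {F : Type*} [NormedAddCommGroup F] [NormedSpace ℝ F] {f : G → F}
    {g : G} (hf : MDifferentiableAt 𝓘(ℝ, E) 𝓘(ℝ, F) f g) (v : E) :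
    (mfderiv 𝓘(ℝ, E) 𝓘(ℝ, F) f g : E →L[ℝ] F) v = leftDeriv f g ((leftFrame E g).symm v) :=
  (congrArg _ ((leftFrame E g).apply_symm_apply v).symm).trans (mfderiv_leftFrame hf _)

theorem leftDeriv_injective_of_leftInverse {f : G → E} {s : E → G} {g : G}
    (hf : MDifferentiableAt 𝓘(ℝ, E) 𝓘(ℝ, E) f g)
    (hs : MDifferentiableAt 𝓘(ℝ, E) 𝓘(ℝ, E) s (f g)) (hsf : Function.LeftInverse s f) :
    Function.Injective (leftDeriv (E := E) f g) := by
  have hchart : MDifferentiableAt 𝓘(ℝ, E) 𝓘(ℝ, E) (leftChart E g) (s (f g)) := by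
    rw [hsf g]
    exact (contMDiffAt_leftChart_self g).mdifferentiableAt (by simp)
  have hφ := (mdifferentiableAt_iff_differentiableAt.1 (hchart.comp (f g) hs)).hasFDerivAt
  have hid : ((leftChart E g) ∘ s) ∘ f = leftChart E g := by
    rw [Function.comp_assoc, hsf.comp_eq_id, Function.comp_id]
  have hcomp := leftDeriv_comp hφ hf
  rw [hid, leftDeriv_leftChart_self] at hcomp
  exact Function.LeftInverse.injective fun X ↦ congr($hcomp.symm X)

theorem leftDeriv_comp_eq {F' : Type*} [NormedAddCommGroup F'] [NormedSpace ℝ F'] {φ : G → F'}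
    {F : G → G} {p : G} (hφ : MDifferentiableAt 𝓘(ℝ, E) 𝓘(ℝ, F') φ (F p))
    (hF : MDifferentiableAt 𝓘(ℝ, E) 𝓘(ℝ, E) F p) (X : E) :
    leftDeriv (φ ∘ F) p X = leftDeriv φ (F p)
      ((leftFrame E (F p)).symm
        ((mfderiv 𝓘(ℝ, E) 𝓘(ℝ, E) F p : E →L[ℝ] E) (leftFrame E p X))) :=
  (mfderiv_leftFrame (hφ.comp p hF) X).symm.trans
    (Eq.trans congr($(mfderiv_comp p hφ hF) (leftFrame E p X)) (mfderiv_eq_leftDeriv hφ _))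

theorem mfderiv_leftFrame_eq_iff {F' : Type*} [NormedAddCommGroup F'] [NormedSpace ℝ F']
    {φ : G → F'} {F : G → G} {p : G} (hφ : MDifferentiableAt 𝓘(ℝ, E) 𝓘(ℝ, F') φ (F p))
    (hinj : Function.Injective (leftDeriv (E := E) φ (F p)))
    (hF : MDifferentiableAt 𝓘(ℝ, E) 𝓘(ℝ, E) F p) (X Z : E) :
    (mfderiv 𝓘(ℝ, E) 𝓘(ℝ, E) F p : E →L[ℝ] E) (leftFrame E p X) = leftFrame E (F p) Z ↔
      leftDeriv (φ ∘ F) p X = leftDeriv φ (F p) Z := by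
  rw [leftDeriv_comp_eq hφ hF, hinj.eq_iff]
  exact (leftFrame E (F p)).symm_apply_eq.symm

end LeftTranslate

section HighIdeal

variable {E : Type*} [NormedAddCommGroup E] [NormedSpace ℝ E] {r : ℕ} {layer : ℕ → Submodule ℝ E}

/-- The abelian ideal formed by the layers of index greater than `⌊r / 2⌋`. -/
abbrev highIdeal (r : ℕ) (layer : ℕ → Submodule ℝ E) : Submodule ℝ E :=
  IsGrading.filtration layer (r / 2 + 1)

/-- The subspace `𝔨`: the layers of even index greater than `⌊r / 2⌋`. -/
abbrev vertical (r : ℕ) (layer : ℕ → Submodule ℝ E) : Submodule ℝ E :=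
  layerSum layer {k | Even k ∧ r / 2 < k}

/-- The subspace `𝔭₁ ⊕ 𝔭₂`, made up of all the layers that do not contribute to `𝔨`. -/
abbrev horizontal (r : ℕ) (layer : ℕ → Submodule ℝ E) : Submodule ℝ E :=
  layerSum layer {k | Even k ∧ r / 2 < k}ᶜ

/-- The subspace `𝔭₁`: the layers of odd index. -/
abbrev oddHorizontal (layer : ℕ → Submodule ℝ E) : Submodule ℝ E := layerSum layer {k | Odd k}

/-- The subspace `𝔭₂`: the layers of even index at most `⌊r / 2⌋`. -/
abbrev evenHorizontal (r : ℕ) (layer : ℕ → Submodule ℝ E) : Submodule ℝ E :=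
  layerSum layer {k | Even k ∧ k ≤ r / 2}

theorem oddHorizontal_sup_evenHorizontal (r : ℕ) (layer : ℕ → Submodule ℝ E) :
    oddHorizontal layer ⊔ evenHorizontal r layer = horizontal r layer := by
  rw [oddHorizontal, evenHorizontal, layerSum_sup]
  congr 1
  ext k
  simp only [Set.mem_union, Set.mem_ofPred_eq, Set.mem_compl_iff, ← Nat.not_even_iff_odd, not_and,
    not_lt]
  tauto

theorem oddHorizontal_le_horizontal : oddHorizontal layer ≤ horizontal r layer :=
  le_sup_left.trans (oddHorizontal_sup_evenHorizontal r layer).le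

theorem evenHorizontal_le_horizontal : evenHorizontal r layer ≤ horizontal r layer :=
  le_sup_right.trans (oddHorizontal_sup_evenHorizontal r layer).le

namespace IsGrading

variable [FiniteDimensional ℝ E] {G : Type*} [TopologicalSpace G] [ChartedSpace E G] [Group G]
  [LieGroup 𝓘(ℝ, E) ∞ G]

theorem bracket_highIdeal_eq_zero (gr : IsGrading E G r layer) {Y Z : E}
    (hY : Y ∈ highIdeal r layer) (hZ : Z ∈ highIdeal r layer) : bracket E G Y Z = 0 :=
  gr.bracket_eq_zero_of_mem_layerSum (fun i hi j hj _ _ ↦ by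
    rw [Set.mem_ofPred_eq] at hi hj
    omega) hY hZ

theorem bracket_mem_highIdeal (gr : IsGrading E G r layer) {Y : E} (hY : Y ∈ highIdeal r layer)
    (X : E) : bracket E G Y X ∈ highIdeal r layer := by
  rw [bracket_swap]
  exact neg_mem (gr.filtration_antitone (Nat.le_succ _) (gr.bracket_mem_filtration X hY))

theorem Ad_integralCurve (gr : IsGrading E G r layer) {Y : E} (hY : Y ∈ highIdeal r layer)
    {γ : ℝ → G} (hγ_zero : γ 0 = 1) (hγ : IsMIntegralCurve γ (leftInvField G Y)) (w : E) (t : ℝ) :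
    Ad E (γ t) w = w + t • bracket E G Y w := by
  have hderiv (v : E) (s : ℝ) :
      HasDerivAt (fun t ↦ Ad E (γ t) v) (Ad E (γ s) (bracket E G Y v)) s := by
    have hcomp := hasDerivAt_comp_of_isMIntegralCurve hγ (f := fun x ↦ Ad E x v) (t := s)
      ((mdifferentiableAt_Ad _).clm_apply mdifferentiableAt_const)
    rwa [leftDeriv_clm_apply (mdifferentiableAt_Ad _), leftDeriv_Ad] at hcomp
  have hfixed (s : ℝ) : Ad E (γ s) (bracket E G Y w) = bracket E G Y w := by
    have hzero (t : ℝ) : HasDerivAt (fun t ↦ Ad E (γ t) (bracket E G Y w)) 0 t := by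
      simpa [gr.bracket_highIdeal_eq_zero hY (gr.bracket_mem_highIdeal hY w)] using
        hderiv (bracket E G Y w) t
    simpa [hγ_zero, Ad_one] using eq_add_smul_of_hasDerivAt hzero s
  simpa [hγ_zero, Ad_one] using
    eq_add_smul_of_hasDerivAt (fun s ↦ (hderiv w s).congr_deriv (hfixed s)) t

theorem vertical_le_highIdeal (gr : IsGrading E G r layer) :
    vertical r layer ≤ highIdeal r layer :=
  gr.layerSum_mono fun _ hk _ _ ↦ hk.2

theorem bracket_oddHorizontal_vertical_mem (gr : IsGrading E G r layer) {X Y : E}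
    (hX : X ∈ oddHorizontal layer) (hY : Y ∈ vertical r layer) :
    bracket E G X Y ∈ oddHorizontal layer :=
  gr.bracket_mem_layerSum (fun _ hi _ hj _ _ _ ↦ Odd.add_even hi hj.1) hX hY

theorem bracket_evenHorizontal_vertical_mem (gr : IsGrading E G r layer) {X Y : E}
    (hX : X ∈ evenHorizontal r layer) (hY : Y ∈ vertical r layer) :
    bracket E G X Y ∈ vertical r layer :=
  gr.bracket_mem_layerSum (U := {k | Even k ∧ r / 2 < k})
    (fun _ hi _ hj _ _ _ ↦ ⟨hi.1.add hj.1, Nat.lt_add_left _ hj.2⟩) hX hY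

theorem isCompl_horizontal_vertical (gr : IsGrading E G r layer) :
    IsCompl (horizontal r layer) (vertical r layer) :=
  (gr.isCompl_layerSum _).symm

/-- The projection onto the layers of index at most `⌊r / 2⌋`. -/
def lowProj (gr : IsGrading E G r layer) : E →L[ℝ] E := gr.proj {k | k ≤ r / 2}

theorem lowProj_eq_zero_iff (gr : IsGrading E G r layer) {x : E} :
    gr.lowProj x = 0 ↔ x ∈ highIdeal r layer :=
  gr.proj_eq_zero_iff_mem_filtration

theorem lowProj_lowProj (gr : IsGrading E G r layer) (x : E) :
    gr.lowProj (gr.lowProj x) = gr.lowProj x :=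
  gr.proj_of_mem (fun _ hk _ _ ↦ hk) (gr.proj_mem _ x)

theorem sub_lowProj_mem (gr : IsGrading E G r layer) (x : E) :
    x - gr.lowProj x ∈ highIdeal r layer := by
  rw [← gr.lowProj_eq_zero_iff, map_sub, lowProj_lowProj, sub_self]

end IsGrading

end HighIdeal

namespace IsGrading

variable {E : Type*} [NormedAddCommGroup E] [NormedSpace ℝ E] [FiniteDimensional ℝ E]
  {G : Type*} [TopologicalSpace G] [SimplyConnectedSpace G] [ChartedSpace E G]
  [Group G] [LieGroup 𝓘(ℝ, E) ∞ G] {r : ℕ} {layer : ℕ → Submodule ℝ E}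

/-- The inverse of the diffeomorphism `exp`. -/
def log (gr : IsGrading E G r layer) (g : G) : E := gr.weightInv (gr.coord g)

theorem contMDiff_log (gr : IsGrading E G r layer) :
    ContMDiff 𝓘(ℝ, E) 𝓘(ℝ, E) ∞ (gr.log : G → E) :=
  gr.weightInv.contDiff.contMDiff.comp gr.contMDiff_coord

variable [T2Space G]

section Exponential

/-- A diffeomorphism from the Lie algebra onto the group. It agrees with the exponential map on
the abelian ideal `highIdeal`, and is only used there. -/
def exp (gr : IsGrading E G r layer) (Y : E) : G := gr.coordSymm (gr.weight Y)

@[simp]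
theorem coord_exp (gr : IsGrading E G r layer) (Y : E) :
    gr.coord (gr.exp Y : G) = gr.weight Y :=
  gr.coord_coordSymm _

@[simp]
theorem log_exp (gr : IsGrading E G r layer) (Y : E) : gr.log (gr.exp Y : G) = Y := by
  rw [log, coord_exp, weightInv_weight]

@[simp]
theorem exp_log (gr : IsGrading E G r layer) (g : G) : gr.exp (gr.log g) = g := by
  rw [exp, log, weight_weightInv, coordSymm_coord]

@[simp]
theorem exp_zero (gr : IsGrading E G r layer) : gr.exp 0 = (1 : G) :=
  gr.coord_injective (by simp)

theorem contMDiff_exp (gr : IsGrading E G r layer) :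
    ContMDiff 𝓘(ℝ, E) 𝓘(ℝ, E) ∞ (gr.exp : E → G) :=
  gr.contMDiff_coordSymm.comp (gr.weight : E →L[ℝ] E).contDiff.contMDiff

theorem integralCurve_eq_exp (gr : IsGrading E G r layer) {Y : E} (hY : Y ∈ highIdeal r layer)
    {γ : ℝ → G} (hγ_zero : γ 0 = 1) (hγ : IsMIntegralCurve γ (leftInvField G Y)) (t : ℝ) :
    γ t = gr.exp (t • Y) := by
  have hderiv (s : ℝ) : HasDerivAt (gr.coord ∘ γ) (gr.weight Y) s := by
    simpa [gr.Ad_integralCurve hY hγ_zero hγ,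
      gr.bracket_highIdeal_eq_zero hY (gr.weight_mem_layerSum hY)] using
      gr.hasDerivAt_coord_comp hγ s
  refine gr.coord_injective ?_
  simpa [hγ_zero] using eq_add_smul_of_hasDerivAt hderiv t

theorem isMIntegralCurve_exp (gr : IsGrading E G r layer) {Y : E} (hY : Y ∈ highIdeal r layer) :
    IsMIntegralCurve (fun t : ℝ ↦ gr.exp (t • Y)) (leftInvField G Y) := by
  have := FiniteDimensional.complete ℝ E
  obtain ⟨γ, hγ_zero, hγ⟩ := exists_isMIntegralCurve_leftInvField Y (1 : G)
  rwa [← funext (gr.integralCurve_eq_exp hY hγ_zero hγ)]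

theorem Ad_exp (gr : IsGrading E G r layer) {Y : E} (hY : Y ∈ highIdeal r layer) (w : E) :
    Ad E (gr.exp Y : G) w = w + bracket E G Y w := by
  simpa using gr.Ad_integralCurve hY (by simp) (gr.isMIntegralCurve_exp hY) w 1

theorem exp_add (gr : IsGrading E G r layer) {Y Z : E} (hY : Y ∈ highIdeal r layer)
    (hZ : Z ∈ highIdeal r layer) : (gr.exp (Y + Z) : G) = gr.exp Y * gr.exp Z := by
  refine gr.coord_injective ?_
  rw [coord_mul, coord_exp, coord_exp, coord_exp, gr.Ad_exp hY,
    gr.bracket_highIdeal_eq_zero hY (gr.weight_mem_layerSum hZ), map_add, add_zero]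

/-- The restriction of `exp` to a subspace of the abelian ideal `highIdeal`. -/
def expHom (gr : IsGrading E G r layer) {𝔨 : Submodule ℝ E} (h𝔨 : 𝔨 ≤ highIdeal r layer) :
    Multiplicative 𝔨 →* G :=
  MonoidHom.mk' (fun Y ↦ gr.exp (Multiplicative.toAdd Y : 𝔨)) fun Y Z ↦
    gr.exp_add (h𝔨 (Multiplicative.toAdd Y).2) (h𝔨 (Multiplicative.toAdd Z).2)

theorem connectedSubgroup_eq_range_expHom (gr : IsGrading E G r layer) {𝔨 : Submodule ℝ E}
    (h𝔨 : 𝔨 ≤ highIdeal r layer) :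
    connectedSubgroup (I := 𝓘(ℝ, E)) (G := G) 𝔨 = (gr.expHom h𝔨).range := by
  refine (congrArg Subgroup.closure (Set.ext fun x ↦ ⟨?_, ?_⟩)).trans
    (Subgroup.closure_eq (gr.expHom h𝔨).range)
  · rintro ⟨Y, hY, γ, hγ_zero, hγ, rfl⟩
    refine ⟨Multiplicative.ofAdd ⟨Y, hY⟩, ?_⟩
    exact (congrArg gr.exp (one_smul ℝ Y).symm).trans
      (gr.integralCurve_eq_exp (h𝔨 hY) hγ_zero hγ 1).symm
  · rintro ⟨Y, rfl⟩
    exact ⟨_, (Multiplicative.toAdd Y).2, _, by simp,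
      gr.isMIntegralCurve_exp (h𝔨 (Multiplicative.toAdd Y).2), by simp [expHom]⟩

theorem mem_connectedSubgroup_iff (gr : IsGrading E G r layer) {𝔨 : Submodule ℝ E}
    (h𝔨 : 𝔨 ≤ highIdeal r layer) {x : G} :
    x ∈ connectedSubgroup (I := 𝓘(ℝ, E)) (G := G) 𝔨 ↔ ∃ Y ∈ 𝔨, gr.exp Y = x := by
  rw [gr.connectedSubgroup_eq_range_expHom h𝔨]
  exact ⟨fun ⟨Y, hY⟩ ↦ ⟨_, (Multiplicative.toAdd Y).2, hY⟩,
    fun ⟨Y, hY, h⟩ ↦ ⟨Multiplicative.ofAdd ⟨Y, hY⟩, h⟩⟩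

end Exponential

section AdaptedCoordinates

/-- A representative of the class of `g` modulo the exponentials of `highIdeal`, which depends
only on that class. -/
def lowPart (gr : IsGrading E G r layer) (g : G) : G := gr.coordSymm (gr.lowProj (gr.coord g))

theorem log_lowPart_inv_mul_mem (gr : IsGrading E G r layer) (g : G) :
    gr.log ((gr.lowPart g)⁻¹ * g) ∈ highIdeal r layer := by
  have hcoord : gr.coord ((gr.lowPart g)⁻¹ * g) =
      Ad E (gr.lowPart g)⁻¹ (gr.coord g - gr.lowProj (gr.coord g)) := by
    have hmul := gr.coord_mul (gr.lowPart g) ((gr.lowPart g)⁻¹ * g)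
    rw [mul_inv_cancel_left, ← sub_eq_iff_eq_add'] at hmul
    rw [← Ad_inv_Ad (gr.lowPart g) (gr.coord ((gr.lowPart g)⁻¹ * g)), ← hmul, lowPart,
      coord_coordSymm]
  rw [log, hcoord]
  exact gr.weightInv_mem_layerSum (gr.Ad_mem_filtration _ (gr.sub_lowProj_mem _))

theorem lowProj_coord_mul_exp (gr : IsGrading E G r layer) (g : G) {Y : E}
    (hY : Y ∈ highIdeal r layer) :
    gr.lowProj (gr.coord (g * gr.exp Y)) = gr.lowProj (gr.coord g) := by
  rw [coord_mul, map_add, coord_exp,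
    gr.lowProj_eq_zero_iff.2 (gr.Ad_mem_filtration g (gr.weight_mem_layerSum hY)), add_zero]

theorem lowPart_mul_exp (gr : IsGrading E G r layer) (g : G) {Y : E}
    (hY : Y ∈ highIdeal r layer) : gr.lowPart (g * gr.exp Y) = gr.lowPart g :=
  congrArg gr.coordSymm (gr.lowProj_coord_mul_exp g hY)

/-- Coordinates on `G` in which right multiplication by the exponential of an element of the
abelian ideal `highIdeal` is a translation. -/
def adaptedCoord (gr : IsGrading E G r layer) (g : G) : E :=
  gr.lowProj (gr.coord g) + gr.log ((gr.lowPart g)⁻¹ * g)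

/-- The inverse of the diffeomorphism `adaptedCoord`. -/
def adaptedCoordSymm (gr : IsGrading E G r layer) (u : E) : G :=
  gr.coordSymm (gr.lowProj u) * gr.exp (u - gr.lowProj u)

theorem contMDiff_adaptedCoord (gr : IsGrading E G r layer) :
    ContMDiff 𝓘(ℝ, E) 𝓘(ℝ, E) ∞ (gr.adaptedCoord : G → E) := by
  have hlow : ContMDiff 𝓘(ℝ, E) 𝓘(ℝ, E) ∞ fun g : G ↦ gr.lowProj (gr.coord g) :=
    gr.lowProj.contDiff.contMDiff.comp gr.contMDiff_coord
  exact hlow.add (gr.contMDiff_log.comp ((gr.contMDiff_coordSymm.comp hlow).inv.mul contMDiff_id))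

theorem contMDiff_adaptedCoordSymm (gr : IsGrading E G r layer) :
    ContMDiff 𝓘(ℝ, E) 𝓘(ℝ, E) ∞ (gr.adaptedCoordSymm : E → G) :=
  (gr.contMDiff_coordSymm.comp gr.lowProj.contDiff.contMDiff).mul
    (gr.contMDiff_exp.comp (contDiff_id.sub gr.lowProj.contDiff).contMDiff)

theorem adaptedCoord_mul_exp (gr : IsGrading E G r layer) (g : G) {Y : E}
    (hY : Y ∈ highIdeal r layer) :
    gr.adaptedCoord (g * gr.exp Y) = gr.adaptedCoord g + Y := by
  have hlog : gr.log ((gr.lowPart g)⁻¹ * g * gr.exp Y) =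
      gr.log ((gr.lowPart g)⁻¹ * g) + Y := by
    nth_rewrite 1 [← gr.exp_log ((gr.lowPart g)⁻¹ * g)]
    rw [← gr.exp_add (gr.log_lowPart_inv_mul_mem g) hY, log_exp]
  rw [adaptedCoord, gr.lowProj_coord_mul_exp g hY, gr.lowPart_mul_exp g hY, ← mul_assoc, hlog,
    ← add_assoc, adaptedCoord]

@[simp]
theorem adaptedCoord_adaptedCoordSymm (gr : IsGrading E G r layer) (u : E) :
    gr.adaptedCoord (gr.adaptedCoordSymm u : G) = u := by
  rw [adaptedCoordSymm, gr.adaptedCoord_mul_exp _ (gr.sub_lowProj_mem u), adaptedCoord, lowPart,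
    coord_coordSymm, lowProj_lowProj, inv_mul_cancel, ← gr.exp_zero, log_exp, add_zero,
    add_sub_cancel]

@[simp]
theorem adaptedCoordSymm_adaptedCoord (gr : IsGrading E G r layer) (g : G) :
    gr.adaptedCoordSymm (gr.adaptedCoord g) = g := by
  have hlow : gr.lowProj (gr.adaptedCoord g) = gr.lowProj (gr.coord g) := by
    rw [adaptedCoord, map_add, lowProj_lowProj,
      gr.lowProj_eq_zero_iff.2 (gr.log_lowPart_inv_mul_mem g), add_zero]
  rw [adaptedCoordSymm, hlow, adaptedCoord, add_sub_cancel_left, exp_log, lowPart,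
    mul_inv_cancel_left]

theorem adaptedCoord_injective (gr : IsGrading E G r layer) :
    Function.Injective (gr.adaptedCoord : G → E) :=
  Function.LeftInverse.injective gr.adaptedCoordSymm_adaptedCoord

theorem mdifferentiableAt_adaptedCoord (gr : IsGrading E G r layer) (g : G) :
    MDifferentiableAt 𝓘(ℝ, E) 𝓘(ℝ, E) (gr.adaptedCoord : G → E) g :=
  gr.contMDiff_adaptedCoord.mdifferentiable (by simp) g

theorem leftDeriv_adaptedCoord_injective (gr : IsGrading E G r layer) (g : G) :
    Function.Injective (leftDeriv (E := E) gr.adaptedCoord g) :=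
  leftDeriv_injective_of_leftInverse (gr.mdifferentiableAt_adaptedCoord g)
    (gr.contMDiff_adaptedCoordSymm.mdifferentiable (by simp) _) gr.adaptedCoordSymm_adaptedCoord

theorem leftDeriv_adaptedCoord_of_mem (gr : IsGrading E G r layer) (g : G) {Y : E}
    (hY : Y ∈ highIdeal r layer) : leftDeriv gr.adaptedCoord g Y = Y := by
  have hcurve : IsMIntegralCurve (fun t : ℝ ↦ g * gr.exp (t • Y)) (leftInvField G Y) := by
    rw [isMIntegralCurve_iff_isMIntegralCurveOn]
    exact isMIntegralCurveOn_mul_left g ((gr.isMIntegralCurve_exp hY).isMIntegralCurveOn _)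
  have hline : gr.adaptedCoord ∘ (fun t : ℝ ↦ g * gr.exp (t • Y)) =
      fun t ↦ gr.adaptedCoord g + t • Y :=
    funext fun t ↦ gr.adaptedCoord_mul_exp g (Submodule.smul_mem _ t hY)
  have hderiv :=
    hasDerivAt_comp_of_isMIntegralCurve hcurve (t := 0) (gr.mdifferentiableAt_adaptedCoord _)
  rw [hline, zero_smul, exp_zero, mul_one] at hderiv
  have hslope : HasDerivAt (fun t : ℝ ↦ gr.adaptedCoord g + t • Y) Y 0 := by
    simpa using ((hasDerivAt_id (0 : ℝ)).smul_const Y).const_add (gr.adaptedCoord g)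
  exact hderiv.unique hslope

theorem leftDeriv_adaptedCoord_mul_exp (gr : IsGrading E G r layer) (p : G) {Y : E}
    (hY : Y ∈ highIdeal r layer) (W : E) :
    leftDeriv gr.adaptedCoord (p * gr.exp Y) W =
      leftDeriv gr.adaptedCoord p (W + bracket E G Y W) := by
  have hright := leftDeriv_mul_right (f := gr.adaptedCoord) (g := p) (h := gr.exp Y)
    (gr.mdifferentiableAt_adaptedCoord _)
  simp only [gr.adaptedCoord_mul_exp _ hY] at hright
  rw [leftDeriv_add_const (gr.mdifferentiableAt_adaptedCoord p)] at hright
  rw [hright, ContinuousLinearMap.comp_apply, ← gr.Ad_exp hY, Ad_inv_Ad]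

theorem inv_mul_mem_connectedSubgroup_iff (gr : IsGrading E G r layer) {𝔨 : Submodule ℝ E}
    (h𝔨 : 𝔨 ≤ highIdeal r layer) {g g' : G} :
    g⁻¹ * g' ∈ connectedSubgroup (I := 𝓘(ℝ, E)) (G := G) 𝔨 ↔
      gr.adaptedCoord g' - gr.adaptedCoord g ∈ 𝔨 := by
  simp only [gr.mem_connectedSubgroup_iff h𝔨, eq_inv_mul_iff_mul_eq]
  refine ⟨?_, fun h ↦ ⟨_, h, gr.adaptedCoord_injective ?_⟩⟩
  · rintro ⟨Y, hY, rfl⟩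
    rwa [gr.adaptedCoord_mul_exp g (h𝔨 hY), add_sub_cancel_left]
  · rw [gr.adaptedCoord_mul_exp g (h𝔨 h), add_sub_cancel]

end AdaptedCoordinates

end IsGrading

section GlobalChart

variable {V : Type*} [NormedAddCommGroup V] [NormedSpace ℝ V] {B : Type*} [TopologicalSpace B]

theorem exists_chartedSpace_of_homeomorph (Φ : B ≃ₜ V) :
    ∃ _ : ChartedSpace V B, IsManifold 𝓘(ℝ, V) ∞ B ∧
      ∃ Ψ : B ≃ₘ⟮𝓘(ℝ, V), 𝓘(ℝ, V)⟯ V, Ψ.toEquiv = Φ.toEquiv := by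
  let _ : ChartedSpace V B := Φ.toOpenPartialHomeomorph.singletonChartedSpace rfl
  have hB : IsManifold 𝓘(ℝ, V) ∞ B :=
    { __ := Φ.toOpenPartialHomeomorph.singleton_hasGroupoid rfl (contDiffGroupoid ∞ 𝓘(ℝ, V)) }
  refine ⟨inferInstance, hB, ⟨Φ.toEquiv, fun b ↦ ?_, fun v ↦ ?_⟩, rfl⟩
  · exact contMDiffAt_of_mem_maximalAtlas (n := ∞)
      (IsManifold.chart_mem_maximalAtlas (I := 𝓘(ℝ, V)) b) (mem_chart_source V b)
  · exact (contMDiffOn_chart_symm (x := Φ.symm v) v (by simp)).contMDiffAt (by simp)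

end GlobalChart

theorem exists_euclideanProd_of_isCompl {E : Type*} [NormedAddCommGroup E] [NormedSpace ℝ E]
    [FiniteDimensional ℝ E] {𝔭 𝔨 : Submodule ℝ E} (h : IsCompl 𝔭 𝔨) :
    ∃ (m d : ℕ) (e : E ≃L[ℝ] EuclideanSpace ℝ (Fin m) × EuclideanSpace ℝ (Fin d)),
      (∀ x, (e x).1 = 0 ↔ x ∈ 𝔨) ∧ ∀ x, (e x).2 = 0 ↔ x ∈ 𝔭 := by
  let split := Submodule.prodEquivOfIsCompl 𝔭 𝔨 h
  let coords (𝔞 : Submodule ℝ E) :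
      𝔞 ≃ₗ[ℝ] EuclideanSpace ℝ (Fin (Module.finrank ℝ 𝔞)) :=
    LinearEquiv.ofFinrankEq _ _ (by simp)
  refine ⟨_, _, (split.symm.trans ((coords 𝔭).prodCongr (coords 𝔨))).toContinuousLinearEquiv,
    fun x ↦ ?_, fun x ↦ ?_⟩
  · have hfst : coords 𝔭 (split.symm x).1 = 0 ↔ (split.symm x).1 = 0 :=
      (coords 𝔭).map_eq_zero_iff
    exact hfst.trans (Submodule.prodEquivOfIsCompl_symm_apply_fst_eq_zero _ _ h)
  · have hsnd : coords 𝔨 (split.symm x).2 = 0 ↔ (split.symm x).2 = 0 :=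
      (coords 𝔨).map_eq_zero_iff
    exact hsnd.trans (Submodule.prodEquivOfIsCompl_symm_apply_snd_eq_zero _ _ h)

section TrivialBundle

variable {E : Type*} [NormedAddCommGroup E] [NormedSpace ℝ E]
  {H : Type*} [TopologicalSpace H] {I : ModelWithCorners ℝ E H}
  {P : Type*} [TopologicalSpace P] [ChartedSpace H P]
  {E' : Type*} [NormedAddCommGroup E'] [NormedSpace ℝ E']
  {H' : Type*} [TopologicalSpace H'] {J : ModelWithCorners ℝ E' H'}
  {B : Type*} [TopologicalSpace B] [ChartedSpace H' B]
  {E'' : Type*} [NormedAddCommGroup E''] [NormedSpace ℝ E'']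
  {H'' : Type*} [TopologicalSpace H''] {IL : ModelWithCorners ℝ E'' H''}
  {L : Type*} [TopologicalSpace L] [ChartedSpace H'' L] [Group L]

theorem isPrincipalBundle_of_diffeomorph [ContMDiffMul IL ∞ L] (T : P ≃ₘ⟮I, J.prod IL⟯ B × L)
    {act : P → L → P} (hact : ∀ p a, T (act p a) = ((T p).1, (T p).2 * a)) :
    IsPrincipalBundle I J IL (fun p ↦ (T p).1) act where
  act_one p := T.injective (by simp [hact])
  act_mul p a b := T.injective (by simp [hact, mul_assoc])
  contMDiff_act := by
    have hsymm (q : P × L) : act q.1 q.2 = T.symm ((T q.1).1, (T q.1).2 * q.2) := by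
      rw [← hact, T.symm_apply_apply]
    have hT : ContMDiff (I.prod IL) (J.prod IL) ∞ fun q : P × L ↦ T q.1 :=
      T.contMDiff.comp contMDiff_fst
    exact (T.symm.contMDiff.comp (hT.fst.prodMk (hT.snd.mul contMDiff_snd))).congr hsymm
  proj_act p a := by rw [hact]
  free p a h := by
    have hsnd := hact p a
    rw [h] at hsnd
    exact left_eq_mul.1 congr($hsnd.2)
  transitive p q h := ⟨(T p).2⁻¹ * (T q).2,
    T.injective ((hact _ _).trans (Prod.ext h (mul_inv_cancel_left _ _)))⟩
  locally_trivial b :=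
    ⟨{ toOpenPartialHomeomorph := T.toHomeomorph.toOpenPartialHomeomorph
       baseSet := Set.univ
       open_baseSet := isOpen_univ
       source_eq := rfl
       target_eq := Set.univ_prod_univ.symm
       proj_toFun := fun _ _ ↦ rfl },
      Set.mem_univ b, T.contMDiff.contMDiffOn, T.symm.contMDiff.contMDiffOn,
      fun p _ a ↦ congr($(hact p a).2)⟩

end TrivialBundle

/-- The additive group of a vector space, written multiplicatively. A type synonym such as
`Multiplicative V` would lose the manifold structure of `V`. -/
abbrev multiplicativeGroup (V : Type*) [AddGroup V] : Group V :=
  inferInstanceAs (Group (Multiplicative V))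

theorem lieGroup_multiplicativeGroup (V : Type*) [NormedAddCommGroup V] [NormedSpace ℝ V] :
    @LieGroup ℝ _ V _ V _ _ 𝓘(ℝ, V) ∞ V (multiplicativeGroup V) _ _ :=
  let _ := multiplicativeGroup V
  { contMDiff_mul := contMDiff_add 𝓘(ℝ, V) ∞
    contMDiff_inv := contMDiff_neg 𝓘(ℝ, V) ∞ }

section LeftTranslate

variable {E : Type*} [NormedAddCommGroup E] [NormedSpace ℝ E]
  {G : Type*} [TopologicalSpace G] [ChartedSpace E G] [Group G] [LieGroup 𝓘(ℝ, E) ∞ G]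

theorem isCompl_leftTranslate {𝔞 𝔟 : Submodule ℝ E} (h : IsCompl 𝔞 𝔟) (g : G) :
    IsCompl (leftTranslate (I := 𝓘(ℝ, E)) (G := G) 𝔞 g : Submodule ℝ E)
      (leftTranslate (I := 𝓘(ℝ, E)) (G := G) 𝔟 g) :=
  (Submodule.orderIsoMapComap (leftFrame E g).toLinearEquiv).isCompl h

theorem mfderiv_mul_right_leftFrame (p h : G) (X : E) :
    (mfderiv 𝓘(ℝ, E) 𝓘(ℝ, E) (fun x : G ↦ x * h) p : E →L[ℝ] E) (leftFrame E p X) =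
      leftFrame E (p * h) (Ad E h⁻¹ X) := by
  have hchart : MDifferentiableAt 𝓘(ℝ, E) 𝓘(ℝ, E) (leftChart E (p * h)) (p * h) :=
    (contMDiffAt_leftChart_self (p * h)).mdifferentiableAt (by simp)
  have hinj : Function.Injective (leftDeriv (E := E) (leftChart E (p * h)) (p * h)) := by
    rw [leftDeriv_leftChart_self]
    exact Function.injective_id
  have hmul : MDifferentiableAt 𝓘(ℝ, E) 𝓘(ℝ, E) (fun x : G ↦ x * h) p :=
    contMDiff_mul_right.mdifferentiable (n := ∞) (by simp) p
  refine (mfderiv_leftFrame_eq_iff (F := fun x ↦ x * h) hchart hinj hmul X _).2 ?_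
  exact congr($(leftDeriv_mul_right hchart) X)

theorem map_mfderiv_mul_right_leftTranslate {𝔞 𝔟 : Submodule ℝ E} (p : G) {h : G}
    (h𝔟 : 𝔞.map (Ad E h⁻¹).toLinearMap = 𝔟) :
    (leftTranslate (I := 𝓘(ℝ, E)) (G := G) 𝔞 p).map
        (mfderiv 𝓘(ℝ, E) 𝓘(ℝ, E) (fun x : G ↦ x * h) p).toLinearMap =
      leftTranslate (I := 𝓘(ℝ, E)) (G := G) 𝔟 (p * h) := by
  subst h𝔟
  ext w
  constructor
  · rintro ⟨_, ⟨X, hX, rfl⟩, rfl⟩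
    exact ⟨Ad E h⁻¹ X, ⟨X, hX, rfl⟩, (mfderiv_mul_right_leftFrame (E := E) p h X).symm⟩
  · rintro ⟨_, ⟨X, hX, rfl⟩, rfl⟩
    exact ⟨_, ⟨X, hX, rfl⟩, mfderiv_mul_right_leftFrame (E := E) p h X⟩

variable {F : Type*} [NormedAddCommGroup F] [NormedSpace ℝ F]

theorem leftDeriv_mem_of_forall_mem [FiniteDimensional ℝ F] {S : Submodule ℝ F} {f : G → F} {g : G}
    (hf : MDifferentiableAt 𝓘(ℝ, E) 𝓘(ℝ, F) f g) (h : ∀ x, f x ∈ S) (X : E) :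
    leftDeriv f g X ∈ S := by
  have hclosed : IsClosed (S : Set F) := S.closed_of_finiteDimensional
  have hzero : S.mkQL ∘ f = fun _ ↦ 0 :=
    funext fun x ↦ (Submodule.Quotient.mk_eq_zero S).2 (h x)
  have hcomp := leftDeriv_comp S.mkQL.hasFDerivAt hf
  rw [hzero, leftDeriv_const] at hcomp
  exact (Submodule.Quotient.mk_eq_zero S).1 congr($hcomp.symm X)

variable {V : Type*} [NormedAddCommGroup V] [NormedSpace ℝ V] {B : Type*} [TopologicalSpace B]
  [ChartedSpace V B]

theorem leftDeriv_diffeomorph_comp (Φ : B ≃ₘ⟮𝓘(ℝ, V), 𝓘(ℝ, V)⟯ V) {π : G → B} {g : G}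
    (hπ : MDifferentiableAt 𝓘(ℝ, E) 𝓘(ℝ, V) π g) (X : E) :
    (Φ.mfderivToContinuousLinearEquiv (by simp) (π g) : V ≃L[ℝ] V)
        ((mfderiv 𝓘(ℝ, E) 𝓘(ℝ, V) π g : E →L[ℝ] V) (leftFrame E g X)) =
      leftDeriv (Φ ∘ π) g X :=
  have hΦ := Φ.mdifferentiable (by simp) (π g)
  (congr($(mfderiv_comp g hΦ hπ) (leftFrame E g X)).symm : _ = _).trans
    (mfderiv_leftFrame (hΦ.comp g hπ) X)

theorem ker_mfderiv_eq_leftTranslate (Φ : B ≃ₘ⟮𝓘(ℝ, V), 𝓘(ℝ, V)⟯ V) {π : G → B} {g : G}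
    (hπ : MDifferentiableAt 𝓘(ℝ, E) 𝓘(ℝ, V) π g) :
    LinearMap.ker (mfderiv 𝓘(ℝ, E) 𝓘(ℝ, V) π g).toLinearMap =
      leftTranslate (I := 𝓘(ℝ, E)) (G := G)
        (LinearMap.ker (leftDeriv (E := E) (Φ ∘ π) g : E →ₗ[ℝ] V) : Submodule ℝ E) g := by
  have hmem (X : E) : (mfderiv 𝓘(ℝ, E) 𝓘(ℝ, V) π g : E →L[ℝ] V) (leftFrame E g X) = 0 ↔
      leftDeriv (Φ ∘ π) g X = 0 := by
    rw [← leftDeriv_diffeomorph_comp Φ hπ]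
    exact (Φ.mfderivToContinuousLinearEquiv (by simp) (π g) : V ≃L[ℝ] V).map_eq_zero_iff.symm
  ext w
  obtain ⟨X, rfl⟩ := (leftFrame E g).surjective w
  exact (hmem X).trans (leftFrame_mem_leftTranslate_iff
    (𝔞 := LinearMap.ker (leftDeriv (E := E) (Φ ∘ π) g : E →ₗ[ℝ] V))).symm

theorem mfderiv_surjective_of_leftDeriv (Φ : B ≃ₘ⟮𝓘(ℝ, V), 𝓘(ℝ, V)⟯ V) {π : G → B} {g : G}
    (hπ : MDifferentiableAt 𝓘(ℝ, E) 𝓘(ℝ, V) π g)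
    (h : Function.Surjective (leftDeriv (E := E) (Φ ∘ π) g)) :
    Function.Surjective (mfderiv 𝓘(ℝ, E) 𝓘(ℝ, V) π g) := by
  intro w
  obtain ⟨X, hX⟩ := h (Φ.mfderivToContinuousLinearEquiv (by simp) (π g) w)
  exact ⟨leftFrame E g X, (Φ.mfderivToContinuousLinearEquiv (by simp) (π g)).injective
    ((leftDeriv_diffeomorph_comp Φ hπ X).trans hX)⟩

end LeftTranslate

namespace IsGrading

variable {E : Type*} [NormedAddCommGroup E] [NormedSpace ℝ E] [FiniteDimensional ℝ E]
  {G : Type*} [TopologicalSpace G] [ChartedSpace E G] [Group G] [LieGroup 𝓘(ℝ, E) ∞ G]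
  {r : ℕ} {layer : ℕ → Submodule ℝ E}

theorem disjoint_oddHorizontal_evenHorizontal (gr : IsGrading E G r layer) :
    Disjoint (oddHorizontal layer) (evenHorizontal r layer) :=
  Submodule.disjoint_def.2 fun _ hodd heven ↦
    (gr.proj_of_mem (T := {k | Odd k}) (fun _ hk _ _ ↦ hk) hodd).symm.trans
      (gr.proj_eq_zero (fun _ hk _ _ ↦ Nat.not_odd_iff_even.2 hk.1) heven)

theorem eq_bracket_of_add_eq_add_bracket (gr : IsGrading E G r layer) {X₁ X₂ Y η Z : E}
    (hX₁ : X₁ ∈ oddHorizontal layer) (hX₂ : X₂ ∈ evenHorizontal r layer)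
    (hY : Y ∈ vertical r layer) (hη : η ∈ vertical r layer) (hZ : Z ∈ horizontal r layer)
    (h : X₁ + X₂ + η = Z + bracket E G Y Z) : η = bracket E G Y X₂ := by
  rw [← oddHorizontal_sup_evenHorizontal, Submodule.mem_sup] at hZ
  obtain ⟨Z₁, hZ₁, Z₂, hZ₂, rfl⟩ := hZ
  have hodd : bracket E G Y Z₁ ∈ oddHorizontal layer := by
    rw [bracket_swap]
    exact neg_mem (gr.bracket_oddHorizontal_vertical_mem hZ₁ hY)
  have hvert : bracket E G Y Z₂ ∈ vertical r layer := by
    rw [bracket_swap]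
    exact neg_mem (gr.bracket_evenHorizontal_vertical_mem hZ₂ hY)
  rw [map_add] at h
  have hvert_eq : η - bracket E G Y Z₂ = (Z₁ + bracket E G Y Z₁ - X₁) + (Z₂ - X₂) := by
    linear_combination (norm := module) h
  have hodd_mem : Z₁ + bracket E G Y Z₁ - X₁ ∈ oddHorizontal layer :=
    sub_mem (add_mem hZ₁ hodd) hX₁
  have heven_mem : Z₂ - X₂ ∈ evenHorizontal r layer := sub_mem hZ₂ hX₂
  have hη_eq : η - bracket E G Y Z₂ = 0 :=
    Submodule.disjoint_def.1 gr.isCompl_horizontal_vertical.disjoint _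
      (hvert_eq ▸ add_mem (oddHorizontal_le_horizontal hodd_mem)
        (evenHorizontal_le_horizontal heven_mem)) (sub_mem hη hvert)
  have heven_eq : Z₂ - X₂ = 0 := by
    refine Submodule.disjoint_def.1 gr.disjoint_oddHorizontal_evenHorizontal _ ?_ heven_mem
    rw [hη_eq, eq_comm, add_eq_zero_iff_neg_eq] at hvert_eq
    exact hvert_eq ▸ neg_mem hodd_mem
  rw [sub_eq_zero.1 hη_eq, sub_eq_zero.1 heven_eq]

variable [SimplyConnectedSpace G] [T2Space G]

section Displacement

/-- The displacement of a self-map of `G` in adapted coordinates. For `F p = p * exp Y` with `Y`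
in the ideal `highIdeal` it is the constant `Y`. -/
def displacement (gr : IsGrading E G r layer) (F : G → G) (p : G) : E :=
  gr.adaptedCoord (F p) - gr.adaptedCoord p

variable {F : G → G} {p : G}

theorem contMDiff_displacement (gr : IsGrading E G r layer) (hF : ContMDiff 𝓘(ℝ, E) 𝓘(ℝ, E) ∞ F) :
    ContMDiff 𝓘(ℝ, E) 𝓘(ℝ, E) ∞ (gr.displacement F) :=
  (gr.contMDiff_adaptedCoord.comp hF).sub gr.contMDiff_adaptedCoord

theorem leftDeriv_displacement_mem (gr : IsGrading E G r layer) {𝔨 : Submodule ℝ E}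
    (hF : ContMDiff 𝓘(ℝ, E) 𝓘(ℝ, E) ∞ F) (h𝔨 : ∀ p, gr.displacement F p ∈ 𝔨) (X : E) :
    leftDeriv (gr.displacement F) p X ∈ 𝔨 :=
  leftDeriv_mem_of_forall_mem ((gr.contMDiff_displacement hF).mdifferentiable (by simp) p) h𝔨 X

theorem add_leftDeriv_displacement (gr : IsGrading E G r layer)
    (hF : ContMDiff 𝓘(ℝ, E) 𝓘(ℝ, E) ∞ F) (hhigh : ∀ p, gr.displacement F p ∈ highIdeal r layer)
    {X Z : E} (hXZ : (mfderiv 𝓘(ℝ, E) 𝓘(ℝ, E) F p : E →L[ℝ] E) (leftFrame E p X) =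
      leftFrame E (F p) Z) :
    X + leftDeriv (gr.displacement F) p X = Z + bracket E G (gr.displacement F p) Z := by
  have hFp : F p = p * gr.exp (gr.displacement F p) := gr.adaptedCoord_injective (by
    rw [gr.adaptedCoord_mul_exp p (hhigh p), displacement, add_sub_cancel])
  have hθF := (gr.contMDiff_adaptedCoord.comp hF).mdifferentiable (by simp) p
  have hdisp : leftDeriv (gr.displacement F) p X =
      leftDeriv (gr.adaptedCoord ∘ F) p X - leftDeriv gr.adaptedCoord p X :=
    congr($(leftDeriv_sub hθF (gr.mdifferentiableAt_adaptedCoord p)) X)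
  refine gr.leftDeriv_adaptedCoord_injective p ?_
  rw [← gr.leftDeriv_adaptedCoord_mul_exp p (hhigh p), ← hFp, map_add,
    gr.leftDeriv_adaptedCoord_of_mem p (gr.leftDeriv_displacement_mem hF hhigh X), hdisp,
    add_sub_cancel]
  exact (mfderiv_leftFrame_eq_iff (gr.mdifferentiableAt_adaptedCoord _)
    (gr.leftDeriv_adaptedCoord_injective _) (hF.mdifferentiable (by simp) p) X Z).1 hXZ

theorem leftDeriv_displacement_add (gr : IsGrading E G r layer)
    (hF : ContMDiff 𝓘(ℝ, E) 𝓘(ℝ, E) ∞ F) (hvert : ∀ p, gr.displacement F p ∈ vertical r layer)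
    (hinv : (leftTranslate (I := 𝓘(ℝ, E)) (G := G) (horizontal r layer : Submodule ℝ E) p).map
      (mfderiv 𝓘(ℝ, E) 𝓘(ℝ, E) F p).toLinearMap =
        leftTranslate (I := 𝓘(ℝ, E)) (G := G) (horizontal r layer : Submodule ℝ E) (F p))
    {X₁ X₂ : E} (hX₁ : X₁ ∈ oddHorizontal layer) (hX₂ : X₂ ∈ evenHorizontal r layer) :
    leftDeriv (gr.displacement F) p (X₁ + X₂) = bracket E G (gr.displacement F p) X₂ := by
  have hX : X₁ + X₂ ∈ horizontal r layer :=
    add_mem (oddHorizontal_le_horizontal hX₁) (evenHorizontal_le_horizontal hX₂)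
  obtain ⟨Z, hZ, hXZ⟩ := hinv.le ⟨_, ⟨X₁ + X₂, hX, rfl⟩, rfl⟩
  exact gr.eq_bracket_of_add_eq_add_bracket hX₁ hX₂ (hvert p)
    (gr.leftDeriv_displacement_mem hF hvert _) hZ
    (gr.add_leftDeriv_displacement hF (fun p ↦ gr.vertical_le_highIdeal (hvert p)) hXZ.symm)

/-- The displacement is constant, since its derivative vanishes along the generating layer. -/
theorem bracket_displacement_eq_zero (gr : IsGrading E G r layer)
    (hF : ContMDiff 𝓘(ℝ, E) 𝓘(ℝ, E) ∞ F) (hvert : ∀ p, gr.displacement F p ∈ vertical r layer)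
    (hinv : ∀ p, (leftTranslate (I := 𝓘(ℝ, E)) (G := G) (horizontal r layer : Submodule ℝ E) p).map
      (mfderiv 𝓘(ℝ, E) 𝓘(ℝ, E) F p).toLinearMap =
        leftTranslate (I := 𝓘(ℝ, E)) (G := G) (horizontal r layer : Submodule ℝ E) (F p))
    {X : E} (hX : X ∈ evenHorizontal r layer) (p : G) :
    bracket E G (gr.displacement F p) X = 0 := by
  have hone : ∀ g, ∀ W ∈ layer 1, leftDeriv (gr.displacement F) g W = 0 := fun g W hW ↦ by
    have hodd : W ∈ oddHorizontal layer := layer_le_layerSum layer (S := {k | Odd k}) odd_one hW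
    simpa using gr.leftDeriv_displacement_add hF hvert (hinv g) hodd (zero_mem _)
  have hzero := gr.leftDeriv_eq_zero_of_layer_one (gr.contMDiff_displacement hF) hone p
  rw [← gr.leftDeriv_displacement_add hF hvert (hinv p) (zero_mem _) hX, hzero, zero_apply]

theorem bracket_eq_zero_of_canBeMadePrincipal (gr : IsGrading E G r layer) {m : ℕ} {B : Type*}
    [TopologicalSpace B] [ChartedSpace (EuclideanSpace ℝ (Fin m)) B] {π : G → B}
    (hπ : ∀ g g', π g = π g' ↔ gr.adaptedCoord g' - gr.adaptedCoord g ∈ vertical r layer)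
    (h : CanBeMadePrincipal 𝓘(ℝ, E) 𝓘(ℝ, EuclideanSpace ℝ (Fin m)) π
      (leftTranslate (I := 𝓘(ℝ, E)) (G := G) (horizontal r layer : Submodule ℝ E)))
    {X Y : E} (hX : X ∈ evenHorizontal r layer) (hY : Y ∈ vertical r layer) :
    bracket E G X Y = 0 := by
  obtain ⟨d, L, _, _, _, _, _, act, hact, hinv⟩ := h
  have htranslate : gr.adaptedCoord (1 * gr.exp Y : G) - gr.adaptedCoord (1 : G) = Y := by
    rw [gr.adaptedCoord_mul_exp 1 (gr.vertical_le_highIdeal hY), add_sub_cancel_left]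
  obtain ⟨a, ha⟩ := hact.transitive 1 (1 * gr.exp Y) ((hπ _ _).2 (by rwa [htranslate]))
  have hdisp : gr.displacement (act · a) 1 = Y := by rw [displacement, ha, htranslate]
  rw [bracket_swap, ← hdisp, neg_eq_zero]
  exact gr.bracket_displacement_eq_zero
    (hact.contMDiff_act.comp (contMDiff_id.prodMk contMDiff_const))
    (fun p ↦ (hπ _ _).1 (hact.proj_act p a).symm) (fun p ↦ hinv p a) hX 1

end Displacement

section Submersion

variable {V : Type*} [NormedAddCommGroup V] [NormedSpace ℝ V] {B : Type*} [TopologicalSpace B]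
  [ChartedSpace V B] {Φ : B ≃ₘ⟮𝓘(ℝ, V), 𝓘(ℝ, V)⟯ V} {π : G → B} {q : E →L[ℝ] V}

theorem contMDiff_of_comp_eq (gr : IsGrading E G r layer) (hπ : Φ ∘ π = q ∘ gr.adaptedCoord) :
    ContMDiff 𝓘(ℝ, E) 𝓘(ℝ, V) ∞ π := by
  rw [← Φ.contMDiff_diffeomorph_comp_iff le_rfl, hπ]
  exact q.contDiff.contMDiff.comp gr.contMDiff_adaptedCoord

theorem leftDeriv_comp_eq_clm_comp (gr : IsGrading E G r layer)
    (hπ : Φ ∘ π = q ∘ gr.adaptedCoord) (g : G) :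
    leftDeriv (E := E) (Φ ∘ π) g = q ∘L leftDeriv gr.adaptedCoord g := by
  rw [hπ]
  exact leftDeriv_comp q.hasFDerivAt (gr.mdifferentiableAt_adaptedCoord g)

theorem isSurjectiveSubmersion_of_comp_eq (gr : IsGrading E G r layer)
    (hq : Function.Surjective q) (hπ : Φ ∘ π = q ∘ gr.adaptedCoord) :
    IsSurjectiveSubmersion 𝓘(ℝ, E) 𝓘(ℝ, V) π where
  contMDiff := gr.contMDiff_of_comp_eq hπ
  surjective b := by
    obtain ⟨u, hu⟩ := hq (Φ b)
    refine ⟨gr.adaptedCoordSymm u, Φ.injective ?_⟩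
    exact congr($hπ _).trans (by rwa [Function.comp_apply, adaptedCoord_adaptedCoordSymm])
  mfderiv_surjective g := by
    refine mfderiv_surjective_of_leftDeriv Φ
      ((gr.contMDiff_of_comp_eq hπ).mdifferentiable (by simp) g) ?_
    rw [gr.leftDeriv_comp_eq_clm_comp hπ]
    exact hq.comp (LinearMap.surjective_of_injective (gr.leftDeriv_adaptedCoord_injective g))

theorem ker_leftDeriv_of_comp_eq (gr : IsGrading E G r layer) {𝔨 : Submodule ℝ E}
    (h𝔨 : 𝔨 ≤ highIdeal r layer) (hq : ∀ x, q x = 0 ↔ x ∈ 𝔨) (hπ : Φ ∘ π = q ∘ gr.adaptedCoord)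
    (g : G) : LinearMap.ker (leftDeriv (E := E) (Φ ∘ π) g).toLinearMap = 𝔨 := by
  ext X
  have hker : q (leftDeriv gr.adaptedCoord g X) = 0 ↔ X ∈ 𝔨 := by
    refine (hq _).trans ⟨fun h ↦ ?_, fun h ↦ ?_⟩
    · have hfix := gr.leftDeriv_adaptedCoord_of_mem g (h𝔨 h)
      rwa [gr.leftDeriv_adaptedCoord_injective g hfix] at h
    · rwa [gr.leftDeriv_adaptedCoord_of_mem g (h𝔨 h)]
  rw [gr.leftDeriv_comp_eq_clm_comp hπ]
  exact hker

theorem isEhresmannConnection_of_comp_eq (gr : IsGrading E G r layer) {𝔭 𝔨 : Submodule ℝ E}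
    (h : IsCompl 𝔭 𝔨) (h𝔨 : 𝔨 ≤ highIdeal r layer) (hq : ∀ x, q x = 0 ↔ x ∈ 𝔨)
    (hπ : Φ ∘ π = q ∘ gr.adaptedCoord) :
    IsEhresmannConnection 𝓘(ℝ, E) 𝓘(ℝ, V) π (leftTranslate (I := 𝓘(ℝ, E)) (G := G) 𝔭) := by
  intro g
  rw [ker_mfderiv_eq_leftTranslate Φ ((gr.contMDiff_of_comp_eq hπ).mdifferentiable (by simp) g),
    gr.ker_leftDeriv_of_comp_eq h𝔨 hq hπ]
  exact isCompl_leftTranslate h g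

end Submersion

end IsGrading

namespace IsGrading

variable {E : Type*} [NormedAddCommGroup E] [NormedSpace ℝ E] [FiniteDimensional ℝ E]
  {G : Type*} [TopologicalSpace G] [SimplyConnectedSpace G] [T2Space G] [ChartedSpace E G]
  [Group G] [LieGroup 𝓘(ℝ, E) ∞ G] {r : ℕ} {layer : ℕ → Submodule ℝ E}

section Invariance

theorem exp_neg (gr : IsGrading E G r layer) {Y : E} (hY : Y ∈ highIdeal r layer) :
    (gr.exp (-Y) : G) = (gr.exp Y)⁻¹ :=
  eq_inv_of_mul_eq_one_left (by rw [← gr.exp_add (neg_mem hY) hY, neg_add_cancel, exp_zero])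

theorem Ad_exp_mem_horizontal (gr : IsGrading E G r layer)
    (h : ∀ X ∈ evenHorizontal r layer, ∀ Y ∈ vertical r layer, bracket E G X Y = 0) {X Y : E}
    (hX : X ∈ horizontal r layer) (hY : Y ∈ vertical r layer) :
    Ad E (gr.exp Y : G) X ∈ horizontal r layer := by
  rw [gr.Ad_exp (gr.vertical_le_highIdeal hY)]
  refine add_mem hX ?_
  rw [← oddHorizontal_sup_evenHorizontal, Submodule.mem_sup] at hX
  obtain ⟨X₁, hX₁, X₂, hX₂, rfl⟩ := hX
  rw [bracket_swap, map_add, add_apply, h X₂ hX₂ Y hY, add_zero]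
  exact neg_mem (oddHorizontal_le_horizontal (gr.bracket_oddHorizontal_vertical_mem hX₁ hY))

theorem map_Ad_exp_horizontal (gr : IsGrading E G r layer)
    (h : ∀ X ∈ evenHorizontal r layer, ∀ Y ∈ vertical r layer, bracket E G X Y = 0) {Y : E}
    (hY : Y ∈ vertical r layer) :
    (horizontal r layer).map (Ad E (gr.exp Y : G)).toLinearMap = horizontal r layer := by
  refine le_antisymm (Submodule.map_le_iff_le_comap.2 fun X hX ↦ gr.Ad_exp_mem_horizontal h hX hY)
    fun X hX ↦ ⟨_, gr.Ad_exp_mem_horizontal h hX (neg_mem hY), ?_⟩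
  rw [gr.exp_neg (gr.vertical_le_highIdeal hY)]
  exact Ad_Ad_inv (gr.exp Y) X

theorem isInvariant_mul_exp (gr : IsGrading E G r layer) {A : Type*} {κ : A → E}
    (hκ : ∀ a, κ a ∈ vertical r layer)
    (h : ∀ X ∈ evenHorizontal r layer, ∀ Y ∈ vertical r layer, bracket E G X Y = 0) :
    IsInvariant 𝓘(ℝ, E) (fun p a ↦ p * gr.exp (κ a))
      (leftTranslate (I := 𝓘(ℝ, E)) (G := G) (horizontal r layer : Submodule ℝ E)) := by
  refine fun p a ↦ map_mfderiv_mul_right_leftTranslate p ?_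
  rw [← gr.exp_neg (gr.vertical_le_highIdeal (hκ a))]
  exact gr.map_Ad_exp_horizontal h (neg_mem (hκ a))

end Invariance

section Trivialization

variable {V W : Type*} [NormedAddCommGroup V] [NormedSpace ℝ V] [NormedAddCommGroup W]
  [NormedSpace ℝ W] {B : Type*} [TopologicalSpace B] [ChartedSpace V B]

/-- The global trivialization of a bundle over `B` whose projection is, in the charts
`adaptedCoord` of `G` and `Φ` of `B`, the projection `V × W → V`. -/
def trivialization (gr : IsGrading E G r layer) (e : E ≃L[ℝ] V × W)
    (Φ : B ≃ₘ⟮𝓘(ℝ, V), 𝓘(ℝ, V)⟯ V) : G ≃ₘ⟮𝓘(ℝ, E), 𝓘(ℝ, V).prod 𝓘(ℝ, W)⟯ B × W where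
  toFun g := (Φ.symm (e (gr.adaptedCoord g)).1, (e (gr.adaptedCoord g)).2)
  invFun x := gr.adaptedCoordSymm (e.symm (Φ x.1, x.2))
  left_inv g := by simp
  right_inv x := by simp
  contMDiff_toFun :=
    (Φ.symm.contMDiff.comp ((contDiff_fst.comp e.contDiff).contMDiff.comp
      gr.contMDiff_adaptedCoord)).prodMk
        ((contDiff_snd.comp e.contDiff).contMDiff.comp gr.contMDiff_adaptedCoord)
  contMDiff_invFun := gr.contMDiff_adaptedCoordSymm.comp (e.symm.contDiff.contMDiff.comp
    ((Φ.contMDiff.comp contMDiff_fst).prodMk_space contMDiff_snd))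

theorem trivialization_mul_exp (gr : IsGrading E G r layer) (e : E ≃L[ℝ] V × W)
    (Φ : B ≃ₘ⟮𝓘(ℝ, V), 𝓘(ℝ, V)⟯ V) (g : G) {a : W} (ha : e.symm (0, a) ∈ highIdeal r layer) :
    gr.trivialization e Φ (g * gr.exp (e.symm (0, a))) =
      ((gr.trivialization e Φ g).1, (gr.trivialization e Φ g).2 + a) := by
  have he : e (gr.adaptedCoord (g * gr.exp (e.symm (0, a)))) =
      e (gr.adaptedCoord g) + (0, a) := by
    rw [gr.adaptedCoord_mul_exp g ha, map_add, e.apply_symm_apply]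
  refine Prod.ext (congrArg Φ.symm ?_) congr($he.2)
  exact congr($he.1).trans (add_zero _)

theorem canBeMadePrincipal (gr : IsGrading E G r layer) {d : ℕ}
    {e : E ≃L[ℝ] V × EuclideanSpace ℝ (Fin d)} (he : ∀ x, (e x).1 = 0 ↔ x ∈ vertical r layer)
    {Φ : B ≃ₘ⟮𝓘(ℝ, V), 𝓘(ℝ, V)⟯ V} {π : G → B} (hπ : ∀ g, Φ (π g) = (e (gr.adaptedCoord g)).1)
    (h : ∀ X ∈ evenHorizontal r layer, ∀ Y ∈ vertical r layer, bracket E G X Y = 0) :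
    CanBeMadePrincipal 𝓘(ℝ, E) 𝓘(ℝ, V) π
      (leftTranslate (I := 𝓘(ℝ, E)) (G := G) (horizontal r layer : Submodule ℝ E)) := by
  have hvert (a : EuclideanSpace ℝ (Fin d)) : e.symm (0, a) ∈ vertical r layer :=
    (he _).1 (by rw [e.apply_symm_apply])
  have hπ_fst : π = fun g ↦ (gr.trivialization e Φ g).1 :=
    funext fun g ↦ (Φ.symm_apply_apply _).symm.trans (congrArg Φ.symm (hπ g))
  let _ := multiplicativeGroup (EuclideanSpace ℝ (Fin d))
  have hlie := lieGroup_multiplicativeGroup (EuclideanSpace ℝ (Fin d))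
  refine ⟨d, EuclideanSpace ℝ (Fin d), inferInstance, inferInstance, inferInstance, hlie,
    inferInstance, fun p a ↦ p * gr.exp (e.symm (0, a)), ?_, gr.isInvariant_mul_exp hvert h⟩
  rw [hπ_fst]
  exact isPrincipalBundle_of_diffeomorph (gr.trivialization e Φ) fun p a ↦
    gr.trivialization_mul_exp e Φ p (gr.vertical_le_highIdeal (hvert a))

end Trivialization

section Quotient

variable {V W : Type*} [NormedAddCommGroup V] [NormedSpace ℝ V] [NormedAddCommGroup W]
  [NormedSpace ℝ W] {𝔨 : Submodule ℝ E}

theorem quotient_mk_eq_iff (gr : IsGrading E G r layer) (h𝔨 : 𝔨 ≤ highIdeal r layer) (g g' : G) :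
    (g : G ⧸ connectedSubgroup (I := 𝓘(ℝ, E)) (G := G) 𝔨) = g' ↔
      gr.adaptedCoord g' - gr.adaptedCoord g ∈ 𝔨 :=
  QuotientGroup.eq.trans (gr.inv_mul_mem_connectedSubgroup_iff h𝔨)

/-- The global chart of the quotient of `G` by the subgroup corresponding to `𝔨`, given by the
component in `V` of the coordinates `adaptedCoord`. -/
def quotientHomeomorph (gr : IsGrading E G r layer) (h𝔨 : 𝔨 ≤ highIdeal r layer)
    (e : E ≃L[ℝ] V × W) (he : ∀ x, (e x).1 = 0 ↔ x ∈ 𝔨) :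
    G ⧸ connectedSubgroup (I := 𝓘(ℝ, E)) (G := G) 𝔨 ≃ₜ V where
  toFun := Quotient.lift (fun g ↦ (e (gr.adaptedCoord g)).1) fun g g' h ↦ by
    have hmem := (he _).2 ((gr.quotient_mk_eq_iff h𝔨 g g').1 (Quotient.sound h))
    rw [map_sub, Prod.fst_sub, sub_eq_zero] at hmem
    exact hmem.symm
  invFun v := (gr.adaptedCoordSymm (e.symm (v, 0)) : G)
  left_inv x := by
    obtain ⟨g, rfl⟩ := QuotientGroup.mk_surjective x
    refine (gr.quotient_mk_eq_iff h𝔨 _ _).2 ((he _).1 ?_)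
    rw [adaptedCoord_adaptedCoordSymm, map_sub, e.apply_symm_apply, Prod.fst_sub]
    exact sub_self _
  right_inv v := by
    change (e (gr.adaptedCoord (gr.adaptedCoordSymm (e.symm (v, 0)) : G))).1 = v
    rw [adaptedCoord_adaptedCoordSymm, e.apply_symm_apply]
  continuous_toFun := (continuous_fst.comp
    (e.continuous.comp gr.contMDiff_adaptedCoord.continuous)).quotient_lift _
  continuous_invFun := QuotientGroup.continuous_mk.comp
    (gr.contMDiff_adaptedCoordSymm.continuous.comp
      (e.symm.continuous.comp (continuous_id.prodMk continuous_const)))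

theorem exists_chartedSpace_quotient (gr : IsGrading E G r layer) {K : Subgroup G}
    (hK : K = connectedSubgroup (I := 𝓘(ℝ, E)) (G := G) (vertical r layer : Submodule ℝ E)) :
    let D := leftTranslate (I := 𝓘(ℝ, E)) (G := G) (horizontal r layer : Submodule ℝ E)
    ∃ (m : ℕ) (_ : ChartedSpace (EuclideanSpace ℝ (Fin m)) (G ⧸ K)),
      T2Space (G ⧸ K) ∧
      IsManifold 𝓘(ℝ, EuclideanSpace ℝ (Fin m)) ∞ (G ⧸ K) ∧
      IsSurjectiveSubmersion 𝓘(ℝ, E) 𝓘(ℝ, EuclideanSpace ℝ (Fin m))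
        (QuotientGroup.mk : G → G ⧸ K) ∧
      IsEhresmannConnection 𝓘(ℝ, E) 𝓘(ℝ, EuclideanSpace ℝ (Fin m))
        (QuotientGroup.mk : G → G ⧸ K) D ∧
      (CanBeMadePrincipal 𝓘(ℝ, E) 𝓘(ℝ, EuclideanSpace ℝ (Fin m))
          (QuotientGroup.mk : G → G ⧸ K) D ↔
        ∀ X ∈ evenHorizontal r layer, ∀ Y ∈ vertical r layer, bracket E G X Y = 0) := by
  subst hK
  obtain ⟨m, d, e, he, -⟩ := exists_euclideanProd_of_isCompl gr.isCompl_horizontal_vertical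
  have h𝔨 := gr.vertical_le_highIdeal
  obtain ⟨_, hmanifold, Φ, hΦ⟩ :=
    exists_chartedSpace_of_homeomorph (gr.quotientHomeomorph h𝔨 e he)
  let q : E →L[ℝ] EuclideanSpace ℝ (Fin m) :=
    .fst ℝ _ (EuclideanSpace ℝ (Fin d)) ∘L e.toContinuousLinearMap
  have hπ : Φ ∘ QuotientGroup.mk = q ∘ gr.adaptedCoord :=
    funext fun g ↦ congrArg (fun f : _ ≃ _ ↦ f (QuotientGroup.mk g)) hΦ
  exact ⟨m, _, (gr.quotientHomeomorph h𝔨 e he).isEmbedding.t2Space, hmanifold,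
    gr.isSurjectiveSubmersion_of_comp_eq (Prod.fst_surjective.comp e.surjective) hπ,
    gr.isEhresmannConnection_of_comp_eq gr.isCompl_horizontal_vertical h𝔨 he hπ,
    fun h _ hX _ hY ↦ gr.bracket_eq_zero_of_canBeMadePrincipal (gr.quotient_mk_eq_iff h𝔨) h hX hY,
    gr.canBeMadePrincipal he (congrFun hπ)⟩

end Quotient

end IsGrading

section TotallyGeodesic

open VectorField

variable {E : Type*} [NormedAddCommGroup E] [NormedSpace ℝ E]
  {G : Type*} [TopologicalSpace G] [ChartedSpace E G] [Group G]

theorem leftInvField_mem_leftTranslate {𝔞 : Submodule ℝ E} {X : E} (hX : X ∈ 𝔞) (x : G) :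
    leftInvField G X x ∈ (leftTranslate (I := 𝓘(ℝ, E)) (G := G) 𝔞 x : Submodule ℝ E) :=
  ⟨X, hX, rfl⟩

variable [LieGroup 𝓘(ℝ, E) ∞ G]
  {g : Bundle.ContMDiffRiemannianMetric 𝓘(ℝ, E) ∞ E (fun x : G ↦ TangentSpace 𝓘(ℝ, E) x)}

theorem leftInvField_ne_zero {X : E} (hX : X ≠ 0) (x : G) : leftInvField G X x ≠ 0 :=
  fun h ↦ hX ((leftFrame E x).map_eq_zero_iff.1 h)

variable (g) in
theorem contMDiff_inner_leftInvField (Y Z : E) :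
    ContMDiff 𝓘(ℝ, E) 𝓘(ℝ, ℝ) ∞
      fun x ↦ g.inner x (leftInvField G Y x) (leftInvField G Z x) := fun x ↦ by
  have h : ContMDiffAt 𝓘(ℝ, E) (𝓘(ℝ, E).prod 𝓘(ℝ)) ∞
      (fun m ↦ Bundle.TotalSpace.mk' ℝ (E := Bundle.Trivial G ℝ) m
        (g.inner m (leftInvField G Y m) (leftInvField G Z m))) x :=
    ContMDiffAt.clm_bundle_apply₂ (F₁ := E) (F₂ := E) (g.contMDiff x)
      (contMDiff_leftInvField Y x) (contMDiff_leftInvField Z x)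
  exact (Bundle.contMDiffAt_totalSpace.1 h).2

variable [FiniteDimensional ℝ E] {𝔭 𝔨 : Submodule ℝ E}

/-- The torsion turns `∇_X Y` into `∇_Y X + [X, Y]`, and `⟨∇_Y X, Z⟩ = -⟨X, ∇_Y Z⟩ = 0` because
`∇_Y Z` is tangent to the leaves. -/
theorem inner_cov_leftInvField
    (hort : AreOrthogonal g (leftTranslate (I := 𝓘(ℝ, E)) (G := G) 𝔭)
      (leftTranslate (I := 𝓘(ℝ, E)) (G := G) 𝔨))
    {cov : CovariantDerivative 𝓘(ℝ, E) E (fun x : G ↦ TangentSpace 𝓘(ℝ, E) x)}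
    (hcov : IsLeviCivita g cov) {X Y Z : E} (hX : X ∈ 𝔭) (hZ : Z ∈ 𝔨)
    (hYZ : ∀ x, cov (leftInvField G Z) x (leftInvField G Y x) ∈
      leftTranslate (I := 𝓘(ℝ, E)) (G := G) 𝔨 x) (x : G) :
    g.inner x (cov (leftInvField G Y) x (leftInvField G X x)) (leftInvField G Z x) =
      g.inner x (leftInvField G (bracket E G X Y) x) (leftInvField G Z x) := by
  have htorsion := hcov.torsion_free _ _ x (mdifferentiableAt_leftInvField X x)
    (mdifferentiableAt_leftInvField Y x)
  rw [mlieBracket_leftInvField] at htorsion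
  have hmetric := hcov.metric _ _ x (leftInvField G Y x) (mdifferentiableAt_leftInvField X x)
    (mdifferentiableAt_leftInvField Z x)
  have hXZ : (fun y ↦ g.inner y (leftInvField G X y) (leftInvField G Z y)) = fun _ ↦ (0 : ℝ) :=
    funext fun y ↦ hort y _ (leftInvField_mem_leftTranslate hX y) _
      (leftInvField_mem_leftTranslate hZ y)
  rw [hXZ, hort x _ (leftInvField_mem_leftTranslate hX x) _ (hYZ x), add_zero] at hmetric
  have hYX : g.inner x (cov (leftInvField G X) x (leftInvField G Y x)) (leftInvField G Z x) = 0 :=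
    hmetric.symm.trans (congrArg (fun A : E →L[ℝ] ℝ ↦ A (leftInvField G Y x))
      (mfderiv_const (I := 𝓘(ℝ, E)) (I' := 𝓘(ℝ, ℝ)) (x := x) (c := (0 : ℝ))))
  rw [← htorsion, map_sub, sub_apply, hYX, sub_zero]

theorem leftDeriv_inner_leftInvField
    (hort : AreOrthogonal g (leftTranslate (I := 𝓘(ℝ, E)) (G := G) 𝔭)
      (leftTranslate (I := 𝓘(ℝ, E)) (G := G) 𝔨))
    (hgeo : IsTotallyGeodesic g (leftTranslate (I := 𝓘(ℝ, E)) (G := G) 𝔨))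
    {X Y Z : E} (hX : X ∈ 𝔭) (hY : Y ∈ 𝔨) (hZ : Z ∈ 𝔨) (x : G) :
    leftDeriv (fun y ↦ g.inner y (leftInvField G Y y) (leftInvField G Z y)) x X =
      g.inner x (leftInvField G (bracket E G X Y) x) (leftInvField G Z x) +
        g.inner x (leftInvField G Y x) (leftInvField G (bracket E G X Z) x) := by
  obtain ⟨cov, hcov, htangent⟩ := hgeo
  have hmem {Y Z : E} (hY : Y ∈ 𝔨) (hZ : Z ∈ 𝔨) :=
    htangent _ _ (contMDiff_leftInvField Z) (contMDiff_leftInvField Y)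
      (leftInvField_mem_leftTranslate hZ) (leftInvField_mem_leftTranslate hY)
  have hmetric := hcov.metric _ _ x (leftInvField G X x) (mdifferentiableAt_leftInvField Y x)
    (mdifferentiableAt_leftInvField Z x)
  rw [inner_cov_leftInvField hort hcov hX hZ (hmem hY hZ), g.symm x (leftInvField G Y x),
    inner_cov_leftInvField hort hcov hX hY (hmem hZ hY),
    g.symm x (leftInvField G (bracket E G X Z) x)] at hmetric
  exact (mfderiv_leftFrame ((contMDiff_inner_leftInvField g Y Z).mdifferentiable (by simp) x)
    X).symm.trans hmetric

end TotallyGeodesic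

section SkewNilpotent

theorem apply_eq_zero_of_skew_of_iterate_eq_zero {V : Type*} [AddCommGroup V] {A : V → V}
    {b : V → V → ℝ} {q : Set V} (hA : Set.MapsTo A q q) (hb : ∀ y ∈ q, b y y = 0 → y = 0)
    (hb_zero : ∀ y, b y 0 = 0) (hskew : ∀ y ∈ q, ∀ z ∈ q, b (A y) z + b y (A z) = 0) (n : ℕ)
    {y : V} (hy : y ∈ q) (hn : A^[n + 1] y = 0) : A y = 0 := by
  induction n generalizing y with
  | zero => exact hn
  | succ n ih =>
    have hAA : A (A y) = 0 := ih (hA hy) hn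
    have hself := hskew y hy (A y) (hA hy)
    rw [hAA, hb_zero, add_zero] at hself
    exact hb _ (hA hy) hself

end SkewNilpotent

namespace IsGrading

variable {E : Type*} [NormedAddCommGroup E] [NormedSpace ℝ E] [FiniteDimensional ℝ E]
  {G : Type*} [TopologicalSpace G] [ChartedSpace E G] [Group G] [LieGroup 𝓘(ℝ, E) ∞ G]
  {r : ℕ} {layer : ℕ → Submodule ℝ E}

theorem iterate_bracket_eq_zero (gr : IsGrading E G r layer) (X Y : E) :
    (bracket E G X)^[r + 1] Y = 0 := by
  have hmem (n : ℕ) : (bracket E G X)^[n] Y ∈ filtration layer n := by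
    induction n with
    | zero => exact gr.filtration_zero ▸ Submodule.mem_top
    | succ n ih =>
      rw [Function.iterate_succ_apply']
      exact gr.bracket_mem_filtration X ih
  simpa only [gr.filtration_eq_bot (Nat.lt_succ_self r), Submodule.mem_bot] using hmem (r + 1)

/-- The inner products of left-invariant vertical fields have vanishing derivatives along the
first layer, so they are constant, and `ad X` is skew on the vertical layers. -/
theorem bracket_eq_zero_of_isTotallyGeodesic [PreconnectedSpace G] (gr : IsGrading E G r layer)
    {g : Bundle.ContMDiffRiemannianMetric 𝓘(ℝ, E) ∞ E (fun x : G ↦ TangentSpace 𝓘(ℝ, E) x)}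
    (hort : AreOrthogonal g
      (leftTranslate (I := 𝓘(ℝ, E)) (G := G) (horizontal r layer : Submodule ℝ E))
      (leftTranslate (I := 𝓘(ℝ, E)) (G := G) (vertical r layer : Submodule ℝ E)))
    (hgeo : IsTotallyGeodesic g
      (leftTranslate (I := 𝓘(ℝ, E)) (G := G) (vertical r layer : Submodule ℝ E)))
    {X Y : E} (hX : X ∈ evenHorizontal r layer) (hY : Y ∈ vertical r layer) :
    bracket E G X Y = 0 := by
  have horthogonal {u v : E} (hu : u ∈ oddHorizontal layer) (hv : v ∈ vertical r layer) (x : G) :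
      g.inner x (leftInvField G u x) (leftInvField G v x) = 0 :=
    hort x _ (leftInvField_mem_leftTranslate (oddHorizontal_le_horizontal hu) x) _
      (leftInvField_mem_leftTranslate hv x)
  have hconst : ∀ y ∈ vertical r layer, ∀ z ∈ vertical r layer, ∀ x : G,
      leftDeriv (E := E) (fun x ↦ g.inner x (leftInvField G y x) (leftInvField G z x)) x = 0 := by
    refine fun y hy z hz ↦ gr.leftDeriv_eq_zero_of_layer_one (contMDiff_inner_leftInvField g y z)
      fun x W hW ↦ ?_
    have hW : W ∈ oddHorizontal layer := layer_le_layerSum layer (S := {k | Odd k}) odd_one hW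
    rw [leftDeriv_inner_leftInvField hort hgeo (oddHorizontal_le_horizontal hW) hy hz,
      horthogonal (gr.bracket_oddHorizontal_vertical_mem hW hy) hz, g.symm,
      horthogonal (gr.bracket_oddHorizontal_vertical_mem hW hz) hy, add_zero]
  refine apply_eq_zero_of_skew_of_iterate_eq_zero (A := bracket E G X)
    (b := fun y z ↦ g.inner (1 : G) (leftInvField G y 1) (leftInvField G z 1))
    (q := vertical r layer) (fun y hy ↦ gr.bracket_evenHorizontal_vertical_mem hX hy)
    (fun y _ hy ↦ ?_) (fun y ↦ ?_) (fun y hy z hz ↦ ?_) r hY (gr.iterate_bracket_eq_zero X Y)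
  · by_contra h
    exact (g.pos 1 _ (leftInvField_ne_zero h 1)).ne' hy
  · exact (congrArg (g.inner (1 : G) (leftInvField G y 1))
      (map_zero (leftFrame E (1 : G)))).trans (map_zero _)
  · rw [← leftDeriv_inner_leftInvField hort hgeo (evenHorizontal_le_horizontal hX) hy hz 1,
      hconst y hy z hz 1]
    rfl

end IsGrading

section KoszulForm

open scoped RealInnerProductSpace

variable {E : Type*} [NormedAddCommGroup E] [NormedSpace ℝ E]
  {H : Type*} [NormedAddCommGroup H] [InnerProductSpace ℝ H]

theorem mem_of_inner_eq_zero_of_isCompl (e : E ≃L[ℝ] H) {𝔭 𝔨 : Submodule ℝ E} (h : IsCompl 𝔭 𝔨)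
    (hort : ∀ x ∈ 𝔭, ∀ y ∈ 𝔨, ⟪e x, e y⟫ = 0) {x : E} (hx : ∀ y ∈ 𝔭, ⟪e x, e y⟫ = 0) :
    x ∈ 𝔨 := by
  obtain ⟨u, hu, v, hv, rfl⟩ := Submodule.mem_sup.1 (h.sup_eq_top ▸ Submodule.mem_top (x := x))
  have hself := hx u hu
  rw [map_add, inner_add_left, real_inner_comm, real_inner_comm (e u) (e v), hort u hu v hv,
    add_zero, inner_self_eq_zero, e.map_eq_zero_iff] at hself
  rwa [hself, zero_add]

variable [FiniteDimensional ℝ E]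

theorem exists_equiv_inner_eq_zero_of_isCompl {𝔭 𝔨 : Submodule ℝ E} (h : IsCompl 𝔭 𝔨) :
    ∃ (m d : ℕ) (e : E ≃L[ℝ] WithLp 2 (EuclideanSpace ℝ (Fin m) × EuclideanSpace ℝ (Fin d))),
      ∀ x ∈ 𝔭, ∀ y ∈ 𝔨, ⟪e x, e y⟫ = 0 := by
  obtain ⟨m, d, e, hfst, hsnd⟩ := exists_euclideanProd_of_isCompl h
  refine ⟨m, d, e.trans (WithLp.prodContinuousLinearEquiv 2 ℝ _ _).symm, fun x hx y hy ↦ ?_⟩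
  simp [WithLp.prod_inner_apply, (hsnd x).2 hx, (hfst y).2 hy]

theorem exists_inner_eq (e : E ≃L[ℝ] H) (K : E →L[ℝ] E →L[ℝ] E →L[ℝ] ℝ) :
    ∃ Γ : E →L[ℝ] E →L[ℝ] E, ∀ x y z, ⟪e (Γ x y), e z⟫ = K x y z := by
  have : FiniteDimensional ℝ H := e.toLinearEquiv.finiteDimensional
  have := FiniteDimensional.complete ℝ H
  let riesz : (E →L[ℝ] ℝ) →ₗ[ℝ] E :=
    { toFun φ := e.symm ((InnerProductSpace.toDual ℝ H).symm (φ ∘L (e.symm : H →L[ℝ] E)))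
      map_add' φ ψ := by simp [ContinuousLinearMap.add_comp]
      map_smul' c φ := by simp [ContinuousLinearMap.smul_comp] }
  refine ⟨ContinuousLinearMap.compL ℝ E (E →L[ℝ] ℝ) E riesz.toContinuousLinearMap ∘L K,
    fun x y z ↦ ?_⟩
  simp [riesz]

variable {G : Type*} [TopologicalSpace G] [ChartedSpace E G] [Group G] [LieGroup 𝓘(ℝ, E) ∞ G]
  {e : E ≃L[ℝ] H} {Γ : E →L[ℝ] E →L[ℝ] E}

variable (G) in
/-- `Γ` is the Koszul form of the inner product `⟪e X, e Y⟫` on the Lie algebra of `G`, that is,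
the Levi-Civita connection of the left-invariant metric evaluated on left-invariant fields:
`∇_X Y = Γ X Y`. An inner product on `E` is given by an isomorphism `e` onto an inner product
space, because the norm of `E` need not be Euclidean. -/
def IsKoszulForm (e : E ≃L[ℝ] H) (Γ : E →L[ℝ] E →L[ℝ] E) : Prop :=
  ∀ X Y Z, 2 * ⟪e (Γ X Y), e Z⟫ =
    ⟪e (bracket E G X Y), e Z⟫ - ⟪e X, e (bracket E G Y Z)⟫ - ⟪e Y, e (bracket E G X Z)⟫

variable (G) in
theorem exists_isKoszulForm (e : E ≃L[ℝ] H) : ∃ Γ, IsKoszulForm G e Γ := by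
  let B : E →L[ℝ] E →L[ℝ] ℝ := (innerSL ℝ).bilinearComp (e : E →L[ℝ] H) (e : E →L[ℝ] H)
  obtain ⟨Λ, hΛ⟩ := exists_inner_eq e
    ((ContinuousLinearMap.compL ℝ E E ℝ).bilinearComp B (bracket E G))
  refine ⟨(2 : ℝ)⁻¹ • (bracket E G - Λ - Λ.flip), fun X Y Z ↦ ?_⟩
  simp [inner_sub_left, inner_smul_left, hΛ, B]

namespace IsKoszulForm

theorem inner_apply_add_inner_apply (hΓ : IsKoszulForm G e Γ) (X Y Z : E) :
    ⟪e (Γ X Y), e Z⟫ + ⟪e Y, e (Γ X Z)⟫ = 0 := by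
  have hYZ := hΓ X Y Z
  have hZY := hΓ X Z Y
  rw [bracket_swap Z Y, map_neg, inner_neg_right, real_inner_comm (e Y), real_inner_comm (e Y),
    real_inner_comm _ (e Z)] at hZY
  linarith

theorem apply_sub_apply (hΓ : IsKoszulForm G e Γ) (X Y : E) :
    Γ X Y - Γ Y X = bracket E G X Y := by
  refine e.injective (ext_inner_right ℝ (e.surjective.forall.2 fun Z ↦ ?_))
  have hXY := hΓ X Y Z
  have hYX := hΓ Y X Z
  rw [bracket_swap Y X, map_neg, inner_neg_left] at hYX
  rw [map_sub, inner_sub_left]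
  linarith

end IsKoszulForm

end KoszulForm

section LeftInvariantMetric

open scoped RealInnerProductSpace

variable {E : Type*} [NormedAddCommGroup E] [NormedSpace ℝ E]
  {H : Type*} [NormedAddCommGroup H] [InnerProductSpace ℝ H]
  {G : Type*} [TopologicalSpace G] [ChartedSpace E G] [Group G] [LieGroup 𝓘(ℝ, E) ∞ G]

/-- The left-invariant inner product on the tangent bundle whose value at `1` is the inner
product `⟪e X, e Y⟫`. -/
def leftInner (e : E ≃L[ℝ] H) (x : G) :
    TangentSpace 𝓘(ℝ, E) x →L[ℝ] TangentSpace 𝓘(ℝ, E) x →L[ℝ] ℝ :=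
  let A : E →L[ℝ] H := (leftFrame E x).symm.trans e
  ((innerSL ℝ).bilinearComp A A : E →L[ℝ] E →L[ℝ] ℝ)

theorem isVonNBounded_leftInner_lt_one (e : E ≃L[ℝ] H) (x : G) :
    Bornology.IsVonNBounded ℝ {v : E | (leftInner e x : E →L[ℝ] E →L[ℝ] ℝ) v v < 1} := by
  let A : E ≃L[ℝ] H := (leftFrame E x).symm.trans e
  refine ((NormedSpace.isVonNBounded_ball ℝ H 1).image (A.symm : H →L[ℝ] E)).subset ?_
  rintro v (hv : ⟪A v, A v⟫ < 1)
  refine ⟨A v, ?_, A.symm_apply_apply v⟩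
  rw [real_inner_self_eq_norm_sq] at hv
  rw [mem_ball_zero_iff]
  nlinarith [norm_nonneg (A v)]

theorem leftFrame_symm_trivializationAt_symm {x₀ x : G} (hx : x ∈ (chartAt E x₀).source) (u : E) :
    (leftFrame E x).symm ((trivializationAt E (TangentSpace 𝓘(ℝ, E)) x₀).symm x u) =
      (leftDeriv (E := E) (extChartAt 𝓘(ℝ, E) x₀) x).inverse u := by
  let Y (y : G) : TangentSpace 𝓘(ℝ, E) y :=
    (trivializationAt E (TangentSpace 𝓘(ℝ, E)) x₀).symm y u
  have hbase : x ∈ (trivializationAt E (TangentSpace 𝓘(ℝ, E)) x₀).baseSet := hx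
  have hu : u = leftDeriv (extChartAt 𝓘(ℝ, E) x₀) x (frameComponents Y x) := by
    rw [← trivializationAt_apply_snd hx Y]
    exact (congrArg Prod.snd (Bundle.Trivialization.apply_mk_symm _ hbase u)).symm
  nth_rw 2 [hu]
  exact ((isInvertible_leftDeriv_extChartAt hx).inverse_apply_self _).symm

set_option maxSynthPendingDepth 3 in
theorem contDiff_bilinearComp_self {F : Type*} [NormedAddCommGroup F] [NormedSpace ℝ F]
    (B : F →L[ℝ] F →L[ℝ] ℝ) :
    ContDiff ℝ ∞ fun A : E →L[ℝ] F ↦ B.bilinearComp A A := by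
  have hcomp : ContDiff ℝ ∞ fun A : E →L[ℝ] F ↦ B ∘L A := contDiff_const.clm_comp contDiff_id
  have hflip : ContDiff ℝ ∞ fun A : E →L[ℝ] F ↦ (B ∘L A).flip :=
    (ContinuousLinearMap.flipₗᵢ ℝ E F ℝ).contDiff.comp hcomp
  exact (ContinuousLinearMap.flipₗᵢ ℝ E E ℝ).contDiff.comp (hflip.clm_comp contDiff_fun_id)

set_option maxSynthPendingDepth 3 in
theorem contMDiff_leftInner [CompleteSpace E] (e : E ≃L[ℝ] H) :
    ContMDiff 𝓘(ℝ, E) (𝓘(ℝ, E).prod 𝓘(ℝ, E →L[ℝ] E →L[ℝ] ℝ)) ∞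
      (fun x : G ↦ Bundle.TotalSpace.mk' (E →L[ℝ] E →L[ℝ] ℝ)
        (E := fun x : G ↦ TangentSpace 𝓘(ℝ, E) x →L[ℝ] TangentSpace 𝓘(ℝ, E) x →L[ℝ] ℝ)
        x (leftInner e x)) := fun x₀ ↦ by
  refine (contMDiffAt_hom_bundle _).2 ⟨contMDiffAt_id, ?_⟩
  have hsmooth := (contDiff_bilinearComp_self (E := E) (innerSL ℝ (E := H))).contMDiff.contMDiffAt
    |>.comp x₀ ((contMDiffAt_const (c := (e : E →L[ℝ] H))).clm_comp
      (contMDiffAt_inverse_leftDeriv_extChartAt x₀))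
  refine hsmooth.congr_of_eventuallyEq ?_
  filter_upwards [chart_source_mem_nhds E x₀] with x hx
  have hbase : x ∈ (trivializationAt E (TangentSpace 𝓘(ℝ, E)) x₀).baseSet := hx
  ext v w
  refine (inCoordinates_apply_eq₂ hbase hbase (Set.mem_univ _)).trans ?_
  have hv := leftFrame_symm_trivializationAt_symm hx v
  have hw := leftFrame_symm_trivializationAt_symm hx w
  refine Eq.trans ?_ congr(⟪e $hv, e $hw⟫)
  simp only [Bundle.Trivial.fiberBundle_trivializationAt',
    Bundle.Trivial.linearMapAt_trivialization, LinearMap.id_coe, id_eq]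
  rfl

variable (G) in
/-- The left-invariant Riemannian metric whose value at `1` is the inner product `⟪e X, e Y⟫`. -/
def leftMetric [CompleteSpace E] (e : E ≃L[ℝ] H) :
    Bundle.ContMDiffRiemannianMetric 𝓘(ℝ, E) ∞ E (fun x : G ↦ TangentSpace 𝓘(ℝ, E) x) where
  inner x := leftInner e x
  symm _ _ _ := real_inner_comm _ _
  pos x v hv := real_inner_self_pos.2
    (((leftFrame E x).symm.trans e).map_eq_zero_iff.not.2 (show (v : E) ≠ 0 from hv))
  isVonNBounded x := isVonNBounded_leftInner_lt_one e x
  contMDiff := contMDiff_leftInner e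

theorem areOrthogonal_leftMetric [CompleteSpace E] {e : E ≃L[ℝ] H} {𝔭 𝔨 : Submodule ℝ E}
    (hort : ∀ x ∈ 𝔭, ∀ y ∈ 𝔨, ⟪e x, e y⟫ = 0) :
    AreOrthogonal (leftMetric G e) (leftTranslate (I := 𝓘(ℝ, E)) (G := G) 𝔭)
      (leftTranslate (I := 𝓘(ℝ, E)) (G := G) 𝔨) := fun _ _ hu _ hv ↦
  hort _ (mem_leftTranslate_iff.1 hu) _ (mem_leftTranslate_iff.1 hv)

end LeftInvariantMetric

section LeftInvariantConnection

variable {E : Type*} [NormedAddCommGroup E] [NormedSpace ℝ E]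
  {G : Type*} [TopologicalSpace G] [ChartedSpace E G] [Group G] [LieGroup 𝓘(ℝ, E) ∞ G]
  {Y Z : Π x : G, TangentSpace 𝓘(ℝ, E) x} {x : G}

theorem frameComponents_add :
    frameComponents (Y + Z) = fun x ↦ (frameComponents Y x + frameComponents Z x : E) :=
  funext fun x ↦ map_add (leftFrame E x).symm (Y x) (Z x)

theorem frameComponents_smul (f : G → ℝ) :
    frameComponents (f • Y) = fun x ↦ (f x • frameComponents Y x : E) :=
  funext fun x ↦ map_smul (leftFrame E x).symm (f x) (Y x)

variable [CompleteSpace E]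

theorem leftDeriv_frameComponents_add (hY : MDiffAt (T% Y) x) (hZ : MDiffAt (T% Z) x) :
    leftDeriv (E := E) (frameComponents (Y + Z)) x =
      leftDeriv (frameComponents Y) x + leftDeriv (frameComponents Z) x := by
  rw [frameComponents_add]
  exact ((hasFDerivAt_leftDeriv (mdifferentiableAt_frameComponents hY)).add
    (hasFDerivAt_leftDeriv (mdifferentiableAt_frameComponents hZ))).fderiv

theorem leftDeriv_frameComponents_smul {f : G → ℝ}
    (hf : MDifferentiableAt 𝓘(ℝ, E) 𝓘(ℝ, ℝ) f x) (hY : MDiffAt (T% Y) x) :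
    leftDeriv (E := E) (frameComponents (f • Y)) x =
      f x • leftDeriv (frameComponents Y) x +
        (leftDeriv f x).smulRight (frameComponents Y x) := by
  rw [frameComponents_smul]
  have hderiv := ((hasFDerivAt_leftDeriv hf).smul
    (hasFDerivAt_leftDeriv (mdifferentiableAt_frameComponents hY))).fderiv
  refine Eq.trans hderiv ?_
  simp

/-- The connection given in the left-invariant frame by `∇_X Y = dY(X) + Γ X Y`; on left-invariant
fields it is `Γ`. -/
def leftConnection (Γ : E →L[ℝ] E →L[ℝ] E) :
    CovariantDerivative 𝓘(ℝ, E) E (fun x : G ↦ TangentSpace 𝓘(ℝ, E) x) where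
  toFun Y x := ((leftFrame E x : E →L[ℝ] E) ∘L
    (leftDeriv (frameComponents Y) x + Γ.flip (frameComponents Y x)) ∘L
      ((leftFrame E x).symm : E →L[ℝ] E) : E →L[ℝ] E)
  isCovariantDerivativeOnUniv :=
    { add {Y Z x} hY hZ _ := by
        rw [leftDeriv_frameComponents_add hY hZ, frameComponents_add]
        refine ContinuousLinearMap.ext fun v ↦ ?_
        let X : E := (leftFrame E x).symm v
        let y : E := frameComponents Y x
        let z : E := frameComponents Z x
        change leftFrame E x ((leftDeriv (frameComponents Y) x +
              leftDeriv (frameComponents Z) x : E →L[ℝ] E) X + Γ X (y + z)) =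
          leftFrame E x (leftDeriv (frameComponents Y) x X + Γ X y) +
            leftFrame E x (leftDeriv (frameComponents Z) x X + Γ X z)
        simp only [add_apply, map_add]
        abel
      leibniz {Y f x} hY hf _ := by
        rw [leftDeriv_frameComponents_smul hf hY, frameComponents_smul]
        refine ContinuousLinearMap.ext fun v ↦ ?_
        let X : E := (leftFrame E x).symm v
        let y : E := frameComponents Y x
        let A : E →L[ℝ] ℝ := mfderiv 𝓘(ℝ, E) 𝓘(ℝ, ℝ) f x
        let w : E := Y x
        have hA : A v = leftDeriv f x X := mfderiv_eq_leftDeriv hf v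
        have hw : w = leftFrame E x y := (leftFrame_frameComponents Y x).symm
        change leftFrame E x ((f x • leftDeriv (frameComponents Y) x +
              (leftDeriv f x).smulRight y : E →L[ℝ] E) X + Γ X (f x • y)) =
          f x • leftFrame E x (leftDeriv (frameComponents Y) x X + Γ X y) + A v • w
        rw [hA, hw]
        simp only [add_apply, smul_apply, ContinuousLinearMap.smulRight_apply, map_add, map_smul]
        module }

end LeftInvariantConnection

section LeviCivita

open VectorField
open scoped RealInnerProductSpace

variable {E : Type*} [NormedAddCommGroup E] [NormedSpace ℝ E]
  {H : Type*} [NormedAddCommGroup H] [InnerProductSpace ℝ H]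
  {G : Type*} [TopologicalSpace G] [ChartedSpace E G] [Group G] [LieGroup 𝓘(ℝ, E) ∞ G]

theorem leftFrame_symm_leftConnection [CompleteSpace E] (Γ : E →L[ℝ] E →L[ℝ] E)
    (Y : Π x : G, TangentSpace 𝓘(ℝ, E) x) (x : G) (v : E) :
    (leftFrame E x).symm ((leftConnection Γ Y x : E →L[ℝ] E) v) =
      leftDeriv (frameComponents Y) x ((leftFrame E x).symm v) +
        Γ ((leftFrame E x).symm v) (frameComponents Y x) :=
  (leftFrame E x).symm_apply_apply _

theorem leftDeriv_inner {e : E ≃L[ℝ] H} {f f' : G → E} {x : G}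
    (hf : MDifferentiableAt 𝓘(ℝ, E) 𝓘(ℝ, E) f x) (hf' : MDifferentiableAt 𝓘(ℝ, E) 𝓘(ℝ, E) f' x)
    (X : E) :
    leftDeriv (fun y ↦ ⟪e (f y), e (f' y)⟫) x X =
      ⟪e (leftDeriv f x X), e (f' x)⟫ + ⟪e (f x), e (leftDeriv f' x X)⟫ := by
  have hderiv := ((e.hasFDerivAt.comp (basePt E G) (hasFDerivAt_leftDeriv hf)).inner ℝ
    (e.hasFDerivAt.comp (basePt E G) (hasFDerivAt_leftDeriv hf'))).fderiv
  exact congr($hderiv X).trans (by simp [add_comm])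

theorem leftMetric_metric [CompleteSpace E] {e : E ≃L[ℝ] H} {Γ : E →L[ℝ] E →L[ℝ] E}
    (hskew : ∀ X Y Z, ⟪e (Γ X Y), e Z⟫ + ⟪e Y, e (Γ X Z)⟫ = 0)
    {Y Z : Π x : G, TangentSpace 𝓘(ℝ, E) x} {x : G} (v : TangentSpace 𝓘(ℝ, E) x)
    (hY : MDiffAt (T% Y) x) (hZ : MDiffAt (T% Z) x) :
    d% (fun y ↦ (leftMetric G e).inner y (Y y) (Z y)) x v =
      (leftMetric G e).inner x (leftConnection Γ Y x v) (Z x) +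
        (leftMetric G e).inner x (Y x) (leftConnection Γ Z x v) := by
  have hY' := mdifferentiableAt_frameComponents hY
  have hZ' := mdifferentiableAt_frameComponents hZ
  have hinner : MDifferentiableAt 𝓘(ℝ, E) 𝓘(ℝ, ℝ)
      (fun y ↦ ⟪e (frameComponents Y y), e (frameComponents Z y)⟫) x := by
    let B : E →L[ℝ] E →L[ℝ] ℝ :=
      (innerSL ℝ (E := H)).bilinearComp (e : E →L[ℝ] H) (e : E →L[ℝ] H)
    exact ((mdifferentiableAt_const (c := B)).clm_apply hY').clm_apply hZ'
  refine (mfderiv_eq_leftDeriv hinner v).trans ?_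
  let X : E := (leftFrame E x).symm v
  let y : E := frameComponents Y x
  let z : E := frameComponents Z x
  have hconn : ⟪e (leftDeriv (frameComponents Y) x X + Γ X y), e z⟫ +
      ⟪e y, e (leftDeriv (frameComponents Z) x X + Γ X z)⟫ =
      ⟪e (leftDeriv (frameComponents Y) x X), e z⟫ +
        ⟪e y, e (leftDeriv (frameComponents Z) x X)⟫ := by
    rw [map_add, map_add, inner_add_left, inner_add_right]
    linarith [hskew X y z]
  refine (leftDeriv_inner hY' hZ' X).trans (hconn.symm.trans ?_)
  exact congr(⟪e $(leftFrame_symm_leftConnection Γ Y x v), e z⟫ +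
    ⟪e y, e $(leftFrame_symm_leftConnection Γ Z x v)⟫).symm

theorem IsKoszulForm.isLeviCivita [FiniteDimensional ℝ E] [CompleteSpace E] {e : E ≃L[ℝ] H}
    {Γ : E →L[ℝ] E →L[ℝ] E} (hΓ : IsKoszulForm G e Γ) :
    IsLeviCivita (leftMetric G e) (leftConnection Γ) where
  torsion_free X Y x hX hY := by
    refine (leftFrame E x).symm.injective ?_
    refine Eq.trans ?_ (frameComponents_mlieBracket hX hY).symm
    refine (map_sub (leftFrame E x).symm _ _).trans ?_
    refine congr($(leftFrame_symm_leftConnection Γ Y x (X x)) -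
      $(leftFrame_symm_leftConnection Γ X x (Y x))).trans ?_
    rw [← hΓ.apply_sub_apply]
    exact add_sub_add_comm _ _ _ _
  metric Y Z x v hY hZ := leftMetric_metric hΓ.inner_apply_add_inner_apply v hY hZ

/-- In the Koszul formula for `⟪Γ Y Z, X⟫` with `X ∈ 𝔭`, every term pairs `𝔨` with `𝔭`. -/
theorem IsKoszulForm.apply_mem [FiniteDimensional ℝ E] {e : E ≃L[ℝ] H} {Γ : E →L[ℝ] E →L[ℝ] E}
    (hΓ : IsKoszulForm G e Γ) {𝔭 𝔨 : Submodule ℝ E} (h : IsCompl 𝔭 𝔨)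
    (hort : ∀ x ∈ 𝔭, ∀ y ∈ 𝔨, ⟪e x, e y⟫ = 0) (h𝔨 : ∀ Y ∈ 𝔨, ∀ Z ∈ 𝔨, bracket E G Y Z ∈ 𝔨)
    (h𝔭 : ∀ X ∈ 𝔭, ∀ Y ∈ 𝔨, bracket E G X Y ∈ 𝔭) {Y Z : E} (hY : Y ∈ 𝔨) (hZ : Z ∈ 𝔨) :
    Γ Y Z ∈ 𝔨 := by
  refine mem_of_inner_eq_zero_of_isCompl e h hort fun X hX ↦ ?_
  have hort' {u v : E} (hu : u ∈ 𝔨) (hv : v ∈ 𝔭) : ⟪e u, e v⟫ = 0 :=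
    (real_inner_comm _ _).trans (hort v hv u hu)
  have hbracket {W : E} (hW : W ∈ 𝔨) : bracket E G W X ∈ 𝔭 := by
    rw [bracket_swap]
    exact neg_mem (h𝔭 X hX W hW)
  have hkoszul := hΓ Y Z X
  rw [hort' (h𝔨 Y hY Z hZ) hX, hort' hY (hbracket hZ), hort' hZ (hbracket hY)] at hkoszul
  linarith

theorem isTotallyGeodesic_leftMetric [FiniteDimensional ℝ E] [CompleteSpace E] {e : E ≃L[ℝ] H}
    {𝔭 𝔨 : Submodule ℝ E} (h : IsCompl 𝔭 𝔨) (hort : ∀ x ∈ 𝔭, ∀ y ∈ 𝔨, ⟪e x, e y⟫ = 0)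
    (h𝔨 : ∀ Y ∈ 𝔨, ∀ Z ∈ 𝔨, bracket E G Y Z ∈ 𝔨)
    (h𝔭 : ∀ X ∈ 𝔭, ∀ Y ∈ 𝔨, bracket E G X Y ∈ 𝔭) :
    IsTotallyGeodesic (leftMetric G e) (leftTranslate (I := 𝓘(ℝ, E)) (G := G) 𝔨) := by
  obtain ⟨Γ, hΓ⟩ := exists_isKoszulForm G e
  refine ⟨leftConnection Γ, hΓ.isLeviCivita, fun Y Z hY _ hYmem hZmem x ↦ ?_⟩
  have hderiv : leftDeriv (frameComponents Y) x (frameComponents Z x) ∈ 𝔨 :=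
    leftDeriv_mem_of_forall_mem
      (mdifferentiableAt_frameComponents (hY.mdifferentiable (by simp) x))
      (fun y ↦ mem_leftTranslate_iff.1 (hYmem y)) _
  have hΓ_mem : Γ (frameComponents Z x) (frameComponents Y x) ∈ 𝔨 :=
    hΓ.apply_mem h hort h𝔨 h𝔭 (mem_leftTranslate_iff.1 (hZmem x))
      (mem_leftTranslate_iff.1 (hYmem x))
  exact ⟨_, add_mem hderiv hΓ_mem, rfl⟩

end LeviCivita

namespace IsGrading

variable {E : Type*} [NormedAddCommGroup E] [NormedSpace ℝ E] [FiniteDimensional ℝ E]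
  {G : Type*} [TopologicalSpace G] [ChartedSpace E G] [Group G] [LieGroup 𝓘(ℝ, E) ∞ G]
  {r : ℕ} {layer : ℕ → Submodule ℝ E}

theorem exists_isTotallyGeodesic (gr : IsGrading E G r layer)
    (h : ∀ X ∈ evenHorizontal r layer, ∀ Y ∈ vertical r layer, bracket E G X Y = 0) :
    ∃ g : Bundle.ContMDiffRiemannianMetric 𝓘(ℝ, E) ∞ E (fun x : G ↦ TangentSpace 𝓘(ℝ, E) x),
      AreOrthogonal g
        (leftTranslate (I := 𝓘(ℝ, E)) (G := G) (horizontal r layer : Submodule ℝ E))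
        (leftTranslate (I := 𝓘(ℝ, E)) (G := G) (vertical r layer : Submodule ℝ E)) ∧
      IsTotallyGeodesic g
        (leftTranslate (I := 𝓘(ℝ, E)) (G := G) (vertical r layer : Submodule ℝ E)) := by
  have := FiniteDimensional.complete ℝ E
  obtain ⟨m, d, e, hort⟩ :=
    exists_equiv_inner_eq_zero_of_isCompl gr.isCompl_horizontal_vertical
  refine ⟨leftMetric G e, areOrthogonal_leftMetric hort,
    isTotallyGeodesic_leftMetric gr.isCompl_horizontal_vertical hort (fun Y hY Z hZ ↦ ?_)
      fun X hX Y hY ↦ ?_⟩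
  · rw [gr.bracket_highIdeal_eq_zero (gr.vertical_le_highIdeal hY) (gr.vertical_le_highIdeal hZ)]
    exact zero_mem _
  · rw [← oddHorizontal_sup_evenHorizontal] at hX
    obtain ⟨X₁, hX₁, X₂, hX₂, rfl⟩ := Submodule.mem_sup.1 hX
    rw [map_add, add_apply, h X₂ hX₂ Y hY, add_zero]
    exact oddHorizontal_le_horizontal (gr.bracket_oddHorizontal_vertical_mem hX₁ hY)

end IsGrading

end CarnotFoliation

end

theorem mainTheorem8
    {E : Type*} [NormedAddCommGroup E] [NormedSpace ℝ E] [FiniteDimensional ℝ E]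
    {G : Type*} [TopologicalSpace G] [T2Space G] [SecondCountableTopology G]
    [SimplyConnectedSpace G] [ChartedSpace E G] [Group G] [LieGroup 𝓘(ℝ, E) ∞ G]
    (r : ℕ) (layer : ℕ → Submodule ℝ (GroupLieAlgebra 𝓘(ℝ, E) G))
    (hlayer : CarnotFoliation.IsCarnotGrading 𝓘(ℝ, E) G r layer)
    (𝔭₁ 𝔭₂ 𝔨 : Submodule ℝ (GroupLieAlgebra 𝓘(ℝ, E) G))
    (h𝔭₁ : 𝔭₁ = CarnotFoliation.oddPart layer)
    (h𝔭₂ : 𝔭₂ = CarnotFoliation.lowEvenPart r layer)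
    (h𝔨 : 𝔨 = CarnotFoliation.highEvenPart r layer)
    (D V : Π x : G, Submodule ℝ (TangentSpace 𝓘(ℝ, E) x))
    (hD : D = CarnotFoliation.leftTranslate (𝔭₁ ⊔ 𝔭₂))
    (hV : V = CarnotFoliation.leftTranslate 𝔨)
    (K : Subgroup G) (hK : K = CarnotFoliation.connectedSubgroup 𝔨) :
    -- the metric statement
    ((∃ g : Bundle.ContMDiffRiemannianMetric 𝓘(ℝ, E) ∞ E
          (fun x : G ↦ TangentSpace 𝓘(ℝ, E) x),
        CarnotFoliation.AreOrthogonal g D V ∧ CarnotFoliation.IsTotallyGeodesic g V) ↔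
      CarnotFoliation.bracketSpan 𝓘(ℝ, E) G 𝔭₂ 𝔨 = ⊥) ∧
    -- `G ⧸ K` is a smooth manifold for the (unique) structure making `π` a submersion,
    -- `D` is an Ehresmann connection on `π`, and the principal bundle statement holds
    ∃ (m : ℕ) (_ : ChartedSpace (EuclideanSpace ℝ (Fin m)) (G ⧸ K)),
      T2Space (G ⧸ K) ∧
      IsManifold 𝓘(ℝ, EuclideanSpace ℝ (Fin m)) ∞ (G ⧸ K) ∧
      CarnotFoliation.IsSurjectiveSubmersion 𝓘(ℝ, E) 𝓘(ℝ, EuclideanSpace ℝ (Fin m))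
        (QuotientGroup.mk : G → G ⧸ K) ∧
      CarnotFoliation.IsEhresmannConnection 𝓘(ℝ, E) 𝓘(ℝ, EuclideanSpace ℝ (Fin m))
        (QuotientGroup.mk : G → G ⧸ K) D ∧
      (CarnotFoliation.CanBeMadePrincipal 𝓘(ℝ, E) 𝓘(ℝ, EuclideanSpace ℝ (Fin m))
          (QuotientGroup.mk : G → G ⧸ K) D ↔
        CarnotFoliation.bracketSpan 𝓘(ℝ, E) G 𝔭₂ 𝔨 = ⊥) := by
  let lay : ℕ → Submodule ℝ E := layer
  have gr : CarnotFoliation.IsGrading E G r lay := hlayer.isGrading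
  have hp : (𝔭₁ ⊔ 𝔭₂ : Submodule ℝ E) = CarnotFoliation.horizontal r lay := by
    rw [h𝔭₁, h𝔭₂]
    exact CarnotFoliation.oddHorizontal_sup_evenHorizontal (E := E) r lay
  have hD' : D = CarnotFoliation.leftTranslate (I := 𝓘(ℝ, E)) (G := G)
      (CarnotFoliation.horizontal r lay : Submodule ℝ E) :=
    hD.trans (congrArg (CarnotFoliation.leftTranslate (I := 𝓘(ℝ, E)) (G := G)) hp)
  have hbracket : CarnotFoliation.bracketSpan 𝓘(ℝ, E) G 𝔭₂ 𝔨 = ⊥ ↔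
      ∀ X ∈ CarnotFoliation.evenHorizontal r lay, ∀ Y ∈ CarnotFoliation.vertical r lay,
        CarnotFoliation.bracket E G X Y = 0 := by
    rw [h𝔭₂, h𝔨]
    exact CarnotFoliation.bracketSpan_eq_bot_iff
  rw [h𝔨] at hV hK
  rw [hbracket, hD', hV]
  refine ⟨⟨?_, fun h ↦ gr.exists_isTotallyGeodesic h⟩, gr.exists_chartedSpace_quotient hK⟩
  rintro ⟨g, hort, hgeo⟩ X hX Y hY
  exact gr.bracket_eq_zero_of_isTotallyGeodesic hort hgeo hX hY
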